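/- For complex $a,b,c$ with $c\notin\{0,-1,-2,\dots\}$ let ${}_2F_1(a,b;c;z)$ be the analytic continuation of the Gauss series $\sum_{n\ge 0}\frac{(a)_n(b)_n}{(c)_n\,n!}z^n$ to $\mathbb C\smallsetminus[1,\infty)$; at $z=1$ it denotes the sum of the series when $\Re(a+b-c)<0$. For $\rho,\nu\in\mathbb C$ put $$F^{(1)}_{\rho,\nu}(z)={}_2F_1\Big(\tfrac{\rho+\nu}2,\tfrac{1+\rho+\nu}2;1+\nu;z\Big),\qquad F^{(2)}_{\rho,\nu}(z)={}_2F_1\Big(\tfrac{\rho-\nu}2,\tfrac{1+\rho-\nu}2;1-\nu;z\Big),$$ $$G^{(1)}_{\rho,\nu}(z)=z^{-\frac12(\rho+\nu)}F^{(1)}_{\rho,\nu}(1/z),\qquad G^{(2)}_{\rho,\nu}(z)=z^{-\frac12(\rho-\nu)}F^{(2)}_{\rho,\nu}(1/z),$$ $$E^{(1)}_{\rho,\nu}(z)={}_2F_1\Big(\tfrac{\rho+\nu}2,\tfrac{\rho-\nu}2;\tfrac12;z\Big),\qquad E^{(2)}_{\rho,\nu}(z)={}_2F_1\Big(\tfrac{\rho+\nu+1}2,\tfrac{\rho-\nu+1}2;\tfrac32;z\Big).$$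 Let $d\in\mathbb Z$ and $\rho,\mu\in\mathbb C$ be such that $\mu\notin\mathbb Z$ and none of $\rho+\mu+d$, $\rho+\mu-d$, $\rho-\mu+d$, $\rho-\mu-d$ is a non-positive integer. Define $$C^{\rho}_{\mu,d}=-\frac{\sin(\pi(\rho+\mu))}{(2\pi)^{2\rho}\sin(\pi\mu)}\,\frac{\Gamma(\rho+\mu+d)\Gamma(\rho+\mu-d)}{\Gamma(1+\mu+d)\Gamma(1+\mu-d)},\qquad B_{\rho,\mu,d}=\frac{(-1)^d\cos(\pi\mu)-\cos(\pi\rho)}{4\pi^{2\rho+2}},$$ $$A^{(1)}_{\rho,\mu,d}=\Gamma\Big(\frac{\rho+\mu+d}2\Big)\Gamma\Big(\frac{\rho+\mu-d}2\Big)\Gamma\Big(\frac{\rho-\mu-d}2\Big)\Gamma\Big(\frac{\rho-\mu+d}2\Big),$$ $$A^{(2)}_{\rho,\mu,d}=\Gamma\Big(\frac{1+\rho+\mu+d}2\Big)\Gamma\Big(\frac{1+\rho+\mu-d}2\Big)\Gamma\Big(\frac{1+\rho-\mu-d}2\Big)\Gamma\Big(\frac{1+\rho-\mu+d}2\Big).$$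 Powers of $z$ and $\bar z$ are formed with arguments satisfying $\arg\bar z=-\arg z$. Then for all $z\ne 0$ with $\arg z\in(0,2\pi)$ $$4^{-\mu}C^{\rho}_{\mu,d}\,G^{(1)}_{\rho,\mu+d}(z)\,G^{(1)}_{\rho,\mu-d}(\bar z)+4^{\mu}C^{\rho}_{-\mu,-d}\,G^{(2)}_{\rho,\mu+d}(z)\,G^{(2)}_{\rho,\mu-d}(\bar z)$$ $$=B_{\rho,\mu,d}A^{(1)}_{\rho,\mu,d}\,E^{(1)}_{\rho,\mu+d}(z)\,E^{(1)}_{\rho,\mu-d}(\bar z)+B_{\rho,\mu,d+1}A^{(2)}_{\rho,\mu,d}\cdot 4|z|\,E^{(2)}_{\rho,\mu+d}(z)\,E^{(2)}_{\rho,\mu-d}(\bar z).\qquad(*)$$ Moreover, if $\Re\rho<\tfrac12$, there is a continuous function $f$ on the whole complex plane that equals the left-hand side of $(*)$ for every $z\notin[0,1)$ and every choice of $\arg z$, and equals the right-hand side of $(*)$ for every $z\notin(1,\infty)$. This $f$ is real-analytic on $\mathbb C\smallsetminus\{0,1\}$, and $w\mapsto f(w^2)$ is real-analytic on $\mathbb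 C\smallsetminus\{1,-1\}$. -/

import Mathlib

/-- The complex plane cut along the real half-line `[1, ∞)`. -/
def cutPlane : Set ℂ := (Complex.ofReal '' Set.Ici (1 : ℝ))ᶜ

/-- `f` continues the Gauss series `∑ (a)ₙ (b)ₙ / ((c)ₙ n!) zⁿ`, `|z| < 1`, analytically to the
plane cut along `[1, ∞)`. -/
def IsGaussContinuation (a b c : ℂ) (f : ℂ → ℂ) : Prop :=
  AnalyticOnNhd ℂ f cutPlane ∧ Set.EqOn f (ordinaryHypergeometric a b c) (Metric.ball 0 1)

/-- The analytic continuation of the Gauss series is unique. -/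
theorem IsGaussContinuation.eqOn {a b c : ℂ} {f g : ℂ → ℂ} (hf : IsGaussContinuation a b c f)
    (hg : IsGaussContinuation a b c g) : Set.EqOn f g cutPlane := by
  have h0 : (0 : ℂ) ∈ cutPlane := by
    rintro ⟨x, hx, h⟩
    have : x = 0 := by exact_mod_cast h
    simp [this] at hx
    linarith
  have hs : StarConvex ℝ (0 : ℂ) cutPlane := by
    rw [starConvex_iff_forall_pos h0]
    rintro z hz s t hs ht hst ⟨x, hx, h⟩
    apply hz
    have ht1 : t ≤ 1 := by linarith
    refine ⟨x / t, ?_, ?_⟩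
    · simp only [Set.mem_Ici] at hx ⊢
      rw [le_div_iff₀ ht]
      linarith
    · have : (t : ℂ) ≠ 0 := by exact_mod_cast ht.ne'
      simp only [smul_zero, zero_add, Complex.real_smul] at h
      rw [Complex.ofReal_div, h]
      field_simp
  refine hf.1.eqOn_of_preconnected_of_eventuallyEq hg.1
    (hs.isPathConnected h0).isConnected.isPreconnected h0 ?_
  filter_upwards [Metric.ball_mem_nhds (0 : ℂ) one_pos] with z hz
  rw [hf.2 hz, hg.2 hz]

open Classical in
/-- The hypergeometric function `₂F₁(a, b; c; z)`: the analytic continuation of the Gauss series to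
the plane cut along `[1, ∞)`. On the cut the value is that of the series itself, which is
meaningful at the point `z = 1` when `Re (a + b - c) < 0`. -/
noncomputable def hyp2F1 (a b c z : ℂ) : ℂ :=
  if h : z ∈ cutPlane ∧ ∃ f, IsGaussContinuation a b c f then h.2.choose z
  else ordinaryHypergeometric a b c z

/-- `F⁽¹⁾_{ρ,ν}(z)`. -/
noncomputable def hypF1 (ρ ν z : ℂ) : ℂ := hyp2F1 ((ρ + ν) / 2) ((1 + ρ + ν) / 2) (1 + ν) z

/-- `F⁽²⁾_{ρ,ν}(z)`. -/
noncomputable def hypF2 (ρ ν z : ℂ) : ℂ := hyp2F1 ((ρ - ν) / 2) ((1 + ρ - ν) / 2) (1 - ν) z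

/-- The power `z ^ s` formed with the argument `θ` of `z`. -/
noncomputable def powArg (z : ℂ) (θ : ℝ) (s : ℂ) : ℂ :=
  Complex.exp (s * ((Real.log ‖z‖ : ℂ) + θ * Complex.I))

/-- `G⁽¹⁾_{ρ,ν}(z) = z ^ (-(ρ + ν) / 2) F⁽¹⁾_{ρ,ν}(1 / z)`, where `z` has the argument `θ`. -/
noncomputable def hypG1 (ρ ν z : ℂ) (θ : ℝ) : ℂ :=
  powArg z θ (-(ρ + ν) / 2) * hypF1 ρ ν (1 / z)

/-- `G⁽²⁾_{ρ,ν}(z) = z ^ (-(ρ - ν) / 2) F⁽²⁾_{ρ,ν}(1 / z)`, where `z` has the argument `θ`. -/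
noncomputable def hypG2 (ρ ν z : ℂ) (θ : ℝ) : ℂ :=
  powArg z θ (-(ρ - ν) / 2) * hypF2 ρ ν (1 / z)

/-- `E⁽¹⁾_{ρ,ν}(z)`. -/
noncomputable def hypE1 (ρ ν z : ℂ) : ℂ := hyp2F1 ((ρ + ν) / 2) ((ρ - ν) / 2) (1 / 2) z

/-- `E⁽²⁾_{ρ,ν}(z)`. -/
noncomputable def hypE2 (ρ ν z : ℂ) : ℂ := hyp2F1 ((ρ + ν + 1) / 2) ((ρ - ν + 1) / 2) (3 / 2) z

/-- The constant `C^ρ_{μ,d}`. -/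
noncomputable def coeffC (ρ μ : ℂ) (d : ℤ) : ℂ :=
  -(Complex.sin (Real.pi * (ρ + μ)) /
      ((2 * Real.pi : ℂ) ^ (2 * ρ) * Complex.sin (Real.pi * μ))) *
    (Complex.Gamma (ρ + μ + d) * Complex.Gamma (ρ + μ - d) /
      (Complex.Gamma (1 + μ + d) * Complex.Gamma (1 + μ - d)))

/-- The constant `B_{ρ,μ,d}`. -/
noncomputable def coeffB (ρ μ : ℂ) (d : ℤ) : ℂ :=
  ((-1 : ℂ) ^ d * Complex.cos (Real.pi * μ) - Complex.cos (Real.pi * ρ)) /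
    (4 * (Real.pi : ℂ) ^ (2 * ρ + 2))

/-- The constant `A⁽¹⁾_{ρ,μ,d}`. -/
noncomputable def coeffA1 (ρ μ : ℂ) (d : ℤ) : ℂ :=
  Complex.Gamma ((ρ + μ + d) / 2) * Complex.Gamma ((ρ + μ - d) / 2) *
    Complex.Gamma ((ρ - μ - d) / 2) * Complex.Gamma ((ρ - μ + d) / 2)

/-- The constant `A⁽²⁾_{ρ,μ,d}`. -/
noncomputable def coeffA2 (ρ μ : ℂ) (d : ℤ) : ℂ :=
  Complex.Gamma ((1 + ρ + μ + d) / 2) * Complex.Gamma ((1 + ρ + μ - d) / 2) *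
    Complex.Gamma ((1 + ρ - μ - d) / 2) * Complex.Gamma ((1 + ρ - μ + d) / 2)

/-- The combination of solutions at infinity; if `z` has the argument `θ`, its conjugate has the
argument `-θ`. -/
noncomputable def combInfinity (ρ μ : ℂ) (d : ℤ) (z : ℂ) (θ : ℝ) : ℂ :=
  (4 : ℂ) ^ (-μ) * coeffC ρ μ d *
      hypG1 ρ (μ + d) z θ * hypG1 ρ (μ - d) (starRingEnd ℂ z) (-θ) +
    (4 : ℂ) ^ μ * coeffC ρ (-μ) (-d) *
      hypG2 ρ (μ + d) z θ * hypG2 ρ (μ - d) (starRingEnd ℂ z) (-θ)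

/-- The combination of solutions at zero. -/
noncomputable def combZero (ρ μ : ℂ) (d : ℤ) (z : ℂ) : ℂ :=
  coeffB ρ μ d * coeffA1 ρ μ d * hypE1 ρ (μ + d) z * hypE1 ρ (μ - d) (starRingEnd ℂ z) +
    coeffB ρ μ (d + 1) * coeffA2 ρ μ d * (4 * (‖z‖ : ℂ)) *
      hypE2 ρ (μ + d) z * hypE2 ρ (μ - d) (starRingEnd ℂ z)

/-! For `a = (ρ + ν) / 2`, `b = (ρ - ν) / 2`, `c = 1 / 2` the hypergeometric equation has the
solutions E⁽¹⁾ and (-z)^(1/2) E⁽²⁾ at zero, and (-z)^(-(ρ ± ν)/2) times a Gauss function of 1/z at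
infinity (`solInfinity`). Powers of -z place every branch cut on [0, ∞). The identity comes from
inserting the connection formula `solInfinity = connP · E⁽¹⁾ + connQ · (-z)^(1/2) E⁽²⁾` with ν = μ ±
d into the left-hand side and expanding. Since (-z)^(1/2) (-z̄)^(1/2) = |z|, the diagonal terms have
the shape of the right-hand side; their coefficients are evaluated by duplication, reflection and
addition formulas, and the cross terms cancel (`bilinear_connP`, `bilinear_connQ`,
`bilinear_connP_connQ`).

The connection formula avoids contour integrals. The functions at infinity have the form ₂F₁(a, a +
1/2; c), so a quadratic transformation continues them explicitly (`gaussQuad`). A Wronskian argument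
yields some linear relation on the cut unit disc (`exists_solInfinity_eq`). When Re ρ is
sufficiently negative, letting z tend to 1 from both sides of the cut and using Gauss's summation
theorem determines the coefficients (`connection_coefficients`); both sides are entire in ρ, so the
formula holds for every ρ (`solInfinity_eq`). The connection matrix for ±ν has determinant 2ν, which
is nonzero; inverting it expresses E⁽¹⁾ and E⁽²⁾ through the solutions at infinity, and thereby
continues them to the cut plane.

For the global function, the combination at zero is real-analytic off [1, ∞) apart from the factor
|z| at the origin, and the combination at infinity is so near (1, ∞); they agree off [0, ∞) and are
glued along the unit circle. Under Re ρ < 1/2 all the series converge absolutely on the closed disc,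
which gives continuity at 1. The substitution z = w² turns |z| into the polynomial w w̄. -/

section HypergeometricConnection

open Filter Topology Finset
open scoped Nat ContDiff

/-! ### The Gauss series -/

/-- The radius is exactly 1 unless a parameter is a non-positive integer. The exceptional series
terminate, including the case of `c`, because the inverse of a vanishing Pochhammer symbol is 0 by
convention. -/
theorem one_le_radius_ordinaryHypergeometricSeries (a b c : ℂ) :
    1 ≤ (ordinaryHypergeometricSeries ℂ a b c).radius := by
  by_cases ha : ∃ k : ℕ, a = -k
  · obtain ⟨k, rfl⟩ := ha
    simp [ordinaryHypergeometric_radius_top_of_neg_nat₁]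
  by_cases hb : ∃ k : ℕ, b = -k
  · obtain ⟨k, rfl⟩ := hb
    simp [ordinaryHypergeometric_radius_top_of_neg_nat₂]
  by_cases hc : ∃ k : ℕ, c = -k
  · obtain ⟨k, rfl⟩ := hc
    simp [ordinaryHypergeometric_radius_top_of_neg_nat₃]
  push Not at ha hb hc
  refine (ordinaryHypergeometricSeries_radius_eq_one ℂ a b c fun k => ⟨?_, ?_, ?_⟩).ge
  · exact fun h => ha k (by rw [h, neg_neg])
  · exact fun h => hb k (by rw [h, neg_neg])
  · exact fun h => hc k (by rw [h, neg_neg])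

theorem hasFPowerSeriesOnBall_ordinaryHypergeometric (a b c : ℂ) :
    HasFPowerSeriesOnBall (ordinaryHypergeometric a b c) (ordinaryHypergeometricSeries ℂ a b c)
      0 1 :=
  ((ordinaryHypergeometricSeries ℂ a b c).hasFPowerSeriesOnBall
    (zero_lt_one.trans_le (one_le_radius_ordinaryHypergeometricSeries a b c))).mono one_pos
    (one_le_radius_ordinaryHypergeometricSeries a b c)

theorem analyticOnNhd_ordinaryHypergeometric (a b c : ℂ) :
    AnalyticOnNhd ℂ (ordinaryHypergeometric a b c : ℂ → ℂ) (Metric.ball 0 1) := by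
  have h := (hasFPowerSeriesOnBall_ordinaryHypergeometric a b c).analyticOnNhd
  rwa [← ENNReal.ofReal_one, Metric.eball_ofReal] at h

theorem ordinaryHypergeometric_eq_tsum_coeff (a b c z : ℂ) :
    ordinaryHypergeometric a b c z = ∑' n, ordinaryHypergeometricCoefficient a b c n * z ^ n := by
  rw [ordinaryHypergeometric_eq_tsum]; rfl

theorem ordinaryHypergeometricCoefficient_zero (a b c : ℂ) :
    ordinaryHypergeometricCoefficient a b c 0 = 1 := by
  simp [ordinaryHypergeometricCoefficient]

theorem ordinaryHypergeometricCoefficient_succ {a b c : ℂ} {n : ℕ} (hc : c ≠ -n) :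
    ordinaryHypergeometricCoefficient a b c (n + 1) =
      (a + n) * (b + n) / ((n + 1) * (c + n)) * ordinaryHypergeometricCoefficient a b c n := by
  have h1 : c + n ≠ 0 := fun h => hc (by linear_combination h)
  have h2 : (n : ℂ) + 1 ≠ 0 := by exact_mod_cast n.succ_ne_zero
  simp only [ordinaryHypergeometricCoefficient, ascPochhammer_succ_eval, Nat.factorial_succ]
  push_cast
  simp only [mul_inv]
  field_simp

theorem ascPochhammer_eval_eq_prod (s : ℂ) (n : ℕ) :
    (ascPochhammer ℂ n).eval s = ∏ j ∈ range n, (s + j) := by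
  induction n with
  | zero => simp
  | succ n ih => rw [ascPochhammer_succ_eval, prod_range_succ, ih]

theorem ascPochhammer_eval_ne_zero {s : ℂ} (hs : ∀ k : ℕ, s ≠ -k) (n : ℕ) :
    (ascPochhammer ℂ n).eval s ≠ 0 := by
  rw [ascPochhammer_eval_eq_prod, prod_ne_zero_iff]
  exact fun j _ h => hs j (by linear_combination h)

/-! ### Power series and the hypergeometric equation -/

theorem HasFPowerSeriesOnBall.deriv_ofScalars {f : ℂ → ℂ} {p : FormalMultilinearSeries ℂ ℂ ℂ}
    {r : ENNReal} (h : HasFPowerSeriesOnBall f p 0 r) :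
    ∃ q : FormalMultilinearSeries ℂ ℂ ℂ, HasFPowerSeriesOnBall (deriv f) q 0 r ∧
      ∀ n, q.coeff n = (n + 1) * p.coeff (n + 1) := by
  have h1 := (ContinuousLinearMap.apply ℂ ℂ (1 : ℂ)).comp_hasFPowerSeriesOnBall h.fderiv
  refine ⟨_, h1, fun n => ?_⟩
  have := p.derivSeries_coeff_one n
  simp only [nsmul_eq_mul, Nat.cast_add, Nat.cast_one] at this
  rw [← this]
  rfl

theorem HasSum.of_forall_eq {f g : ℕ → ℂ} {s : ℂ} (h : HasSum f s) (e : ∀ n, g n = f n) :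
    HasSum g s := by
  rwa [funext e]

theorem HasSum.mul_shift {q : ℕ → ℂ} {z s : ℂ} (h0 : q 0 = 0)
    (h : HasSum (fun n => q (n + 1) * z ^ n) s) : HasSum (fun n => q n * z ^ n) (z * s) := by
  have h1 : HasSum (fun n => q (n + 1) * z ^ (n + 1)) (z * s) := by
    refine (h.mul_left z).of_forall_eq fun n => ?_
    ring
  have := (hasSum_nat_add_iff (f := fun n => q n * z ^ n) 1).1 h1
  simpa [h0] using this

theorem HasFPowerSeriesOnBall.hasSum_coeff {f : ℂ → ℂ} {p : FormalMultilinearSeries ℂ ℂ ℂ}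
    {r : ENNReal} (h : HasFPowerSeriesOnBall f p 0 r) {z : ℂ} (hz : z ∈ Metric.eball 0 r) :
    HasSum (fun n => p.coeff n * z ^ n) (f z) := by
  have := h.hasSum hz
  simpa [mul_comm] using this

/-- The left-hand side of the hypergeometric differential equation. -/
noncomputable def hypOp (a b c : ℂ) (f : ℂ → ℂ) (z : ℂ) : ℂ :=
  z * (1 - z) * deriv (deriv f) z + (c - (a + b + 1) * z) * deriv f z - a * b * f z

theorem HasFPowerSeriesOnBall.hasSum_hypOp {f : ℂ → ℂ} {p : FormalMultilinearSeries ℂ ℂ ℂ}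
    {r : ENNReal} (h : HasFPowerSeriesOnBall f p 0 r) (a b c : ℂ) {z : ℂ}
    (hz : z ∈ Metric.eball 0 r) :
    HasSum (fun n : ℕ => ((n + 1) * (c + n) * p.coeff (n + 1) - (a + n) * (b + n) * p.coeff n)
      * z ^ n) (hypOp a b c f z) := by
  obtain ⟨q, hq, hqc⟩ := h.deriv_ofScalars
  obtain ⟨s, hs, hsc⟩ := hq.deriv_ofScalars
  have e0 := h.hasSum_coeff hz
  have e1 := hq.hasSum_coeff hz
  have e2 := hs.hasSum_coeff hz
  have f1 : HasSum (fun n : ℕ => (n * p.coeff n) * z ^ n) (z * deriv f z) := by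
    apply HasSum.mul_shift (by simp)
    convert e1 using 3
    rw [hqc]; push_cast; ring
  have f2 : HasSum (fun n : ℕ => (n * (n + 1) * p.coeff (n + 1)) * z ^ n)
      (z * deriv (deriv f) z) := by
    apply HasSum.mul_shift (q := fun n : ℕ => n * (n + 1) * p.coeff (n + 1)) (by simp)
    convert e2 using 3
    rw [hsc, hqc]; push_cast; ring
  have f3 : HasSum (fun n : ℕ => (n * (n - 1) * p.coeff n) * z ^ n)
      (z * (z * deriv (deriv f) z)) := by
    apply HasSum.mul_shift (q := fun n : ℕ => n * (n - 1) * p.coeff n) (by simp)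
    convert f2 using 3
    push_cast; ring
  have := (((f2.sub f3).add (e1.mul_left c)).sub (f1.mul_left (a + b + 1))).sub
    (e0.mul_left (a * b))
  have e : hypOp a b c f z = z * deriv (deriv f) z - z * (z * deriv (deriv f) z) +
      c * deriv f z - (a + b + 1) * (z * deriv f z) - a * b * f z := by
    rw [hypOp]; ring
  rw [e]
  refine this.of_forall_eq fun n => ?_
  rw [hqc]; ring

theorem hypOp_ordinaryHypergeometric {a b c : ℂ} (hc : ∀ k : ℕ, c ≠ -k) {z : ℂ}
    (hz : z ∈ Metric.ball (0 : ℂ) 1) : hypOp a b c (ordinaryHypergeometric a b c) z = 0 := by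
  have hz' : z ∈ Metric.eball (0 : ℂ) 1 := by
    rwa [← ENNReal.ofReal_one, Metric.eball_ofReal]
  have h := (hasFPowerSeriesOnBall_ordinaryHypergeometric a b c).hasSum_hypOp a b c hz'
  refine h.unique ?_
  convert hasSum_zero with n
  have h1 : c + n ≠ 0 := fun h => hc n (by linear_combination h)
  have h2 : (n : ℂ) + 1 ≠ 0 := by exact_mod_cast n.succ_ne_zero
  have : (ordinaryHypergeometricSeries ℂ a b c).coeff =
      ordinaryHypergeometricCoefficient a b c := by
    funext n; simp [ordinaryHypergeometricSeries]
  rw [this, ordinaryHypergeometricCoefficient_succ (hc n)]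
  field_simp
  ring

/-- An analytic solution of the hypergeometric equation at `0` is a multiple of the Gauss series. -/
theorem eventuallyEq_of_hypOp_eq_zero {a b c : ℂ} (hc : ∀ k : ℕ, c ≠ -k) {f : ℂ → ℂ}
    (hf : AnalyticAt ℂ f 0) (h : ∀ᶠ z in 𝓝 0, hypOp a b c f z = 0) :
    f =ᶠ[𝓝 0] fun z => f 0 * ordinaryHypergeometric a b c z := by
  obtain ⟨p, r, hp⟩ := hf
  set d : ℕ → ℂ := fun n =>
    (n + 1) * (c + n) * p.coeff (n + 1) - (a + n) * (b + n) * p.coeff n with hd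
  have hmem : ∀ᶠ z in 𝓝 (0 : ℂ), z ∈ Metric.eball (0 : ℂ) r :=
    Metric.eball_mem_nhds _ hp.r_pos
  -- The equation says that the series with coefficients `d` represents 0. Uniqueness of power
  -- series turns this into the recurrence of the Gauss coefficients, solvable because `c + n ≠ 0`.
  have hz : HasFPowerSeriesAt (0 : ℂ → ℂ) (FormalMultilinearSeries.ofScalars ℂ d) 0 := by
    rw [hasFPowerSeriesAt_iff]
    filter_upwards [h, hmem] with z h1 h2
    have := hp.hasSum_hypOp a b c h2
    rw [h1] at this
    simpa [hd, mul_comm] using this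
  have hd0 : ∀ n, d n = 0 := by
    have := hz.eq_zero
    rw [FormalMultilinearSeries.ofScalars_series_eq_zero] at this
    exact congrFun this
  have hp0 : p.coeff 0 = f 0 := hp.coeff_zero _
  have hcoef : ∀ n, p.coeff n = f 0 * ordinaryHypergeometricCoefficient a b c n := by
    intro n
    induction n with
    | zero => rw [hp0, ordinaryHypergeometricCoefficient_zero, mul_one]
    | succ n ih =>
      have h1 : c + n ≠ 0 := fun h => hc n (by linear_combination h)
      have h2 : (n : ℂ) + 1 ≠ 0 := by exact_mod_cast n.succ_ne_zero
      have := hd0 n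
      rw [hd] at this
      simp only [ih] at this
      rw [ordinaryHypergeometricCoefficient_succ (hc n)]
      field_simp
      linear_combination this
  filter_upwards [hmem] with z hz
  rw [← (hp.hasSum_coeff hz).tsum_eq, ordinaryHypergeometric_eq_tsum_coeff, ← tsum_mul_left]
  simp only [hcoef, mul_assoc]

/-! ### Growth of the coefficients and behaviour on the closed disc -/

/-- This is Euler's limit for Γ, inverted. At `s = -k` the Pochhammer symbol is eventually 0, in
agreement with the convention `Complex.Gamma (-k) = 0` and `0⁻¹ = 0`. -/
theorem tendsto_ascPochhammer_div (s : ℂ) :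
    Tendsto (fun n : ℕ => (ascPochhammer ℂ (n + 1)).eval s / ((n : ℂ) ^ s * n !)) atTop
      (𝓝 (Complex.Gamma s)⁻¹) := by
  by_cases hs : ∀ k : ℕ, s ≠ -k
  · have h := (Complex.GammaSeq_tendsto_Gamma s).inv₀ (Complex.Gamma_ne_zero hs)
    refine h.congr fun n => ?_
    rw [Complex.GammaSeq, inv_div, ascPochhammer_eval_eq_prod]
  · push Not at hs
    obtain ⟨k, rfl⟩ := hs
    rw [Complex.Gamma_neg_nat_eq_zero, inv_zero]
    refine tendsto_const_nhds.congr' ?_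
    filter_upwards [eventually_ge_atTop k] with n hn
    rw [ascPochhammer_eval_neg_coe_nat_of_lt (by omega), zero_div]

theorem tendsto_ordinaryHypergeometricCoefficient {a b c : ℂ} (hc : ∀ k : ℕ, c ≠ -k) :
    Tendsto (fun n : ℕ => ordinaryHypergeometricCoefficient a b c (n + 1) *
      ((n : ℂ) ^ (c - a - b) * (n + 1))) atTop
      (𝓝 ((Complex.Gamma a)⁻¹ * (Complex.Gamma b)⁻¹ / (Complex.Gamma c)⁻¹)) := by
  have h := ((tendsto_ascPochhammer_div a).mul (tendsto_ascPochhammer_div b)).div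
    (tendsto_ascPochhammer_div c) (inv_ne_zero (Complex.Gamma_ne_zero hc))
  refine h.congr' ?_
  filter_upwards [eventually_gt_atTop 0] with n hn
  have hn0 : (n : ℂ) ≠ 0 := by exact_mod_cast hn.ne'
  have h2 : (n : ℂ) + 1 ≠ 0 := by exact_mod_cast n.succ_ne_zero
  have hf : (n ! : ℂ) ≠ 0 := by exact_mod_cast n.factorial_ne_zero
  have hP := ascPochhammer_eval_ne_zero hc (n + 1)
  have ha : (n : ℂ) ^ a ≠ 0 := by simp [Complex.cpow_eq_zero_iff, hn0]
  have hb : (n : ℂ) ^ b ≠ 0 := by simp [Complex.cpow_eq_zero_iff, hn0]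
  have hcc : (n : ℂ) ^ c ≠ 0 := by simp [Complex.cpow_eq_zero_iff, hn0]
  simp only [Pi.div_apply]
  rw [ordinaryHypergeometricCoefficient, Complex.cpow_sub _ _ hn0, Complex.cpow_sub _ _ hn0,
    Nat.factorial_succ]
  push_cast
  field_simp

/-- A convergent sequence is bounded. This estimate gives both absolute convergence on the closed
disc and the vanishing of the boundary term in Gauss's summation. -/
theorem exists_norm_ordinaryHypergeometricCoefficient_le {a b c : ℂ} (hc : ∀ k : ℕ, c ≠ -k) :
    ∃ C : ℝ, ∀ n : ℕ, 0 < n → ‖ordinaryHypergeometricCoefficient a b c (n + 1)‖ * (n + 1) ≤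
      C * (n : ℝ) ^ (a + b - c).re := by
  obtain ⟨C, hC⟩ := (tendsto_ordinaryHypergeometricCoefficient (a := a) (b := b)
    hc).norm.bddAbove_range
  refine ⟨C, fun n hn => ?_⟩
  have hn' : (0 : ℝ) < n := by exact_mod_cast hn
  have h : ‖ordinaryHypergeometricCoefficient a b c (n + 1)‖ *
      (‖(n : ℂ) ^ (c - a - b)‖ * ‖(n : ℂ) + 1‖) ≤ C := by
    rw [← norm_mul, ← norm_mul]
    exact hC ⟨n, rfl⟩
  rw [Complex.norm_natCast_cpow_of_pos hn] at h
  have e : ‖(n : ℂ) + 1‖ = (n : ℝ) + 1 := by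
    have : (n : ℂ) + 1 = ((n + 1 : ℕ) : ℂ) := by push_cast; rfl
    rw [this, Complex.norm_natCast]; push_cast; rfl
  rw [e] at h
  have e2 : (n : ℝ) ^ (a + b - c).re = ((n : ℝ) ^ (c - a - b).re)⁻¹ := by
    rw [← Real.rpow_neg hn'.le]
    congr 1
    simp
    ring
  have hpos : 0 < (n : ℝ) ^ (c - a - b).re := Real.rpow_pos_of_pos hn' _
  rw [e2, ← div_eq_mul_inv, le_div_iff₀ hpos]
  linarith

theorem summable_norm_ordinaryHypergeometricCoefficient {a b c : ℂ} (hc : ∀ k : ℕ, c ≠ -k)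
    (h : (a + b - c).re < 0) :
    Summable fun n => ‖ordinaryHypergeometricCoefficient a b c n‖ := by
  obtain ⟨C, hC⟩ := exists_norm_ordinaryHypergeometricCoefficient_le (a := a) (b := b) hc
  rw [← summable_nat_add_iff 2]
  have hs : Summable fun n : ℕ => C * ((n + 1 : ℕ) : ℝ) ^ ((a + b - c).re - 1) :=
    ((summable_nat_add_iff 1).2 (Real.summable_nat_rpow.2 (by linarith))).mul_left C
  refine hs.of_nonneg_of_le (fun n => norm_nonneg _) fun n => ?_
  have h1 := hC (n + 1) n.succ_pos
  have hp : (0 : ℝ) < (n + 1 : ℕ) := by positivity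
  rw [Real.rpow_sub hp, Real.rpow_one, ← mul_div_assoc, le_div_iff₀ hp]
  refine le_trans ?_ h1
  gcongr
  linarith

theorem tendsto_mul_ordinaryHypergeometricCoefficient {a b c : ℂ} (hc : ∀ k : ℕ, c ≠ -k)
    (h : (a + b - c).re < 0) :
    Tendsto (fun n : ℕ => n * ordinaryHypergeometricCoefficient a b c n) atTop (𝓝 0) := by
  obtain ⟨C, hC⟩ := exists_norm_ordinaryHypergeometricCoefficient_le (a := a) (b := b) hc
  rw [← tendsto_add_atTop_iff_nat 1]
  have ht : Tendsto (fun n : ℕ => C * (n : ℝ) ^ (a + b - c).re) atTop (𝓝 0) := by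
    have := (tendsto_rpow_neg_atTop (y := -(a + b - c).re) (by linarith)).comp
      tendsto_natCast_atTop_atTop
    simpa [Function.comp_def] using this.const_mul C
  refine squeeze_zero_norm' ?_ ht
  filter_upwards [eventually_gt_atTop 0] with n hn
  refine le_trans (le_of_eq ?_) (hC n hn)
  rw [norm_mul, Complex.norm_natCast, mul_comm]
  push_cast; rfl

theorem continuousOn_ordinaryHypergeometric {a b c : ℂ} (hc : ∀ k : ℕ, c ≠ -k)
    (h : (a + b - c).re < 0) :
    ContinuousOn (ordinaryHypergeometric a b c : ℂ → ℂ) (Metric.closedBall 0 1) := by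
  rw [funext (ordinaryHypergeometric_eq_tsum_coeff a b c)]
  refine continuousOn_tsum (fun n => by fun_prop)
    (summable_norm_ordinaryHypergeometricCoefficient hc h) fun n z hz => ?_
  rw [norm_mul, norm_pow]
  exact mul_le_of_le_one_right (norm_nonneg _)
    (pow_le_one₀ (norm_nonneg _) (by simpa using hz))

/-! ### Gauss's summation theorem -/

theorem re_add_nat_pos {c : ℂ} {n : ℕ} (h : -c.re < n) (m : ℕ) (hm : n ≤ m) : 0 < (c + m).re := by
  have : (n : ℝ) ≤ m := by exact_mod_cast hm
  simp; linarith

theorem ordinaryHypergeometricCoefficient_add_one_right {a b c : ℂ} (hc : ∀ k : ℕ, c ≠ -k)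
    (n : ℕ) : ordinaryHypergeometricCoefficient a b (c + 1) n =
      c / (c + n) * ordinaryHypergeometricCoefficient a b c n := by
  have hc' : ∀ k : ℕ, c + 1 ≠ -k := fun k h => hc (k + 1) (by push_cast; linear_combination h)
  induction n with
  | zero =>
    have := hc 0
    simp only [Nat.cast_zero, neg_zero] at this
    simp [ordinaryHypergeometricCoefficient, this]
  | succ n ih =>
    have h1 : c + n ≠ 0 := fun h => hc n (by linear_combination h)
    have h3 : c + 1 + n ≠ 0 := fun h => hc' n (by linear_combination h)
    have h4 : c + (n + 1) ≠ 0 := by rw [add_comm (n : ℂ), ← add_assoc]; exact h3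
    have h2 : (n : ℂ) + 1 ≠ 0 := by exact_mod_cast n.succ_ne_zero
    rw [ordinaryHypergeometricCoefficient_succ (hc' n),
      ordinaryHypergeometricCoefficient_succ (hc n), ih]
    push_cast
    field_simp
    ring

/-- The difference of the two series telescopes: its partial sum up to N is `-c` times N times the
N-th coefficient, which tends to 0 when `Re (a + b - c) < 0`. -/
theorem ordinaryHypergeometric_one_add_one_right {a b c : ℂ} (hc : ∀ k : ℕ, c ≠ -k)
    (h : (a + b - c).re < 0) :
    c * (c - a - b) * ordinaryHypergeometric a b c (1 : ℂ) =
      (c - a) * (c - b) * ordinaryHypergeometric a b (c + 1) (1 : ℂ) := by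
  have hc' : ∀ k : ℕ, c + 1 ≠ -k := fun k h => hc (k + 1) (by push_cast; linear_combination h)
  have h' : (a + b - (c + 1)).re < 0 := by
    simp at h ⊢; linarith
  have s1 := (summable_norm_ordinaryHypergeometricCoefficient hc h).of_norm.hasSum
  have s2 := (summable_norm_ordinaryHypergeometricCoefficient hc' h').of_norm.hasSum
  have s3 := (s1.mul_left (c * (c - a - b))).sub (s2.mul_left ((c - a) * (c - b)))
  have key : ∀ N : ℕ, ∑ n ∈ range N,
      (c * (c - a - b) * ordinaryHypergeometricCoefficient a b c n -
        (c - a) * (c - b) * ordinaryHypergeometricCoefficient a b (c + 1) n) =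
      -c * (N * ordinaryHypergeometricCoefficient a b c N) := by
    intro N
    induction N with
    | zero => simp
    | succ n ih =>
      have h1 : c + n ≠ 0 := fun h => hc n (by linear_combination h)
      have h2 : (n : ℂ) + 1 ≠ 0 := by exact_mod_cast n.succ_ne_zero
      rw [sum_range_succ, ih, ordinaryHypergeometricCoefficient_add_one_right hc,
        ordinaryHypergeometricCoefficient_succ (hc n)]
      push_cast
      field_simp
      ring
  have s4 := s3.tendsto_sum_nat
  simp only [key] at s4
  have s5 := (tendsto_mul_ordinaryHypergeometricCoefficient hc h).const_mul (-c)
  have := tendsto_nhds_unique s4 s5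
  simp only [ordinaryHypergeometric_eq_tsum_coeff, one_pow, mul_one]
  linear_combination this

theorem norm_ascPochhammer_add_ge {c : ℂ} (hc : 0 < c.re) (m n : ℕ) :
    ‖(ascPochhammer ℂ n).eval c‖ ≤ ‖(ascPochhammer ℂ n).eval (c + m)‖ := by
  rw [ascPochhammer_eval_eq_prod, ascPochhammer_eval_eq_prod, norm_prod, norm_prod]
  refine prod_le_prod (fun _ _ => norm_nonneg _) fun j _ => ?_
  rw [← sq_le_sq₀ (norm_nonneg _) (norm_nonneg _), Complex.sq_norm, Complex.sq_norm,
    Complex.normSq_apply, Complex.normSq_apply]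
  simp only [Complex.add_re, Complex.natCast_re, Complex.add_im, Complex.natCast_im, add_zero]
  have h1 : (0 : ℝ) ≤ j := j.cast_nonneg
  have h2 : (0 : ℝ) ≤ m := m.cast_nonneg
  nlinarith [mul_nonneg h2 h2, mul_nonneg h1 h2, mul_nonneg h2 hc.le]

/-- Dominated convergence: every term with n ≥ 1 has a denominator growing with m, so only the
constant term survives. Iterating the contiguous relation up to this limit proves Gauss's theorem.
-/
theorem tendsto_ordinaryHypergeometric_one_add_nat {a b c : ℂ}
    (h : (a + b - c).re < 0) :
    Tendsto (fun m : ℕ => ordinaryHypergeometric a b (c + m) (1 : ℂ)) atTop (𝓝 1) := by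
  -- After shifting so that `c + m₀` has positive real part, further shifts only increase the
  -- modulus of each factor of the denominator; the series at `c + m₀` is then the dominating one.
  obtain ⟨m₀, hm₀⟩ := exists_nat_gt (-c.re)
  have hre : 0 < (c + m₀).re := re_add_nat_pos hm₀ m₀ le_rfl
  have hc₀ : ∀ k : ℕ, c + m₀ ≠ -k := fun k hk => by
    rw [hk] at hre; simp at hre; linarith [k.cast_nonneg (α := ℝ)]
  have h₀ : (a + b - (c + m₀)).re < 0 := by
    simp at h ⊢; linarith [m₀.cast_nonneg (α := ℝ)]
  rw [← tendsto_add_atTop_iff_nat m₀]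
  simp only [ordinaryHypergeometric_eq_tsum_coeff, one_pow, mul_one]
  have hsum : ∑' n : ℕ, (if n = 0 then (1 : ℂ) else 0) = 1 := tsum_ite_eq 0 _
  rw [← hsum]
  refine tendsto_tsum_of_dominated_convergence
    (summable_norm_ordinaryHypergeometricCoefficient hc₀ h₀) (fun n => ?_)
    (Eventually.of_forall fun m n => ?_)
  · rcases n with _ | n
    · simp [ordinaryHypergeometricCoefficient]
    · simp only [Nat.add_eq_zero_iff, one_ne_zero, and_false, if_false]
      have ht : Tendsto (fun m : ℕ =>
          ‖((ascPochhammer ℂ (n + 1)).eval (c + (m + m₀ : ℕ)))⁻¹‖) atTop (𝓝 0) := by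
        have hb : Tendsto (fun m : ℕ => (m : ℝ)⁻¹ *
            ‖(ascPochhammer ℂ n).eval (c + m₀ + 1)‖⁻¹) atTop (𝓝 0) := by
          simpa using (tendsto_inv_atTop_nhds_zero_nat (𝕜 := ℝ)).mul_const _
        refine squeeze_zero' (Eventually.of_forall fun _ => norm_nonneg _) ?_ hb
        filter_upwards [eventually_gt_atTop 0] with m hm
        rw [norm_inv, ← mul_inv]
        have hm' : (0 : ℝ) < m := by exact_mod_cast hm
        have hre1 : 0 < (c + m₀ + 1).re := by simp at hre ⊢; linarith
        have hne : 0 < ‖(ascPochhammer ℂ n).eval (c + m₀ + 1)‖ := by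
          rw [norm_pos_iff]
          refine ascPochhammer_eval_ne_zero (fun k hk => ?_) n
          rw [hk] at hre1; simp at hre1; linarith [k.cast_nonneg (α := ℝ)]
        refine inv_anti₀ (by positivity) ?_
        have hsplit : (ascPochhammer ℂ (n + 1)).eval (c + (m + m₀ : ℕ)) =
            (c + (m + m₀ : ℕ)) * (ascPochhammer ℂ n).eval (c + m₀ + 1 + m) := by
          rw [ascPochhammer_eval_eq_prod, ascPochhammer_eval_eq_prod, prod_range_succ', mul_comm]
          congr 1
          · simp
          · refine prod_congr rfl fun j _ => ?_
            push_cast; ring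
        rw [hsplit, norm_mul]
        gcongr
        · calc (m : ℝ) ≤ (c + (m + m₀ : ℕ)).re := by simp at hre ⊢; linarith
            _ ≤ _ := Complex.re_le_norm _
        · exact norm_ascPochhammer_add_ge hre1 m n
      have ht' := tendsto_zero_iff_norm_tendsto_zero.2 ht
      simpa [ordinaryHypergeometricCoefficient] using ht'.const_mul
        (((n + 1)! : ℂ)⁻¹ * (ascPochhammer ℂ (n + 1)).eval a * (ascPochhammer ℂ (n + 1)).eval b)
  · have e : c + ((m + m₀ : ℕ) : ℂ) = c + m₀ + m := by push_cast; ring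
    rw [e]
    simp only [ordinaryHypergeometricCoefficient, norm_mul, norm_inv]
    gcongr
    · exact norm_pos_iff.2 (ascPochhammer_eval_ne_zero hc₀ n)
    · exact norm_ascPochhammer_add_ge hre m n

theorem ordinaryHypergeometric_one_eq_prod {a b c : ℂ} (hc : ∀ k : ℕ, c ≠ -k)
    (h : (a + b - c).re < 0) (m : ℕ) :
    (ascPochhammer ℂ m).eval c * (ascPochhammer ℂ m).eval (c - a - b) *
      ordinaryHypergeometric a b c (1 : ℂ) =
    (ascPochhammer ℂ m).eval (c - a) * (ascPochhammer ℂ m).eval (c - b) *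
      ordinaryHypergeometric a b (c + m) (1 : ℂ) := by
  induction m with
  | zero => simp
  | succ m ih =>
    have hc' : ∀ k : ℕ, c + m ≠ -k := fun k hk =>
      hc (k + m) (by push_cast; linear_combination hk)
    have h' : (a + b - (c + m)).re < 0 := by
      simp at h ⊢; linarith [m.cast_nonneg (α := ℝ)]
    have := ordinaryHypergeometric_one_add_one_right hc' h'
    simp only [ascPochhammer_succ_eval]
    have e : c + ((m + 1 : ℕ) : ℂ) = c + m + 1 := by push_cast; ring
    rw [e]
    linear_combination (c + m) * (c - a - b + m) * ih +
      (ascPochhammer ℂ m).eval (c - a) * (ascPochhammer ℂ m).eval (c - b) * this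

/-- **Gauss's summation theorem**. -/
theorem ordinaryHypergeometric_one {a b c : ℂ} (hc : ∀ k : ℕ, c ≠ -k)
    (h : (a + b - c).re < 0) :
    ordinaryHypergeometric a b c (1 : ℂ) = Complex.Gamma c * Complex.Gamma (c - a - b) *
      (Complex.Gamma (c - a))⁻¹ * (Complex.Gamma (c - b))⁻¹ := by
  have hcab : ∀ k : ℕ, c - a - b ≠ -k := fun k hk => by
    have : (a + b - c) = k := by linear_combination -hk
    rw [this] at h; simp at h; linarith [k.cast_nonneg (α := ℝ)]
  have g1 := Complex.Gamma_ne_zero hc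
  have g2 := Complex.Gamma_ne_zero hcab
  have lim1 := ((tendsto_ascPochhammer_div c).mul (tendsto_ascPochhammer_div (c - a - b))).mul_const
    (ordinaryHypergeometric a b c (1 : ℂ))
  have lim2 := ((tendsto_ascPochhammer_div (c - a)).mul
    (tendsto_ascPochhammer_div (c - b))).mul
    ((tendsto_ordinaryHypergeometric_one_add_nat h).comp (tendsto_add_atTop_nat 1))
  have heq := tendsto_nhds_unique_of_eventuallyEq lim1 lim2 (by
    filter_upwards [eventually_gt_atTop 0] with n hn
    have hn0 : (n : ℂ) ≠ 0 := by exact_mod_cast hn.ne'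
    have hp := ordinaryHypergeometric_one_eq_prod hc h (n + 1)
    -- The powers of n in the four Euler limits cancel because c + (c - a - b) = (c - a) + (c - b).
    have e : (n : ℂ) ^ c * (n : ℂ) ^ (c - a - b) = (n : ℂ) ^ (c - a) * (n : ℂ) ^ (c - b) := by
      rw [← Complex.cpow_add _ _ hn0, ← Complex.cpow_add _ _ hn0]; congr 1; ring
    rw [div_mul_div_comm, div_mul_div_comm, Function.comp_apply, div_mul_eq_mul_div, hp,
      mul_div_right_comm]
    congr 2
    linear_combination (n ! : ℂ) ^ 2 * e)
  field_simp at heq ⊢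
  linear_combination heq

/-! ### Dependence on the parameters -/

theorem norm_ascPochhammer_eval_le {a : ℂ} {R : ℝ} (h : ‖a‖ ≤ R) (n : ℕ) :
    ‖(ascPochhammer ℂ n).eval a‖ ≤ ‖(ascPochhammer ℂ n).eval (R : ℂ)‖ := by
  rw [ascPochhammer_eval_eq_prod, ascPochhammer_eval_eq_prod, norm_prod, norm_prod]
  refine prod_le_prod (fun _ _ => norm_nonneg _) fun j _ => ?_
  have hR : 0 ≤ R := (norm_nonneg _).trans h
  calc ‖a + j‖ ≤ ‖a‖ + ‖(j : ℂ)‖ := norm_add_le _ _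
    _ ≤ R + j := by rw [Complex.norm_natCast]; linarith
    _ = ‖(R : ℂ) + j‖ := by
      have : (R : ℂ) + j = ((R + j : ℝ) : ℂ) := by push_cast; rfl
      rw [this, Complex.norm_real, Real.norm_of_nonneg (by positivity)]

theorem summable_norm_ordinaryHypergeometricCoefficient_mul_pow (a b c : ℂ) {z : ℂ}
    (hz : ‖z‖ < 1) :
    Summable fun n => ‖ordinaryHypergeometricCoefficient a b c n‖ * ‖z‖ ^ n := by
  have h := (ordinaryHypergeometricSeries ℂ a b c).summable_norm_apply (x := z) (by
    refine Metric.eball_subset_eball (one_le_radius_ordinaryHypergeometricSeries a b c) ?_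
    rw [← ENNReal.ofReal_one, Metric.eball_ofReal]
    simpa using hz)
  refine h.congr fun n => ?_
  rw [ordinaryHypergeometricSeries_apply_eq, smul_eq_mul, norm_mul, norm_pow]

/-- Locally in `t` both parameters have modulus below a fixed R, and |(a)ₙ| ≤ (R)ₙ, so the series
with numerator parameters R, R gives a uniform summable bound on holomorphic terms. -/
theorem differentiable_ordinaryHypergeometric_param {α β : ℂ → ℂ} (hα : Differentiable ℂ α)
    (hβ : Differentiable ℂ β) (c : ℂ) {z : ℂ} (hz : ‖z‖ < 1) :
    Differentiable ℂ fun t => ordinaryHypergeometric (α t) (β t) c z := by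
  intro t₀
  set R : ℝ := ‖α t₀‖ + ‖β t₀‖ + 1
  have hU : IsOpen {t | ‖α t‖ < R ∧ ‖β t‖ < R} :=
    (isOpen_lt hα.continuous.norm continuous_const).inter
      (isOpen_lt hβ.continuous.norm continuous_const)
  have ht₀ : t₀ ∈ {t | ‖α t‖ < R ∧ ‖β t‖ < R} :=
    ⟨by simp only [R]; linarith [norm_nonneg (β t₀)],
      by simp only [R]; linarith [norm_nonneg (α t₀)]⟩
  simp only [ordinaryHypergeometric_eq_tsum_coeff]
  refine (Complex.differentiableOn_tsum_of_summable_norm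
    (summable_norm_ordinaryHypergeometricCoefficient_mul_pow R R c hz) (fun n => ?_) hU
    fun n t ht => ?_).differentiableAt (hU.mem_nhds ht₀)
  · simp only [ordinaryHypergeometricCoefficient]
    have h1 : Differentiable ℂ fun t => (ascPochhammer ℂ n).eval (α t) :=
      (ascPochhammer ℂ n).differentiable.comp hα
    have h2 : Differentiable ℂ fun t => (ascPochhammer ℂ n).eval (β t) :=
      (ascPochhammer ℂ n).differentiable.comp hβ
    exact (((h1.const_mul _).mul h2).mul_const _ |>.mul_const _).differentiableOn
  · rw [norm_mul, norm_pow]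
    simp only [ordinaryHypergeometricCoefficient, norm_mul]
    gcongr
    · exact norm_ascPochhammer_eval_le ht.1.le n
    · exact norm_ascPochhammer_eval_le ht.2.le n

/-! ### Changes of variable in the hypergeometric equation -/

/-- The factor `u` enters through its logarithmic derivative `m`, so it factors out of both
derivatives. Verifying a transformed equation then reduces to a rational identity. -/
theorem deriv_mul_comp {u w m n m' n' H : ℂ → ℂ} {U V : Set ℂ} (hU : IsOpen U)
    (hu : ∀ z ∈ U, HasDerivAt u (u z * m z) z) (hw : ∀ z ∈ U, HasDerivAt w (n z) z)
    (hH : AnalyticOnNhd ℂ H V) (hUV : ∀ z ∈ U, w z ∈ V) {z : ℂ} (hz : z ∈ U)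
    (hm : HasDerivAt m (m' z) z) (hn : HasDerivAt n (n' z) z) :
    deriv (fun z => u z * H (w z)) z = u z * (m z * H (w z) + n z * deriv H (w z)) ∧
    deriv (deriv fun z => u z * H (w z)) z = u z * ((m z ^ 2 + m' z) * H (w z) +
      (2 * m z * n z + n' z) * deriv H (w z) + n z ^ 2 * deriv (deriv H) (w z)) := by
  have hHw : ∀ z ∈ U, HasDerivAt (fun z => H (w z)) (deriv H (w z) * n z) z := fun z hz =>
    ((hH _ (hUV z hz)).differentiableAt.hasDerivAt).comp z (hw z hz)
  have hHw' : ∀ z ∈ U, HasDerivAt (fun z => deriv H (w z)) (deriv (deriv H) (w z) * n z) z :=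
    fun z hz => ((hH _ (hUV z hz)).deriv.differentiableAt.hasDerivAt).comp z (hw z hz)
  have h1 : ∀ z ∈ U, HasDerivAt (fun z => u z * H (w z))
      (u z * (m z * H (w z) + n z * deriv H (w z))) z := fun z hz => by
    refine ((hu z hz).mul (hHw z hz)).congr_deriv ?_
    ring
  refine ⟨(h1 z hz).deriv, ?_⟩
  have he : deriv (fun z => u z * H (w z)) =ᶠ[𝓝 z]
      fun z => u z * (m z * H (w z) + n z * deriv H (w z)) := by
    filter_upwards [hU.mem_nhds hz] with y hy
    exact (h1 y hy).deriv
  rw [he.deriv_eq]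
  have h2 := (hu z hz).mul ((hm.mul (hHw z hz)).add (hn.mul (hHw' z hz)))
  refine Eq.trans h2.deriv ?_
  simp only [Pi.mul_apply, Pi.add_apply]
  ring

/-! ### The cut plane -/

theorem mem_cutPlane_iff {z : ℂ} : z ∈ cutPlane ↔ 1 - z ∈ Complex.slitPlane := by
  rw [Complex.mem_slitPlane_iff, cutPlane, Set.mem_compl_iff, ← not_iff_not, not_not]
  simp only [Complex.sub_re, Complex.one_re, Complex.sub_im, Complex.one_im, not_or, not_lt, ne_eq,
    not_not, Set.mem_image, Set.mem_Ici]
  constructor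
  · rintro ⟨x, hx, rfl⟩
    simpa using hx
  · rintro ⟨h1, h2⟩
    refine ⟨z.re, by linarith, ?_⟩
    apply Complex.ext <;> simp
    linarith

theorem isOpen_cutPlane : IsOpen cutPlane := by
  have : cutPlane = (fun z => 1 - z) ⁻¹' Complex.slitPlane := by
    ext z; exact mem_cutPlane_iff
  rw [this]
  exact Complex.isOpen_slitPlane.preimage (by fun_prop)

theorem ball_subset_cutPlane : Metric.ball (0 : ℂ) 1 ⊆ cutPlane := by
  intro z hz
  rw [mem_cutPlane_iff, Complex.mem_slitPlane_iff]
  left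
  have : z.re < 1 := (Complex.re_le_norm z).trans_lt (by simpa using hz)
  simpa using this

/-- Near 0 the equation and the value `f 0 = 1` single out the Gauss series, so any solution on the
whole cut plane with this value is its continuation. -/
theorem IsGaussContinuation.of_hypOp {a b c : ℂ} (hc : ∀ k : ℕ, c ≠ -k) {f : ℂ → ℂ}
    (hf : AnalyticOnNhd ℂ f cutPlane) (h : ∀ z ∈ cutPlane, hypOp a b c f z = 0) (h0 : f 0 = 1) :
    IsGaussContinuation a b c f := by
  refine ⟨hf, ?_⟩
  have h0mem : (0 : ℂ) ∈ Metric.ball (0 : ℂ) 1 := by simp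
  refine (hf.mono ball_subset_cutPlane).eqOn_of_preconnected_of_eventuallyEq
    (analyticOnNhd_ordinaryHypergeometric a b c) (convex_ball _ _).isPreconnected h0mem ?_
  have := eventuallyEq_of_hypOp_eq_zero hc (hf 0 (ball_subset_cutPlane h0mem))
    (Filter.mem_of_superset (isOpen_cutPlane.mem_nhds (ball_subset_cutPlane h0mem)) h)
  simpa [h0] using this

/-! ### A quadratic transformation -/

/-- The square root of `1 - z` with positive real part on the cut plane. -/
noncomputable def sqrtOneSub (z : ℂ) : ℂ := (1 - z) ^ (1 / 2 : ℂ)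

theorem sqrtOneSub_sq (z : ℂ) : sqrtOneSub z ^ 2 = 1 - z := by
  rw [sqrtOneSub, one_div]
  exact Complex.cpow_nat_inv_pow _ two_ne_zero

theorem re_cpow_half_pos {z : ℂ} (hz : z ∈ Complex.slitPlane) : 0 < (z ^ (1 / 2 : ℂ)).re := by
  have hz0 : z ≠ 0 := Complex.slitPlane_ne_zero hz
  have harg := Complex.mem_slitPlane_iff_arg.1 hz
  rw [Complex.cpow_def_of_ne_zero hz0, Complex.exp_re]
  refine mul_pos (Real.exp_pos _) (Real.cos_pos_of_mem_Ioo ?_)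
  have e : (Complex.log z * (1 / 2)).im = z.arg / 2 := by
    simp [Complex.log_im]; ring
  rw [e]
  have h1 := Complex.neg_pi_lt_arg z
  have h2 := lt_of_le_of_ne (Complex.arg_le_pi z) harg.1
  constructor <;> linarith

theorem re_sqrtOneSub_pos {z : ℂ} (hz : z ∈ cutPlane) : 0 < (sqrtOneSub z).re :=
  re_cpow_half_pos (mem_cutPlane_iff.1 hz)

theorem ne_zero_of_re_pos' {r : ℂ} (h : 0 < r.re) : r ≠ 0 := by
  rintro rfl; simp at h

theorem one_add_ne_zero_of_re_pos {r : ℂ} (h : 0 < r.re) : 1 + r ≠ 0 :=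
  ne_zero_of_re_pos' (by simp; linarith)

theorem norm_one_sub_div_one_add_lt {r : ℂ} (h : 0 < r.re) : ‖(1 - r) / (1 + r)‖ < 1 := by
  rw [norm_div, div_lt_one (norm_pos_iff.2 (one_add_ne_zero_of_re_pos h)),
    ← sq_lt_sq₀ (norm_nonneg _) (norm_nonneg _), Complex.sq_norm, Complex.sq_norm,
    Complex.normSq_apply, Complex.normSq_apply]
  simp
  nlinarith

theorem hasDerivAt_sqrtOneSub {z : ℂ} (hz : z ∈ cutPlane) :
    HasDerivAt sqrtOneSub (-1 / (2 * sqrtOneSub z)) z := by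
  have h1 : HasDerivAt (fun z : ℂ => 1 - z) (-1) z := (hasDerivAt_id z).const_sub 1
  have h2 := h1.cpow_const (c := (1 / 2 : ℂ)) (mem_cutPlane_iff.1 hz)
  have hne : 1 - z ≠ 0 := Complex.slitPlane_ne_zero (mem_cutPlane_iff.1 hz)
  have hr := ne_zero_of_re_pos' (re_sqrtOneSub_pos hz)
  have hs := sqrtOneSub_sq z
  refine h2.congr_deriv ?_
  rw [Complex.cpow_sub _ _ hne, Complex.cpow_one]
  change 1 / 2 * (sqrtOneSub z / (1 - z)) * -1 = _
  rw [← hs]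
  field_simp

/-- The continuation of `₂F₁(a, a + 1/2; c; z)` obtained from a quadratic transformation. -/
noncomputable def gaussQuad (a c z : ℂ) : ℂ :=
  ((1 + sqrtOneSub z) / 2) ^ (-(2 * a)) *
    ordinaryHypergeometric (2 * a) (2 * a - c + 1) c ((1 - sqrtOneSub z) / (1 + sqrtOneSub z))

theorem gaussQuad_zero (a c : ℂ) : gaussQuad a c 0 = 1 := by
  simp [gaussQuad, sqrtOneSub]

theorem half_one_add_mem_slitPlane {r : ℂ} (h : 0 < r.re) : (1 + r) / 2 ∈ Complex.slitPlane := by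
  left
  have : (1 + r) / 2 = ((1 / 2 : ℝ) : ℂ) * (1 + r) := by push_cast; ring
  rw [this, Complex.re_ofReal_mul]
  simp; linarith

theorem hasDerivAt_half_one_add_cpow (s : ℂ) {z : ℂ} (hz : z ∈ cutPlane) :
    HasDerivAt (fun z => ((1 + sqrtOneSub z) / 2) ^ s)
      (((1 + sqrtOneSub z) / 2) ^ s * (-s / (2 * sqrtOneSub z * (1 + sqrtOneSub z)))) z := by
  have hre := re_sqrtOneSub_pos hz
  have h1 := (((hasDerivAt_sqrtOneSub hz).const_add 1).div_const 2).cpow_const (c := s)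
    (half_one_add_mem_slitPlane hre)
  refine h1.congr_deriv ?_
  have hne := Complex.slitPlane_ne_zero (half_one_add_mem_slitPlane hre)
  have hr := ne_zero_of_re_pos' hre
  have hr1 := one_add_ne_zero_of_re_pos hre
  rw [Complex.cpow_sub _ _ hne, Complex.cpow_one]
  field_simp

theorem hasDerivAt_cayley_sqrtOneSub {z : ℂ} (hz : z ∈ cutPlane) :
    HasDerivAt (fun z => (1 - sqrtOneSub z) / (1 + sqrtOneSub z))
      (1 / (sqrtOneSub z * (1 + sqrtOneSub z) ^ 2)) z := by
  have hre := re_sqrtOneSub_pos hz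
  have hr := ne_zero_of_re_pos' hre
  have hr1 := one_add_ne_zero_of_re_pos hre
  have h := hasDerivAt_sqrtOneSub hz
  refine ((h.const_sub 1).div (h.const_add 1) hr1).congr_deriv ?_
  field_simp
  ring

theorem analyticOnNhd_gaussQuad (a c : ℂ) : AnalyticOnNhd ℂ (gaussQuad a c) cutPlane := by
  refine DifferentiableOn.analyticOnNhd (fun z hz => ?_) isOpen_cutPlane
  refine DifferentiableAt.differentiableWithinAt ?_
  refine (hasDerivAt_half_one_add_cpow _ hz).differentiableAt.mul ?_
  exact (analyticOnNhd_ordinaryHypergeometric _ _ _ _ (by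
    simpa using norm_one_sub_div_one_add_lt (re_sqrtOneSub_pos hz))).differentiableAt.comp z
    (hasDerivAt_cayley_sqrtOneSub hz).differentiableAt

/-- The square root takes the cut plane into the right half-plane, which the Cayley map sends into
the unit disc. There the inner Gauss series converges and satisfies its own equation, which is
pulled back to `z`. -/
theorem hypOp_gaussQuad {a c : ℂ} (hc : ∀ k : ℕ, c ≠ -k) {z : ℂ} (hz : z ∈ cutPlane) :
    hypOp a (a + 1 / 2) c (gaussQuad a c) z = 0 := by
  have hre := re_sqrtOneSub_pos hz
  have hr := ne_zero_of_re_pos' hre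
  have hr1 := one_add_ne_zero_of_re_pos hre
  have hV : ∀ z ∈ cutPlane, (1 - sqrtOneSub z) / (1 + sqrtOneSub z) ∈ Metric.ball (0 : ℂ) 1 :=
    fun z hz => by simpa using norm_one_sub_div_one_add_lt (re_sqrtOneSub_pos hz)
  have hs := sqrtOneSub_sq z
  have hd := hasDerivAt_sqrtOneSub hz
  obtain ⟨e1, e2⟩ := deriv_mul_comp (u := fun z => ((1 + sqrtOneSub z) / 2) ^ (-(2 * a)))
    (w := fun z => (1 - sqrtOneSub z) / (1 + sqrtOneSub z))
    (m := fun z => -(-(2 * a)) / (2 * sqrtOneSub z * (1 + sqrtOneSub z)))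
    (n := fun z => 1 / (sqrtOneSub z * (1 + sqrtOneSub z) ^ 2))
    (m' := fun z => a * (1 + 2 * sqrtOneSub z) /
      (2 * sqrtOneSub z ^ 3 * (1 + sqrtOneSub z) ^ 2))
    (n' := fun z => (1 + 3 * sqrtOneSub z) / (2 * sqrtOneSub z ^ 3 * (1 + sqrtOneSub z) ^ 3))
    isOpen_cutPlane (fun z hz => hasDerivAt_half_one_add_cpow _ hz)
    (fun z hz => hasDerivAt_cayley_sqrtOneSub hz)
    (analyticOnNhd_ordinaryHypergeometric (2 * a) (2 * a - c + 1) c) hV hz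
    (by
      refine ((hasDerivAt_const z _).div ((hd.const_mul 2).mul (hd.const_add 1))
        (by simp [hr, hr1])).congr_deriv ?_
      simp only [Pi.mul_apply]
      field_simp
      ring)
    (by
      refine ((hasDerivAt_const z _).div (hd.mul ((hd.const_add 1).pow 2))
        (by simp [hr, hr1])).congr_deriv ?_
      simp only [Pi.pow_apply, Pi.mul_apply]
      field_simp
      ring)
  have hode := hypOp_ordinaryHypergeometric (a := 2 * a) (b := 2 * a - c + 1) hc (hV z hz)
  have hz1 : z = 1 - sqrtOneSub z ^ 2 := by linear_combination hs
  rw [hypOp] at hode ⊢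
  have hg : gaussQuad a c = fun z => ((1 + sqrtOneSub z) / 2) ^ (-(2 * a)) *
    ordinaryHypergeometric (2 * a) (2 * a - c + 1) c
      ((1 - sqrtOneSub z) / (1 + sqrtOneSub z)) := rfl
  rw [hg, e1, e2]
  generalize (ordinaryHypergeometric (2 * a) (2 * a - c + 1) c : ℂ → ℂ) = H at *
  clear e1 e2 hg hd hs
  dsimp only
  generalize H ((1 - sqrtOneSub z) / (1 + sqrtOneSub z)) = h0 at *
  generalize deriv H ((1 - sqrtOneSub z) / (1 + sqrtOneSub z)) = h1 at *
  generalize deriv (deriv H) ((1 - sqrtOneSub z) / (1 + sqrtOneSub z)) = h2 at *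
  generalize ((1 + sqrtOneSub z) / 2) ^ (-(2 * a)) = u at *
  generalize sqrtOneSub z = r at *
  rw [hz1]
  -- With r = √(1 - z) all coefficients are rational in r, and the operator in z applied to u · H(w)
  -- is u / (2r(1 + r)) times the operator in w applied to H.
  linear_combination (norm := skip) u / (2 * r * (1 + r)) * hode
  field_simp
  ring

theorem isGaussContinuation_gaussQuad (a : ℂ) {c : ℂ} (hc : ∀ k : ℕ, c ≠ -k) :
    IsGaussContinuation a (a + 1 / 2) c (gaussQuad a c) :=
  .of_hypOp hc (analyticOnNhd_gaussQuad a c) (fun _ hz => hypOp_gaussQuad hc hz)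
    (gaussQuad_zero a c)

/-! ### Solutions on the plane cut along the positive reals -/

/-- The complex plane cut along the real half-line `[0, ∞)`. -/
def posCutPlane : Set ℂ := {z | -z ∈ Complex.slitPlane}

theorem isOpen_posCutPlane : IsOpen posCutPlane :=
  Complex.isOpen_slitPlane.preimage continuous_neg

theorem ne_zero_of_mem_posCutPlane {z : ℂ} (hz : z ∈ posCutPlane) : z ≠ 0 :=
  neg_ne_zero.1 (Complex.slitPlane_ne_zero hz)

theorem mem_posCutPlane_iff {z : ℂ} : z ∈ posCutPlane ↔ z ∉ Complex.ofReal '' Set.Ici (0 : ℝ) := by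
  rw [posCutPlane, Set.mem_ofPred_eq, Complex.mem_slitPlane_iff, ← not_iff_not, not_not]
  simp only [Complex.neg_re, Complex.neg_im, not_or, not_lt, ne_eq, not_not, Set.mem_image,
    Set.mem_Ici]
  constructor
  · rintro ⟨h1, h2⟩
    refine ⟨z.re, by linarith, ?_⟩
    apply Complex.ext <;> simp
    linarith
  · rintro ⟨x, hx, rfl⟩
    simpa using hx

theorem posCutPlane_subset_cutPlane : posCutPlane ⊆ cutPlane := by
  intro z hz
  rw [mem_posCutPlane_iff] at hz
  rintro ⟨x, hx, rfl⟩
  exact hz ⟨x, Set.mem_Ici.2 (zero_le_one.trans (Set.mem_Ici.1 hx)), rfl⟩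

theorem one_div_mem_cutPlane {z : ℂ} (hz : z ∈ posCutPlane) : 1 / z ∈ cutPlane := by
  rw [mem_posCutPlane_iff] at hz
  rintro ⟨x, hx, h⟩
  have hx' : (1 : ℝ) ≤ x := hx
  refine hz ⟨x⁻¹, Set.mem_Ici.2 (inv_nonneg.2 (zero_le_one.trans hx')), ?_⟩
  rw [Complex.ofReal_inv, h, one_div, inv_inv]

theorem hasDerivAt_neg_cpow (s : ℂ) {z : ℂ} (hz : z ∈ posCutPlane) :
    HasDerivAt (fun z : ℂ => (-z) ^ s) ((-z) ^ s * (s / z)) z := by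
  have h := (hasDerivAt_neg z).cpow_const (c := s) hz
  have hz0 := ne_zero_of_mem_posCutPlane hz
  refine h.congr_deriv ?_
  rw [Complex.cpow_sub _ _ (neg_ne_zero.2 hz0), Complex.cpow_one]
  field_simp

theorem analyticAt_neg_cpow (s : ℂ) {z : ℂ} (hz : z ∈ posCutPlane) :
    AnalyticAt ℂ (fun z : ℂ => (-z) ^ s) z :=
  DifferentiableOn.analyticAt (s := posCutPlane)
    (fun _ hy => (hasDerivAt_neg_cpow s hy).differentiableAt.differentiableWithinAt)
    (isOpen_posCutPlane.mem_nhds hz)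

/-- Kummer's solution at infinity with exponent `a`. For `c = 1 / 2` the second parameter `a - c +
1` is `a + 1 / 2`, the case covered by the quadratic transformation. -/
theorem hypOp_neg_cpow_mul_comp_one_div {a b c : ℂ} {H : ℂ → ℂ} (hH : AnalyticOnNhd ℂ H cutPlane)
    (h : ∀ z ∈ cutPlane, hypOp a (a - c + 1) (a - b + 1) H z = 0) {z : ℂ} (hz : z ∈ posCutPlane) :
    hypOp a b c (fun z => (-z) ^ (-a) * H (1 / z)) z = 0 := by
  have hz0 := ne_zero_of_mem_posCutPlane hz
  obtain ⟨e1, e2⟩ := deriv_mul_comp (u := fun z => (-z) ^ (-a)) (w := fun z => 1 / z)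
    (m := fun z => -a / z) (n := fun z => -1 / z ^ 2) (m' := fun z => a / z ^ 2)
    (n' := fun z => 2 / z ^ 3) isOpen_posCutPlane (fun z hz => hasDerivAt_neg_cpow _ hz)
    (fun z hz => by
      have hz0 := ne_zero_of_mem_posCutPlane hz
      refine ((hasDerivAt_const z (1 : ℂ)).div (hasDerivAt_id' z) hz0).congr_deriv ?_
      simp)
    hH (fun z hz => one_div_mem_cutPlane hz) hz
    (by
      refine ((hasDerivAt_const z (-a)).div (hasDerivAt_id' z) hz0).congr_deriv ?_
      simp)
    (by
      refine ((hasDerivAt_const z (-1 : ℂ)).div (hasDerivAt_pow 2 z) (by simp [hz0])).congr_deriv ?_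
      field_simp
      norm_num
      ring)
  have hode := h _ (one_div_mem_cutPlane hz)
  rw [hypOp] at hode ⊢
  rw [e1, e2]
  generalize H (1 / z) = h0 at *
  generalize deriv H (1 / z) = h1 at *
  generalize deriv (deriv H) (1 / z) = h2 at *
  generalize (-z) ^ (-a) = u at *
  linear_combination (norm := skip) (-u / z) * hode
  field_simp
  ring

/-- The second local exponent at zero, `1 - c`. A power of `-z` differs from one of `z` by a
constant on each branch, which the linear equation does not see. -/
theorem hypOp_neg_cpow_mul {a b c : ℂ} {H : ℂ → ℂ} {V : Set ℂ} (hV : IsOpen V)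
    (hH : AnalyticOnNhd ℂ H V)
    (h : ∀ z ∈ V, hypOp (a - c + 1) (b - c + 1) (2 - c) H z = 0) {z : ℂ}
    (hz : z ∈ V ∩ posCutPlane) :
    hypOp a b c (fun z => (-z) ^ (1 - c) * H z) z = 0 := by
  have hz0 := ne_zero_of_mem_posCutPlane hz.2
  obtain ⟨e1, e2⟩ := deriv_mul_comp (u := fun z => (-z) ^ (1 - c)) (w := fun z => z)
    (m := fun z => (1 - c) / z) (n := fun _ => 1) (m' := fun z => -(1 - c) / z ^ 2)
    (n' := fun _ => 0) (hV.inter isOpen_posCutPlane) (fun z hz => hasDerivAt_neg_cpow _ hz.2)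
    (fun z hz => hasDerivAt_id' z)
    hH (fun z hz => hz.1) hz
    (by
      refine ((hasDerivAt_const z (1 - c)).div (hasDerivAt_id' z) hz0).congr_deriv ?_
      simp)
    (hasDerivAt_const z 1)
  have hode := h _ hz.1
  rw [hypOp] at hode ⊢
  rw [e1, e2]
  generalize H z = h0 at *
  generalize deriv H z = h1 at *
  generalize deriv (deriv H) z = h2 at *
  generalize (-z) ^ (1 - c) = u at *
  linear_combination (norm := skip) u * hode
  field_simp
  ring

/-! ### The space of solutions is spanned by two solutions with non-vanishing Wronskian -/

theorem hasDerivAt_wronskian {f g : ℂ → ℂ} {z : ℂ} (hf : AnalyticAt ℂ f z)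
    (hg : AnalyticAt ℂ g z) :
    HasDerivAt (fun z => f z * deriv g z - deriv f z * g z)
      (f z * deriv (deriv g) z - deriv (deriv f) z * g z) z := by
  have h := (hf.differentiableAt.hasDerivAt.mul hg.deriv.differentiableAt.hasDerivAt).sub
    (hf.deriv.differentiableAt.hasDerivAt.mul hg.differentiableAt.hasDerivAt)
  refine h.congr_deriv ?_
  ring

theorem wronskian_ode {a b c : ℂ} {f g : ℂ → ℂ} {z : ℂ} (hf : hypOp a b c f z = 0)
    (hg : hypOp a b c g z = 0) :
    z * (1 - z) * (f z * deriv (deriv g) z - deriv (deriv f) z * g z) =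
      -(c - (a + b + 1) * z) * (f z * deriv g z - deriv f z * g z) := by
  rw [hypOp] at hf hg
  linear_combination f z * hg - g z * hf

/-- Abel's argument: all Wronskians satisfy the same first-order linear equation, so the quotient of
two of them has derivative zero on a small ball avoiding 0 and 1. -/
theorem exists_const_mul_wronskian {a b c : ℂ} {f g e₁ e₂ : ℂ → ℂ} {z₀ : ℂ} (h0 : z₀ ≠ 0)
    (h1 : z₀ ≠ 1) (hf : AnalyticAt ℂ f z₀) (hg : AnalyticAt ℂ g z₀) (he₁ : AnalyticAt ℂ e₁ z₀)
    (he₂ : AnalyticAt ℂ e₂ z₀) (of : ∀ᶠ z in 𝓝 z₀, hypOp a b c f z = 0)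
    (og : ∀ᶠ z in 𝓝 z₀, hypOp a b c g z = 0)
    (o₁ : ∀ᶠ z in 𝓝 z₀, hypOp a b c e₁ z = 0) (o₂ : ∀ᶠ z in 𝓝 z₀, hypOp a b c e₂ z = 0)
    (hW : e₁ z₀ * deriv e₂ z₀ - deriv e₁ z₀ * e₂ z₀ ≠ 0) :
    ∃ p : ℂ, ∀ᶠ z in 𝓝 z₀, f z * deriv g z - deriv f z * g z =
      p * (e₁ z * deriv e₂ z - deriv e₁ z * e₂ z) := by
  have hWc := (hasDerivAt_wronskian he₁ he₂).continuousAt.eventually_ne hW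
  have hall := (eventually_ne_nhds h0).and <| (eventually_ne_nhds h1).and <|
    hf.eventually_analyticAt.and <| hg.eventually_analyticAt.and <|
    he₁.eventually_analyticAt.and <| he₂.eventually_analyticAt.and <| of.and <| og.and <|
    o₁.and <| o₂.and hWc
  obtain ⟨ε, hε, hball⟩ := Metric.eventually_nhds_iff_ball.1 hall
  have hd : ∀ z ∈ Metric.ball z₀ ε, HasDerivAt (fun z => (f z * deriv g z - deriv f z * g z) /
      (e₁ z * deriv e₂ z - deriv e₁ z * e₂ z)) 0 z := by
    intro z hz
    obtain ⟨a0, a1, af, ag, ae₁, ae₂, of, og, o₁, o₂, hw⟩ := hball z hz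
    refine ((hasDerivAt_wronskian af ag).div (hasDerivAt_wronskian ae₁ ae₂) hw).congr_deriv ?_
    have k1 := wronskian_ode of og
    have k2 := wronskian_ode o₁ o₂
    have hz1 : 1 - z ≠ 0 := sub_ne_zero.2 (Ne.symm a1)
    rw [div_eq_zero_iff]
    left
    refine mul_left_cancel₀ (mul_ne_zero a0 hz1) ?_
    linear_combination (e₁ z * deriv e₂ z - deriv e₁ z * e₂ z) * k1 -
      (f z * deriv g z - deriv f z * g z) * k2
  obtain ⟨p, hp⟩ := Metric.isOpen_ball.exists_is_const_of_deriv_eq_zero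
    (convex_ball z₀ ε).isPreconnected
    (fun z hz => (hd z hz).differentiableAt.differentiableWithinAt)
    (fun z hz => (hd z hz).deriv)
  refine ⟨p, ?_⟩
  filter_upwards [Metric.ball_mem_nhds z₀ hε] with z hz
  obtain ⟨-, -, -, -, -, -, -, -, -, -, hw⟩ := hball z hz
  rw [← hp z hz, div_mul_cancel₀ _ hw]

/-- Cramer's rule: f W(e₁, e₂) = W(f, e₂) e₁ + W(e₁, f) e₂, where the Wronskians on the right are
constant multiples of W(e₁, e₂). -/
theorem exists_eventuallyEq_of_hypOp {a b c : ℂ} {f e₁ e₂ : ℂ → ℂ} {z₀ : ℂ} (h0 : z₀ ≠ 0)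
    (h1 : z₀ ≠ 1) (hf : AnalyticAt ℂ f z₀) (he₁ : AnalyticAt ℂ e₁ z₀)
    (he₂ : AnalyticAt ℂ e₂ z₀) (of : ∀ᶠ z in 𝓝 z₀, hypOp a b c f z = 0)
    (o₁ : ∀ᶠ z in 𝓝 z₀, hypOp a b c e₁ z = 0) (o₂ : ∀ᶠ z in 𝓝 z₀, hypOp a b c e₂ z = 0)
    (hW : e₁ z₀ * deriv e₂ z₀ - deriv e₁ z₀ * e₂ z₀ ≠ 0) :
    ∃ p q : ℂ, ∀ᶠ z in 𝓝 z₀, f z = p * e₁ z + q * e₂ z := by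
  obtain ⟨p, hp⟩ := exists_const_mul_wronskian h0 h1 hf he₂ he₁ he₂ of o₂ o₁ o₂ hW
  obtain ⟨q, hq⟩ := exists_const_mul_wronskian h0 h1 he₁ hf he₁ he₂ o₁ of o₁ o₂ hW
  refine ⟨p, q, ?_⟩
  filter_upwards [hp, hq, (hasDerivAt_wronskian he₁ he₂).continuousAt.eventually_ne hW]
    with z kp kq kw
  refine mul_right_cancel₀ kw ?_
  linear_combination e₁ z * kp + e₂ z * kq

/-! ### Connection with the solutions at zero, undetermined coefficients -/

/-- The unit disc cut along the positive reals. -/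
def cutDisc : Set ℂ := Metric.ball 0 1 ∩ posCutPlane

theorem isOpen_cutDisc : IsOpen cutDisc := Metric.isOpen_ball.inter isOpen_posCutPlane

theorem ofReal_neg_mem_cutDisc {ε : ℝ} (h0 : 0 < ε) (h1 : ε < 1) : (-ε : ℂ) ∈ cutDisc := by
  constructor
  · simpa [abs_of_pos h0] using h1
  · left; simpa using h0

theorem neg_half_mem_cutDisc : ((-(1 / 2 : ℝ) : ℝ) : ℂ) ∈ cutDisc := by
  have := ofReal_neg_mem_cutDisc (ε := 1 / 2) (by norm_num) (by norm_num)
  rwa [Complex.ofReal_neg]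

theorem starConvex_posCutPlane : StarConvex ℝ ((-(1 / 2 : ℝ) : ℝ) : ℂ) posCutPlane := by
  rw [starConvex_iff_forall_pos neg_half_mem_cutDisc.2]
  rintro z hz s t hs ht hst
  change -z ∈ Complex.slitPlane at hz
  change -(s • _ + t • z) ∈ Complex.slitPlane
  rw [Complex.mem_slitPlane_iff] at hz ⊢
  simp only [Complex.neg_re, Complex.neg_im, Complex.real_smul, Complex.add_re, Complex.add_im,
    Complex.re_ofReal_mul, Complex.im_ofReal_mul, Complex.ofReal_re, Complex.ofReal_im] at hz ⊢
  rcases hz with hz | hz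
  · left
    nlinarith [mul_pos ht hz]
  · right
    simpa [ht.ne'] using hz

theorem isPreconnected_posCutPlane : IsPreconnected posCutPlane :=
  (starConvex_posCutPlane.isPathConnected neg_half_mem_cutDisc.2).isConnected.isPreconnected

theorem isPreconnected_cutDisc : IsPreconnected cutDisc :=
  ((((convex_ball _ _).starConvex neg_half_mem_cutDisc.1).inter
    starConvex_posCutPlane).isPathConnected neg_half_mem_cutDisc).isConnected.isPreconnected

/-- The solution at infinity with exponent `(ρ + ν) / 2`. -/
noncomputable def solInfinity (ρ ν z : ℂ) : ℂ :=
  (-z) ^ (-((ρ + ν) / 2)) * gaussQuad ((ρ + ν) / 2) (1 + ν) (1 / z)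

theorem one_add_ne_neg_nat {ν : ℂ} (hν : ∀ n : ℤ, ν ≠ n) (k : ℕ) : 1 + ν ≠ -k := fun h =>
  hν (-(k + 1)) (by push_cast; linear_combination h)

theorem half_ne_neg_nat (k : ℕ) : (1 / 2 : ℂ) ≠ -k := fun h => by
  have := congrArg Complex.re h
  simp at this
  linarith [k.cast_nonneg (α := ℝ)]

theorem three_halves_ne_neg_nat (k : ℕ) : (3 / 2 : ℂ) ≠ -k := fun h => by
  have := congrArg Complex.re h
  simp at this
  linarith [k.cast_nonneg (α := ℝ)]

theorem analyticOnNhd_solInfinity (ρ ν : ℂ) : AnalyticOnNhd ℂ (solInfinity ρ ν) posCutPlane := by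
  intro z hz
  have hz0 := ne_zero_of_mem_posCutPlane hz
  refine (analyticAt_neg_cpow _ hz).mul ?_
  have h : AnalyticAt ℂ (fun z : ℂ => 1 / z) z := analyticAt_const.div analyticAt_id hz0
  exact (analyticOnNhd_gaussQuad _ _ _ (one_div_mem_cutPlane hz)).fun_comp h

theorem hypOp_solInfinity {ρ ν : ℂ} (hν : ∀ k : ℕ, 1 + ν ≠ -k) {z : ℂ} (hz : z ∈ posCutPlane) :
    hypOp ((ρ + ν) / 2) ((ρ - ν) / 2) (1 / 2) (solInfinity ρ ν) z = 0 := by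
  refine hypOp_neg_cpow_mul_comp_one_div (analyticOnNhd_gaussQuad _ _) (fun z hz => ?_) hz
  have := hypOp_gaussQuad (a := (ρ + ν) / 2) hν hz
  convert this using 2 <;> ring

/-- The Gauss series of `E⁽¹⁾`. -/
noncomputable def seriesE1 (ρ ν : ℂ) : ℂ → ℂ :=
  ordinaryHypergeometric ((ρ + ν) / 2) ((ρ - ν) / 2) (1 / 2)

/-- The Gauss series of `E⁽²⁾`. -/
noncomputable def seriesE2 (ρ ν : ℂ) : ℂ → ℂ :=
  ordinaryHypergeometric ((ρ + ν + 1) / 2) ((ρ - ν + 1) / 2) (3 / 2)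

theorem analyticOnNhd_seriesE1 (ρ ν : ℂ) : AnalyticOnNhd ℂ (seriesE1 ρ ν) (Metric.ball 0 1) :=
  analyticOnNhd_ordinaryHypergeometric _ _ _

theorem analyticOnNhd_seriesE2 (ρ ν : ℂ) : AnalyticOnNhd ℂ (seriesE2 ρ ν) (Metric.ball 0 1) :=
  analyticOnNhd_ordinaryHypergeometric _ _ _

theorem hypOp_neg_cpow_half_mul_seriesE2 (ρ ν : ℂ) {z : ℂ} (hz : z ∈ cutDisc) :
    hypOp ((ρ + ν) / 2) ((ρ - ν) / 2) (1 / 2)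
      (fun z => (-z) ^ (1 / 2 : ℂ) * seriesE2 ρ ν z) z = 0 := by
  have := hypOp_neg_cpow_mul (a := (ρ + ν) / 2) (b := (ρ - ν) / 2) (c := 1 / 2)
    Metric.isOpen_ball (analyticOnNhd_seriesE2 ρ ν) (fun z hz => by
      have := hypOp_ordinaryHypergeometric (a := (ρ + ν + 1) / 2) (b := (ρ - ν + 1) / 2)
        three_halves_ne_neg_nat hz
      unfold seriesE2
      convert this using 2 <;> ring) hz
  convert this using 5
  ring

/-- The two solutions at zero are independent near a negative point close to the origin. The local
relation obtained there spreads over the connected cut disc. -/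
theorem exists_solInfinity_eq {ρ ν : ℂ} (hν : ∀ k : ℕ, 1 + ν ≠ -k) :
    ∃ p q : ℂ, ∀ z ∈ cutDisc, solInfinity ρ ν z =
      p * seriesE1 ρ ν z + q * ((-z) ^ (1 / 2 : ℂ) * seriesE2 ρ ν z) := by
  have hE1 := analyticOnNhd_seriesE1 ρ ν
  have hE2 := analyticOnNhd_seriesE2 ρ ν
  have h00 : (0 : ℂ) ∈ Metric.ball (0 : ℂ) 1 := by simp
  -- The Wronskian of the two solutions at zero multiplied by 2z (-z)^(-1/2). Unlike the Wronskian
  -- itself it is regular at 0, with value 1, so it has no zero nearby.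
  set V : ℂ → ℂ := fun z => seriesE1 ρ ν z * (seriesE2 ρ ν z + 2 * z * deriv (seriesE2 ρ ν) z) -
    2 * z * seriesE2 ρ ν z * deriv (seriesE1 ρ ν) z with hVdef
  have hVc : ContinuousAt V 0 := by
    have c1 := (hE1 0 h00).continuousAt
    have c2 := (hE2 0 h00).continuousAt
    have c3 := (hE1 0 h00).deriv.continuousAt
    have c4 := (hE2 0 h00).deriv.continuousAt
    fun_prop
  have hV0 : V 0 ≠ 0 := by simp [hVdef, seriesE1, seriesE2]
  obtain ⟨ε, hε, hball⟩ := Metric.eventually_nhds_iff_ball.1 (hVc.eventually_ne hV0)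
  set δ : ℝ := min ε 1 / 2
  have hδ : 0 < δ := by positivity
  have hδ1 : δ < 1 := by
    have := min_le_right ε 1
    simp only [δ]; linarith
  have hδε : δ < ε := by
    have := min_le_left ε 1
    simp only [δ]; linarith
  have hz₀ := ofReal_neg_mem_cutDisc hδ hδ1
  set z₀ : ℂ := -δ
  have hne := ne_zero_of_mem_posCutPlane hz₀.2
  have hVz : V z₀ ≠ 0 := hball z₀ (by simpa [z₀, abs_of_pos hδ] using hδε)
  have hD := isOpen_cutDisc.mem_nhds hz₀
  have aE2 : AnalyticOnNhd ℂ (fun z => (-z) ^ (1 / 2 : ℂ) * seriesE2 ρ ν z) cutDisc :=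
    fun z hz => (analyticAt_neg_cpow _ hz.2).mul (hE2 z hz.1)
  have hone : z₀ ≠ 1 := by
    intro h
    have := hz₀.1
    rw [h] at this; simp at this
  have hderiv : deriv (fun z => (-z) ^ (1 / 2 : ℂ) * seriesE2 ρ ν z) z₀ =
      (-z₀) ^ (1 / 2 : ℂ) * (1 / 2 / z₀) * seriesE2 ρ ν z₀ +
        (-z₀) ^ (1 / 2 : ℂ) * deriv (seriesE2 ρ ν) z₀ :=
    ((hasDerivAt_neg_cpow _ hz₀.2).mul (hE2 z₀ hz₀.1).differentiableAt.hasDerivAt).deriv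
  obtain ⟨p, q, hpq⟩ := exists_eventuallyEq_of_hypOp (a := (ρ + ν) / 2) (b := (ρ - ν) / 2)
    (c := 1 / 2) hne hone (analyticOnNhd_solInfinity ρ ν z₀ hz₀.2) (hE1 z₀ hz₀.1) (aE2 z₀ hz₀)
    (mem_of_superset hD fun z hz => hypOp_solInfinity hν hz.2)
    (mem_of_superset hD fun z hz => hypOp_ordinaryHypergeometric half_ne_neg_nat hz.1)
    (mem_of_superset hD fun z hz => hypOp_neg_cpow_half_mul_seriesE2 ρ ν hz) (by
      rw [hderiv]
      have hpow : (-z₀) ^ (1 / 2 : ℂ) ≠ 0 := by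
        simp [Complex.cpow_eq_zero_iff, hne]
      intro h
      refine hVz ?_
      refine mul_left_cancel₀ hpow ?_
      rw [hVdef]
      linear_combination (norm := skip) 2 * z₀ * h
      field_simp
      ring)
  refine ⟨p, q, ?_⟩
  refine ((analyticOnNhd_solInfinity ρ ν).mono
    Set.inter_subset_right).eqOn_of_preconnected_of_eventuallyEq (fun z hz => ?_)
    isPreconnected_cutDisc hz₀ hpq
  exact (analyticAt_const.mul (hE1 z hz.1)).add (analyticAt_const.mul (aE2 z hz))

/-! ### Boundary values -/

theorem IsGaussContinuation.eqOn_closedBall {a b c : ℂ} {f : ℂ → ℂ}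
    (hf : IsGaussContinuation a b c f) (hc : ∀ k : ℕ, c ≠ -k) (h : (a + b - c).re < 0) :
    Set.EqOn f (ordinaryHypergeometric a b c) (Metric.closedBall 0 1 ∩ cutPlane) := by
  refine hf.2.of_subset_closure (hf.1.continuousOn.mono Set.inter_subset_right)
    ((continuousOn_ordinaryHypergeometric hc h).mono Set.inter_subset_left)
    (Set.subset_inter Metric.ball_subset_closedBall ball_subset_cutPlane) ?_
  rw [closure_ball _ one_ne_zero]
  exact Set.inter_subset_left

theorem real_mul_mem_posCutPlane {z : ℂ} (hz : z ∈ posCutPlane) {t : ℝ} (ht : 0 < t) :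
    (t : ℂ) * z ∈ posCutPlane := by
  change -z ∈ Complex.slitPlane at hz
  change -(t * z) ∈ Complex.slitPlane
  rw [Complex.mem_slitPlane_iff] at hz ⊢
  simp only [Complex.neg_re, Complex.neg_im, Complex.re_ofReal_mul, Complex.im_ofReal_mul] at hz ⊢
  rcases hz with hz | hz
  · left; nlinarith [mul_pos ht hz]
  · right; simpa [ht.ne'] using hz

theorem closedBall_inter_subset_closure_cutDisc :
    Metric.closedBall 0 1 ∩ posCutPlane ⊆ closure cutDisc := by
  rintro z ⟨hz1, hz2⟩
  have ht : Tendsto (fun t : ℝ => (t : ℂ) * z) (𝓝[<] 1) (𝓝 z) := by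
    have : ContinuousAt (fun t : ℝ => (t : ℂ) * z) 1 := by fun_prop
    simpa using this.tendsto.mono_left nhdsWithin_le_nhds
  refine mem_closure_of_tendsto ht ?_
  filter_upwards [Ioo_mem_nhdsLT (zero_lt_one (α := ℝ))] with t ht
  refine ⟨?_, real_mul_mem_posCutPlane hz2 ht.1⟩
  have hz1' : ‖z‖ ≤ 1 := by simpa using hz1
  rw [mem_ball_zero_iff, norm_mul, Complex.norm_real, Real.norm_of_nonneg ht.1.le]
  nlinarith [ht.1, ht.2, norm_nonneg z]

theorem continuous_neg_cpow_on_posCutPlane (s : ℂ) :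
    ContinuousOn (fun z : ℂ => (-z) ^ s) posCutPlane := fun _ hz =>
  (analyticAt_neg_cpow s hz).continuousAt.continuousWithinAt

theorem neg_exp_mem_posCutPlane {τ : ℝ} (hτ : τ ∈ Set.Ioo (-Real.pi) Real.pi) :
    -Complex.exp (τ * Complex.I) ∈ posCutPlane := by
  change - -_ ∈ Complex.slitPlane
  rw [neg_neg, Complex.mem_slitPlane_iff_arg]
  refine ⟨?_, Complex.exp_ne_zero _⟩
  rw [Complex.arg_exp_mul_I, toIocMod_eq_self _ |>.2 ⟨hτ.1, by linarith [hτ.2, Real.pi_pos]⟩]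
  exact hτ.2.ne

theorem exp_mul_I_cpow {τ : ℝ} (hτ : τ ∈ Set.Ioo (-Real.pi) Real.pi) (s : ℂ) :
    Complex.exp (τ * Complex.I) ^ s = Complex.exp (τ * Complex.I * s) := by
  rw [Complex.cpow_def_of_ne_zero (Complex.exp_ne_zero _),
    Complex.log_exp (by simpa using hτ.1) (by simpa using hτ.2.le)]

theorem re_add_sub_neg {ρ s : ℂ} (hρ : ρ.re < 1 / 2) (h : s = ρ - 1 / 2) : s.re < 0 := by
  have : s = ρ - ((1 / 2 : ℝ) : ℂ) := by rw [h]; push_cast; rfl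
  rw [this]; simp at hρ ⊢; linarith

/-- On the circle z = -exp(iτ), |τ| < π, the principal power of -z is exp(iτs). For all three Gauss
functions a + b - c = ρ - 1/2, so Re ρ < 1/2 makes both sides continuous up to τ = ±π, the two
approaches to z = 1. -/
theorem solInfinity_boundary {ρ ν : ℂ} (hν : ∀ k : ℕ, 1 + ν ≠ -k) (hρ : ρ.re < 1 / 2) {p q : ℂ}
    (h : ∀ z ∈ cutDisc, solInfinity ρ ν z =
      p * seriesE1 ρ ν z + q * ((-z) ^ (1 / 2 : ℂ) * seriesE2 ρ ν z))
    {τ : ℝ} (hτ : τ ∈ Set.Icc (-Real.pi) Real.pi) :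
    Complex.exp (τ * Complex.I * (-((ρ + ν) / 2))) *
      ordinaryHypergeometric ((ρ + ν) / 2) ((ρ + ν) / 2 + 1 / 2) (1 + ν)
        (-Complex.exp (-(τ * Complex.I))) =
    p * seriesE1 ρ ν (-Complex.exp (τ * Complex.I)) + q *
      (Complex.exp (τ * Complex.I * (1 / 2)) * seriesE2 ρ ν (-Complex.exp (τ * Complex.I))) := by
  have r0 : ((ρ + ν) / 2 + ((ρ + ν) / 2 + 1 / 2) - (1 + ν)).re < 0 := re_add_sub_neg hρ (by ring)
  have r1 : ((ρ + ν) / 2 + (ρ - ν) / 2 - 1 / 2).re < 0 := re_add_sub_neg hρ (by ring)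
  have r2 : ((ρ + ν + 1) / 2 + (ρ - ν + 1) / 2 - 3 / 2).re < 0 := re_add_sub_neg hρ (by ring)
  have cF := continuousOn_ordinaryHypergeometric hν r0
  have cE1 := continuousOn_ordinaryHypergeometric half_ne_neg_nat r1
  have cE2 := continuousOn_ordinaryHypergeometric three_halves_ne_neg_nat r2
  have hcirc : ∀ τ : ℝ, -Complex.exp (τ * Complex.I) ∈ Metric.closedBall (0 : ℂ) 1 := fun τ => by
    simp [Complex.norm_exp_ofReal_mul_I]
  have hcirc' : ∀ τ : ℝ, -Complex.exp (-(τ * Complex.I)) ∈ Metric.closedBall (0 : ℂ) 1 :=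
    fun τ => by
      have := hcirc (-τ)
      rwa [Complex.ofReal_neg, neg_mul] at this
  have hcl : ∀ z ∈ Metric.closedBall 0 1 ∩ posCutPlane, solInfinity ρ ν z =
      p * seriesE1 ρ ν z + q * ((-z) ^ (1 / 2 : ℂ) * seriesE2 ρ ν z) := by
    refine Set.EqOn.of_subset_closure (s := cutDisc) h
      ((analyticOnNhd_solInfinity ρ ν).continuousOn.mono Set.inter_subset_right)
      (((cE1.mono Set.inter_subset_left).const_smul p).add
        ((((continuous_neg_cpow_on_posCutPlane _).mono Set.inter_subset_right).mul
          (cE2.mono Set.inter_subset_left)).const_smul q))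
      (Set.inter_subset_inter_left _ Metric.ball_subset_closedBall)
      closedBall_inter_subset_closure_cutDisc
  revert τ
  have : closure (Set.Ioo (-Real.pi) Real.pi) = Set.Icc (-Real.pi) Real.pi :=
    closure_Ioo (by linarith [Real.pi_pos])
  rw [← this]
  intro τ hτ
  refine Set.EqOn.closure (s := Set.Ioo (-Real.pi) Real.pi)
    (f := fun τ : ℝ => Complex.exp (τ * Complex.I * (-((ρ + ν) / 2))) *
      ordinaryHypergeometric ((ρ + ν) / 2) ((ρ + ν) / 2 + 1 / 2) (1 + ν)
        (-Complex.exp (-(τ * Complex.I))))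
    (g := fun τ : ℝ => p * seriesE1 ρ ν (-Complex.exp (τ * Complex.I)) + q *
      (Complex.exp (τ * Complex.I * (1 / 2)) * seriesE2 ρ ν (-Complex.exp (τ * Complex.I))))
    (fun τ hτ => ?_) ?_ ?_ hτ
  · have hm := neg_exp_mem_posCutPlane hτ
    have hz := hcl _ ⟨hcirc τ, hm⟩
    have hinv : 1 / -Complex.exp (τ * Complex.I) = -Complex.exp (-(τ * Complex.I)) := by
      rw [Complex.exp_neg]; field_simp
    rw [solInfinity, (isGaussContinuation_gaussQuad _ hν).eqOn_closedBall hν r0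
      ⟨hinv ▸ hcirc' τ, one_div_mem_cutPlane hm⟩, hinv, neg_neg, exp_mul_I_cpow hτ,
      exp_mul_I_cpow hτ] at hz
    exact hz
  · exact (by fun_prop : Continuous fun τ : ℝ => Complex.exp (τ * Complex.I * (-((ρ + ν) / 2)))).mul
      (cF.comp_continuous (by fun_prop) hcirc')
  · exact ((cE1.comp_continuous (by fun_prop) hcirc).const_smul p).add
      (((by fun_prop : Continuous fun τ : ℝ => Complex.exp (τ * Complex.I * (1 / 2))).mul
        (cE2.comp_continuous (by fun_prop) hcirc)).const_smul q)

/-! ### The connection coefficients -/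

theorem inv_Gamma_mul_inv_Gamma_one_sub (z : ℂ) :
    (Complex.Gamma z)⁻¹ * (Complex.Gamma (1 - z))⁻¹ = Complex.sin (Real.pi * z) / Real.pi := by
  rw [← mul_inv, Complex.Gamma_mul_Gamma_one_sub, inv_div]

theorem inv_Gamma_half_add_mul (z : ℂ) :
    (Complex.Gamma (1 / 2 + z))⁻¹ * (Complex.Gamma (1 / 2 - z))⁻¹ =
      Complex.cos (Real.pi * z) / Real.pi := by
  have h := inv_Gamma_mul_inv_Gamma_one_sub (1 / 2 + z)
  have e1 : (1 : ℂ) - (1 / 2 + z) = 1 / 2 - z := by ring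
  have e2 : (Real.pi : ℂ) * (1 / 2 + z) = Real.pi * z + Real.pi / 2 := by ring
  rwa [e1, e2, Complex.sin_add_pi_div_two] at h

theorem Gamma_half_eq_sqrt_pi : Complex.Gamma (1 / 2) = (√Real.pi : ℝ) := by
  rw [← Real.Gamma_one_half_eq, ← Complex.Gamma_ofReal]; push_cast; rfl

theorem Gamma_three_halves : Complex.Gamma (3 / 2) = (√Real.pi : ℝ) / 2 := by
  have h := Complex.Gamma_add_one (1 / 2) (by norm_num)
  have e : (1 / 2 + 1 : ℂ) = 3 / 2 := by norm_num
  rw [← e, h, Gamma_half_eq_sqrt_pi]; ring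

theorem sqrt_pi_mul_self : ((√Real.pi : ℝ) : ℂ) * (√Real.pi : ℝ) = Real.pi := by
  rw [← Complex.ofReal_mul, Real.mul_self_sqrt Real.pi_pos.le]

theorem sqrt_pi_ne_zero : ((√Real.pi : ℝ) : ℂ) ≠ 0 := by
  exact_mod_cast (Real.sqrt_pos.2 Real.pi_pos).ne'

/-- The coefficient of `E⁽¹⁾` in the solution at infinity. -/
noncomputable def connP (ρ ν : ℂ) : ℂ :=
  (√Real.pi : ℝ) * Complex.Gamma (1 + ν) * (Complex.Gamma ((1 + ρ + ν) / 2))⁻¹ *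
    (Complex.Gamma (1 + (ν - ρ) / 2))⁻¹

/-- The coefficient of `(-z) ^ (1 / 2) E⁽²⁾` in the solution at infinity. -/
noncomputable def connQ (ρ ν : ℂ) : ℂ :=
  -2 * (√Real.pi : ℝ) * Complex.Gamma (1 + ν) * (Complex.Gamma ((ρ + ν) / 2))⁻¹ *
    (Complex.Gamma ((1 + ν - ρ) / 2))⁻¹

/-- Half the sum and half the difference of the boundary relations at τ = π and τ = -π isolate `p`
and `q`; Gauss's theorem evaluates the functions at 1. The bound on Re ρ keeps the Γ-factors to be
cancelled in the right half-plane, hence nonzero. -/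
theorem connection_coefficients {ρ ν : ℂ} (hν : ∀ k : ℕ, 1 + ν ≠ -k) (hρ : ρ.re < -|ν.re|)
    {p q : ℂ} (h : ∀ z ∈ cutDisc, solInfinity ρ ν z =
      p * seriesE1 ρ ν z + q * ((-z) ^ (1 / 2 : ℂ) * seriesE2 ρ ν z)) :
    p = connP ρ ν ∧ q = connQ ρ ν := by
  have hρ0 : ρ.re < 1 / 2 := by linarith [abs_nonneg ν.re]
  have hn1 := neg_abs_le ν.re
  have hn2 := le_abs_self ν.re
  have hplus := solInfinity_boundary hν hρ0 h (τ := Real.pi) ⟨by linarith [Real.pi_pos], le_rfl⟩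
  have hminus := solInfinity_boundary hν hρ0 h (τ := -Real.pi)
    ⟨le_rfl, by linarith [Real.pi_pos]⟩
  have e1 : -Complex.exp (Real.pi * Complex.I) = 1 := by simp [Complex.exp_pi_mul_I]
  have e2 : -Complex.exp (-(Real.pi * Complex.I)) = 1 := by
    rw [Complex.exp_neg, Complex.exp_pi_mul_I]; norm_num
  have e3 : Complex.exp (Real.pi * Complex.I * (1 / 2)) = Complex.I := by
    have : Real.pi * Complex.I * (1 / 2) = Real.pi / 2 * Complex.I := by ring
    rw [this, Complex.exp_pi_div_two_mul_I]
  have e4 : Complex.exp (-(Real.pi * Complex.I) * (1 / 2)) = -Complex.I := by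
    rw [neg_mul, Complex.exp_neg, e3, Complex.inv_I]
  simp only [Complex.ofReal_neg, neg_mul (Real.pi : ℂ) Complex.I, neg_neg] at hminus
  rw [e1, e2, e3] at hplus
  rw [e1, e2, e4] at hminus
  have x1 : Complex.exp (Real.pi * Complex.I * (-((ρ + ν) / 2))) =
      Complex.cos (Real.pi * ((ρ + ν) / 2)) - Complex.sin (Real.pi * ((ρ + ν) / 2)) * Complex.I := by
    have : Real.pi * Complex.I * (-((ρ + ν) / 2)) = -(Real.pi * ((ρ + ν) / 2)) * Complex.I := by
      ring
    rw [this, Complex.exp_mul_I, Complex.cos_neg, Complex.sin_neg]; ring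
  have x2 : Complex.exp (-(Real.pi * Complex.I) * (-((ρ + ν) / 2))) =
      Complex.cos (Real.pi * ((ρ + ν) / 2)) + Complex.sin (Real.pi * ((ρ + ν) / 2)) * Complex.I := by
    have : -(Real.pi * Complex.I) * (-((ρ + ν) / 2)) = (Real.pi * ((ρ + ν) / 2)) * Complex.I := by
      ring
    rw [this, Complex.exp_mul_I]
  rw [x1] at hplus
  rw [x2] at hminus
  set F := ordinaryHypergeometric ((ρ + ν) / 2) ((ρ + ν) / 2 + 1 / 2) (1 + ν) (1 : ℂ) with hF
  have hp : Complex.cos (Real.pi * ((ρ + ν) / 2)) * F = p * seriesE1 ρ ν 1 := by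
    linear_combination (hplus + hminus) / 2
  have hq : -Complex.sin (Real.pi * ((ρ + ν) / 2)) * F = q * seriesE2 ρ ν 1 := by
    refine mul_left_cancel₀ Complex.I_ne_zero ?_
    linear_combination (hplus - hminus) / 2
  have r0 : ((ρ + ν) / 2 + ((ρ + ν) / 2 + 1 / 2) - (1 + ν)).re < 0 := re_add_sub_neg hρ0 (by ring)
  have r1 : ((ρ + ν) / 2 + (ρ - ν) / 2 - 1 / 2).re < 0 := re_add_sub_neg hρ0 (by ring)
  have r2 : ((ρ + ν + 1) / 2 + (ρ - ν + 1) / 2 - 3 / 2).re < 0 := re_add_sub_neg hρ0 (by ring)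
  have vF := ordinaryHypergeometric_one hν r0
  have vE1 := ordinaryHypergeometric_one half_ne_neg_nat r1
  have vE2 := ordinaryHypergeometric_one three_halves_ne_neg_nat r2
  rw [← hF, show 1 + ν - (ρ + ν) / 2 - ((ρ + ν) / 2 + 1 / 2) = 1 / 2 - ρ by ring,
    show 1 + ν - (ρ + ν) / 2 = 1 + (ν - ρ) / 2 by ring,
    show 1 + ν - ((ρ + ν) / 2 + 1 / 2) = (1 + ν - ρ) / 2 by ring] at vF
  rw [show (1 : ℂ) / 2 - (ρ + ν) / 2 - (ρ - ν) / 2 = 1 / 2 - ρ by ring,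
    show (1 : ℂ) / 2 - (ρ - ν) / 2 = (1 + ν - ρ) / 2 by ring, Gamma_half_eq_sqrt_pi] at vE1
  rw [show (3 : ℂ) / 2 - (ρ + ν + 1) / 2 - (ρ - ν + 1) / 2 = 1 / 2 - ρ by ring,
    show (3 : ℂ) / 2 - (ρ + ν + 1) / 2 = 1 - (ρ + ν) / 2 by ring,
    show (3 : ℂ) / 2 - (ρ - ν + 1) / 2 = 1 + (ν - ρ) / 2 by ring, Gamma_three_halves] at vE2
  have hpi : (Real.pi : ℂ) ≠ 0 := by exact_mod_cast Real.pi_ne_zero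
  have hsin : Complex.sin (Real.pi * ((ρ + ν) / 2)) = Real.pi *
      ((Complex.Gamma ((ρ + ν) / 2))⁻¹ * (Complex.Gamma (1 - (ρ + ν) / 2))⁻¹) := by
    rw [inv_Gamma_mul_inv_Gamma_one_sub]; field_simp
  have hcos : Complex.cos (Real.pi * ((ρ + ν) / 2)) = Real.pi *
      ((Complex.Gamma ((1 + ρ + ν) / 2))⁻¹ * (Complex.Gamma (1 / 2 - (ρ + ν) / 2))⁻¹) := by
    rw [show (1 + ρ + ν) / 2 = 1 / 2 + (ρ + ν) / 2 by ring, inv_Gamma_half_add_mul]; field_simp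
  have n1 : Complex.Gamma (1 / 2 - ρ) ≠ 0 := Complex.Gamma_ne_zero_of_re_pos (by
    rw [show (1 : ℂ) / 2 - ρ = ((1 / 2 : ℝ) : ℂ) - ρ by push_cast; rfl]
    simp at hρ0 ⊢; linarith)
  have n2 : Complex.Gamma (1 / 2 - (ρ + ν) / 2) ≠ 0 := Complex.Gamma_ne_zero_of_re_pos (by
    rw [show (1 : ℂ) / 2 - (ρ + ν) / 2 = ((1 / 2 : ℝ) : ℂ) * (1 - ρ - ν) by push_cast; ring,
      Complex.re_ofReal_mul]
    simp; linarith)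
  have n3 : Complex.Gamma ((1 + ν - ρ) / 2) ≠ 0 := Complex.Gamma_ne_zero_of_re_pos (by
    rw [show (1 + ν - ρ) / 2 = ((1 / 2 : ℝ) : ℂ) * (1 + ν - ρ) by push_cast; ring,
      Complex.re_ofReal_mul]
    simp; linarith)
  have n4 : Complex.Gamma (1 - (ρ + ν) / 2) ≠ 0 := Complex.Gamma_ne_zero_of_re_pos (by
    rw [show 1 - (ρ + ν) / 2 = ((1 / 2 : ℝ) : ℂ) * (2 - ρ - ν) by push_cast; ring,
      Complex.re_ofReal_mul]
    simp; linarith)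
  have n5 : Complex.Gamma (1 + (ν - ρ) / 2) ≠ 0 := Complex.Gamma_ne_zero_of_re_pos (by
    rw [show 1 + (ν - ρ) / 2 = ((1 / 2 : ℝ) : ℂ) * (2 + ν - ρ) by push_cast; ring,
      Complex.re_ofReal_mul]
    simp; linarith)
  have hs := sqrt_pi_ne_zero
  have hss := sqrt_pi_mul_self
  rw [seriesE1, vE1, vF, hcos, ← hss] at hp
  rw [seriesE2, vE2, vF, hsin, ← hss] at hq
  rw [connP, connQ]
  generalize (Complex.Gamma ((1 + ρ + ν) / 2))⁻¹ = i1 at *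
  generalize (Complex.Gamma ((ρ + ν) / 2))⁻¹ = i2 at *
  generalize Complex.Gamma (1 / 2 - ρ) = g1 at *
  generalize Complex.Gamma (1 / 2 - (ρ + ν) / 2) = g2 at *
  generalize Complex.Gamma ((1 + ν - ρ) / 2) = g3 at *
  generalize Complex.Gamma (1 - (ρ + ν) / 2) = g4 at *
  generalize Complex.Gamma (1 + (ν - ρ) / 2) = g5 at *
  constructor
  · field_simp at hp ⊢
    linear_combination -hp
  · field_simp at hq ⊢
    linear_combination -hq

/-! ### Continuation in `ρ` -/

theorem differentiable_const_cpow {f : ℂ → ℂ} {x : ℂ} (hx : x ≠ 0) (hf : Differentiable ℂ f) :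
    Differentiable ℂ fun t => x ^ f t := fun t => (hf t).const_cpow (Or.inl hx)

theorem differentiable_inv_Gamma_comp {f : ℂ → ℂ} (hf : Differentiable ℂ f) :
    Differentiable ℂ fun t => (Complex.Gamma (f t))⁻¹ :=
  Complex.differentiable_one_div_Gamma.comp hf

theorem differentiable_connP (ν : ℂ) : Differentiable ℂ fun ρ => connP ρ ν :=
  ((differentiable_inv_Gamma_comp (by fun_prop)).const_mul _).mul
    (differentiable_inv_Gamma_comp (by fun_prop))

theorem differentiable_connQ (ν : ℂ) : Differentiable ℂ fun ρ => connQ ρ ν :=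
  ((differentiable_inv_Gamma_comp (by fun_prop)).const_mul _).mul
    (differentiable_inv_Gamma_comp (by fun_prop))

/-- In the quadratic form ρ occurs only in exponents and in numerator parameters of a series at a
fixed point of the unit disc, so the dependence on ρ is entire. -/
theorem differentiable_solInfinity (ν : ℂ) {z : ℂ} (hz : z ∈ posCutPlane) :
    Differentiable ℂ fun ρ => solInfinity ρ ν z := by
  have hre := re_sqrtOneSub_pos (one_div_mem_cutPlane hz)
  refine (differentiable_const_cpow (neg_ne_zero.2 (ne_zero_of_mem_posCutPlane hz))
    (by fun_prop)).mul ?_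
  refine (differentiable_const_cpow
    (Complex.slitPlane_ne_zero (half_one_add_mem_slitPlane hre)) (by fun_prop)).mul ?_
  exact differentiable_ordinaryHypergeometric_param (by fun_prop) (by fun_prop) _
    (norm_one_sub_div_one_add_lt hre)

/-- The connection formula on the cut disc. -/
theorem solInfinity_eq {ρ ν : ℂ} (hν : ∀ k : ℕ, 1 + ν ≠ -k) {z : ℂ} (hz : z ∈ cutDisc) :
    solInfinity ρ ν z = connP ρ ν * seriesE1 ρ ν z +
      connQ ρ ν * ((-z) ^ (1 / 2 : ℂ) * seriesE2 ρ ν z) := by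
  have hz1 : ‖z‖ < 1 := by simpa using hz.1
  have d1 := differentiable_solInfinity ν hz.2
  have d2 : Differentiable ℂ fun ρ => connP ρ ν * seriesE1 ρ ν z +
      connQ ρ ν * ((-z) ^ (1 / 2 : ℂ) * seriesE2 ρ ν z) :=
    ((differentiable_connP ν).mul (differentiable_ordinaryHypergeometric_param (by fun_prop)
      (by fun_prop) _ hz1)).add ((differentiable_connQ ν).mul
      ((differentiable_ordinaryHypergeometric_param (by fun_prop) (by fun_prop) _
        hz1).const_mul _))
  have a1 := d1.differentiableOn.analyticOnNhd (isOpen_univ (X := ℂ))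
  have a2 := d2.differentiableOn.analyticOnNhd (isOpen_univ (X := ℂ))
  have hopen : IsOpen {ρ : ℂ | ρ.re < -|ν.re|} :=
    isOpen_lt Complex.continuous_re continuous_const
  have hmem : ((-|ν.re| - 1 : ℝ) : ℂ) ∈ {ρ : ℂ | ρ.re < -|ν.re|} := by
    change (((-|ν.re| - 1 : ℝ) : ℂ)).re < -|ν.re|
    rw [Complex.ofReal_re]; linarith
  -- The coefficients are known on an open half-plane of ρ; the identity theorem in ρ, with z and ν
  -- fixed, removes the restriction.
  have := a1.eq_of_eventuallyEq a2 (mem_of_superset (hopen.mem_nhds hmem) fun ρ hρ => by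
    obtain ⟨p, q, hpq⟩ := exists_solInfinity_eq (ρ := ρ) hν
    obtain ⟨rfl, rfl⟩ := connection_coefficients hν hρ hpq
    exact hpq z hz)
  exact congrFun this ρ

/-! ### Identification of `hyp2F1` -/

theorem IsGaussContinuation.eqOn_hyp2F1 {a b c : ℂ} {f : ℂ → ℂ}
    (hf : IsGaussContinuation a b c f) : Set.EqOn (hyp2F1 a b c) f cutPlane := by
  intro z hz
  have h : z ∈ cutPlane ∧ ∃ f, IsGaussContinuation a b c f := ⟨hz, f, hf⟩
  rw [hyp2F1, dif_pos h]
  exact h.2.choose_spec.eqOn hf hz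

theorem IsGaussContinuation.hyp2F1 {a b c : ℂ} {f : ℂ → ℂ} (hf : IsGaussContinuation a b c f) :
    IsGaussContinuation a b c (hyp2F1 a b c) := by
  refine ⟨fun z hz => (hf.1 z hz).congr ?_, fun z hz => ?_⟩
  · exact (hf.eqOn_hyp2F1.eventuallyEq_of_mem (isOpen_cutPlane.mem_nhds hz)).symm
  · rw [hf.eqOn_hyp2F1 (ball_subset_cutPlane hz), hf.2 hz]

/-- The only point of the closed disc on the cut is 1, where `hyp2F1` falls back to the sum of the
series. -/
theorem hyp2F1_eqOn_closedBall {a b c : ℂ} (hf : IsGaussContinuation a b c (hyp2F1 a b c))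
    (hc : ∀ k : ℕ, c ≠ -k) (h : (a + b - c).re < 0) :
    Set.EqOn (hyp2F1 a b c) (ordinaryHypergeometric a b c) (Metric.closedBall 0 1) := by
  intro z hz
  by_cases hzc : z ∈ cutPlane
  · exact hf.eqOn_closedBall hc h ⟨hz, hzc⟩
  · rw [hyp2F1, dif_neg fun h => hzc h.1]

theorem continuousOn_hyp2F1 {a b c : ℂ} (hf : IsGaussContinuation a b c (hyp2F1 a b c))
    (hc : ∀ k : ℕ, c ≠ -k) (h : (a + b - c).re < 0) :
    ContinuousOn (hyp2F1 a b c) (Metric.closedBall 0 1) :=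
  (continuousOn_ordinaryHypergeometric hc h).congr (hyp2F1_eqOn_closedBall hf hc h)

theorem mem_ball_or_mem_posCutPlane {z : ℂ} (hz : z ∈ cutPlane) :
    z ∈ Metric.ball (0 : ℂ) 1 ∨ z ∈ posCutPlane := by
  by_contra! h
  have h2 := h.2
  rw [mem_posCutPlane_iff, not_not] at h2
  obtain ⟨x, hx, rfl⟩ := h2
  have hx0 : (0 : ℝ) ≤ x := hx
  refine hz ⟨x, Set.mem_Ici.2 ?_, rfl⟩
  simpa [abs_of_nonneg hx0] using h.1

-- The cut plane is the union of the unit disc and the plane cut along [0, ∞), so the series and `g`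
-- glue to a continuation as soon as they agree on the overlap.
open Classical in
theorem exists_isGaussContinuation_of_eqOn_cutDisc {a b c : ℂ} {g : ℂ → ℂ}
    (hg : AnalyticOnNhd ℂ g posCutPlane)
    (h : Set.EqOn g (ordinaryHypergeometric a b c) cutDisc) :
    ∃ f, IsGaussContinuation a b c f := by
  refine ⟨fun z => if z ∈ Metric.ball (0 : ℂ) 1 then ordinaryHypergeometric a b c z else g z,
    fun z hz => ?_, fun z hz => if_pos hz⟩
  rcases mem_ball_or_mem_posCutPlane hz with hz | hz
  · refine (analyticOnNhd_ordinaryHypergeometric a b c z hz).congr ?_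
    filter_upwards [Metric.isOpen_ball.mem_nhds hz] with y hy
    exact (if_pos hy).symm
  · refine (hg z hz).congr ?_
    filter_upwards [isOpen_posCutPlane.mem_nhds hz] with y hy
    by_cases hb : y ∈ Metric.ball (0 : ℂ) 1
    · rw [if_pos hb, h ⟨hb, hy⟩]
    · rw [if_neg hb]

/-! ### The determinant of the connection matrix -/

theorem sin_pi_mul_ne_zero_of_ne_int {ν : ℂ} (hν : ∀ n : ℤ, ν ≠ n) : Complex.sin (Real.pi * ν) ≠ 0 := by
  rw [Complex.sin_ne_zero_iff]
  intro k hk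
  have hpi : (Real.pi : ℂ) ≠ 0 := by exact_mod_cast Real.pi_ne_zero
  exact hν k (mul_left_cancel₀ hpi (by linear_combination hk))

theorem neg_ne_int {ν : ℂ} (hν : ∀ n : ℤ, ν ≠ n) (n : ℤ) : -ν ≠ n := fun h =>
  hν (-n) (by push_cast; linear_combination -h)

theorem ne_zero_of_ne_int {ν : ℂ} (hν : ∀ n : ℤ, ν ≠ n) : ν ≠ 0 := by
  simpa using hν 0

/-- Reflection turns each product of four inverse Γ-factors into a cosine times a sine, the
difference of which is -sin(πν); the factor Γ(1 + ν)Γ(1 - ν) = πν / sin(πν) leaves 2ν. -/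
theorem conn_det {ν : ℂ} (hν : ∀ n : ℤ, ν ≠ n) (ρ : ℂ) :
    connP ρ ν * connQ ρ (-ν) - connP ρ (-ν) * connQ ρ ν = 2 * ν := by
  have hpi : (Real.pi : ℂ) ≠ 0 := by exact_mod_cast Real.pi_ne_zero
  have hsin := sin_pi_mul_ne_zero_of_ne_int hν
  have hν0 := ne_zero_of_ne_int hν
  have c1 := inv_Gamma_half_add_mul ((ρ + ν) / 2)
  have c2 := inv_Gamma_half_add_mul ((ρ - ν) / 2)
  have s1 := inv_Gamma_mul_inv_Gamma_one_sub ((ρ - ν) / 2)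
  have s2 := inv_Gamma_mul_inv_Gamma_one_sub ((ρ + ν) / 2)
  have hG : Complex.Gamma (1 + ν) * Complex.Gamma (1 - ν) * Complex.sin (Real.pi * ν) =
      ν * Real.pi := by
    rw [add_comm, Complex.Gamma_add_one _ hν0, mul_assoc ν, Complex.Gamma_mul_Gamma_one_sub,
      mul_assoc, div_mul_cancel₀ _ hsin]
  have htrig : Complex.cos (Real.pi * ((ρ + ν) / 2)) * Complex.sin (Real.pi * ((ρ - ν) / 2)) -
      Complex.cos (Real.pi * ((ρ - ν) / 2)) * Complex.sin (Real.pi * ((ρ + ν) / 2)) =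
      -Complex.sin (Real.pi * ν) := by
    have e : -(Real.pi * ν) = Real.pi * ((ρ - ν) / 2) - Real.pi * ((ρ + ν) / 2) := by ring
    rw [← Complex.sin_neg, e, Complex.sin_sub]; ring
  have hss := sqrt_pi_mul_self
  rw [connP, connP, connQ, connQ]
  rw [show (1 + ρ + ν) / 2 = 1 / 2 + (ρ + ν) / 2 by ring,
    show (1 + ρ + -ν) / 2 = 1 / 2 + (ρ - ν) / 2 by ring,
    show (1 + ν - ρ) / 2 = 1 / 2 - (ρ - ν) / 2 by ring,
    show (1 + -ν - ρ) / 2 = 1 / 2 - (ρ + ν) / 2 by ring,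
    show 1 + (ν - ρ) / 2 = 1 - (ρ - ν) / 2 by ring,
    show 1 + (-ν - ρ) / 2 = 1 - (ρ + ν) / 2 by ring, ← sub_eq_add_neg, ← sub_eq_add_neg]
  calc _ = -2 * (((√Real.pi : ℝ) : ℂ) * (√Real.pi : ℝ)) * (Complex.Gamma (1 + ν) *
        Complex.Gamma (1 - ν)) * (((Complex.Gamma (1 / 2 + (ρ + ν) / 2))⁻¹ *
        (Complex.Gamma (1 / 2 - (ρ + ν) / 2))⁻¹) * ((Complex.Gamma ((ρ - ν) / 2))⁻¹ *
        (Complex.Gamma (1 - (ρ - ν) / 2))⁻¹) - ((Complex.Gamma (1 / 2 + (ρ - ν) / 2))⁻¹ *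
        (Complex.Gamma (1 / 2 - (ρ - ν) / 2))⁻¹) * ((Complex.Gamma ((ρ + ν) / 2))⁻¹ *
        (Complex.Gamma (1 - (ρ + ν) / 2))⁻¹)) := by ring
    _ = -2 / Real.pi * (Complex.Gamma (1 + ν) * Complex.Gamma (1 - ν)) *
        -Complex.sin (Real.pi * ν) := by
      rw [hss, c1, c2, s1, s2, ← htrig]; field_simp
    _ = 2 / Real.pi * (ν * Real.pi) := by rw [← hG]; ring
    _ = 2 * ν := by field_simp

/-! ### The connection formula -/

theorem ordinaryHypergeometric_comm (a b c : ℂ) :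
    (ordinaryHypergeometric a b c : ℂ → ℂ) = ordinaryHypergeometric b a c := by
  funext z
  rw [ordinaryHypergeometric, ordinaryHypergeometricSeries_symm, ordinaryHypergeometric]

theorem seriesE1_neg (ρ ν : ℂ) : seriesE1 ρ (-ν) = seriesE1 ρ ν := by
  rw [seriesE1, seriesE1, ordinaryHypergeometric_comm, sub_neg_eq_add, ← sub_eq_add_neg]

theorem seriesE2_neg (ρ ν : ℂ) : seriesE2 ρ (-ν) = seriesE2 ρ ν := by
  rw [seriesE2, seriesE2, ordinaryHypergeometric_comm, sub_neg_eq_add, ← sub_eq_add_neg]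

theorem isGaussContinuation_hypE1 {ν : ℂ} (hν : ∀ n : ℤ, ν ≠ n) (ρ : ℂ) :
    IsGaussContinuation ((ρ + ν) / 2) ((ρ - ν) / 2) (1 / 2) (hypE1 ρ ν) := by
  have hν0 := ne_zero_of_ne_int hν
  obtain ⟨f, hf⟩ := exists_isGaussContinuation_of_eqOn_cutDisc (a := (ρ + ν) / 2)
    (b := (ρ - ν) / 2) (c := 1 / 2)
    -- First row of the inverse connection matrix. The series at zero are even in ν, so the
    -- connection formulas for ν and -ν involve the same two functions.
    (g := fun z => (2 * ν)⁻¹ * (connQ ρ (-ν) * solInfinity ρ ν z -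
      connQ ρ ν * solInfinity ρ (-ν) z))
    (fun z hz => analyticAt_const.mul ((analyticAt_const.mul
      (analyticOnNhd_solInfinity ρ ν z hz)).sub (analyticAt_const.mul
      (analyticOnNhd_solInfinity ρ (-ν) z hz)))) (fun z hz => by
      have h1 := solInfinity_eq (ρ := ρ) (one_add_ne_neg_nat hν) hz
      have h2 := solInfinity_eq (ρ := ρ) (one_add_ne_neg_nat (neg_ne_int hν)) hz
      have hd := conn_det hν ρ
      rw [seriesE1_neg, seriesE2_neg] at h2
      change _ = seriesE1 ρ ν z
      dsimp only
      rw [inv_mul_eq_iff_eq_mul₀ (by simpa using hν0), h1, h2]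
      linear_combination seriesE1 ρ ν z * hd)
  exact hf.hyp2F1

theorem isGaussContinuation_hypE2 {ν : ℂ} (hν : ∀ n : ℤ, ν ≠ n) (ρ : ℂ) :
    IsGaussContinuation ((ρ + ν + 1) / 2) ((ρ - ν + 1) / 2) (3 / 2) (hypE2 ρ ν) := by
  have hν0 := ne_zero_of_ne_int hν
  obtain ⟨f, hf⟩ := exists_isGaussContinuation_of_eqOn_cutDisc (a := (ρ + ν + 1) / 2)
    (b := (ρ - ν + 1) / 2) (c := 3 / 2)
    (g := fun z => (2 * ν)⁻¹ * ((-z) ^ (-(1 / 2) : ℂ) * (connP ρ ν * solInfinity ρ (-ν) z -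
      connP ρ (-ν) * solInfinity ρ ν z)))
    (fun z hz => analyticAt_const.mul ((analyticAt_neg_cpow _ hz).mul ((analyticAt_const.mul
      (analyticOnNhd_solInfinity ρ (-ν) z hz)).sub (analyticAt_const.mul
      (analyticOnNhd_solInfinity ρ ν z hz))))) (fun z hz => by
      have h1 := solInfinity_eq (ρ := ρ) (one_add_ne_neg_nat hν) hz
      have h2 := solInfinity_eq (ρ := ρ) (one_add_ne_neg_nat (neg_ne_int hν)) hz
      have hd := conn_det hν ρ
      rw [seriesE1_neg, seriesE2_neg] at h2
      change _ = seriesE2 ρ ν z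
      dsimp only
      have hne := neg_ne_zero.2 (ne_zero_of_mem_posCutPlane hz.2)
      have hpow : (-z) ^ (1 / 2 : ℂ) ≠ 0 := by simp [Complex.cpow_eq_zero_iff, neg_ne_zero.1 hne]
      rw [inv_mul_eq_iff_eq_mul₀ (by simpa using hν0), Complex.cpow_neg,
        inv_mul_eq_iff_eq_mul₀ hpow, h1, h2]
      linear_combination (-z) ^ (1 / 2 : ℂ) * seriesE2 ρ ν z * hd)
  exact hf.hyp2F1

theorem hypF1_eq (ρ ν : ℂ) :
    hypF1 ρ ν = hyp2F1 ((ρ + ν) / 2) ((ρ + ν) / 2 + 1 / 2) (1 + ν) := by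
  funext z
  rw [hypF1]
  congr 1
  ring

theorem isGaussContinuation_hypF1 {ν : ℂ} (hν : ∀ n : ℤ, ν ≠ n) (ρ : ℂ) :
    IsGaussContinuation ((ρ + ν) / 2) ((ρ + ν) / 2 + 1 / 2) (1 + ν) (hypF1 ρ ν) := by
  rw [hypF1_eq]
  exact (isGaussContinuation_gaussQuad _ (one_add_ne_neg_nat hν)).hyp2F1

/-- With E⁽¹⁾ and E⁽²⁾ continued, the identity theorem extends the connection formula from the cut
disc to the whole plane cut along [0, ∞). -/
theorem neg_cpow_mul_hypF1_eq {ν : ℂ} (hν : ∀ n : ℤ, ν ≠ n) (ρ : ℂ) {z : ℂ}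
    (hz : z ∈ posCutPlane) :
    (-z) ^ (-((ρ + ν) / 2)) * hypF1 ρ ν (1 / z) = connP ρ ν * hypE1 ρ ν z +
      connQ ρ ν * ((-z) ^ (1 / 2 : ℂ) * hypE2 ρ ν z) := by
  have h1 := isGaussContinuation_hypE1 hν ρ
  have h2 := isGaussContinuation_hypE2 hν ρ
  have hF : hypF1 ρ ν (1 / z) = gaussQuad ((ρ + ν) / 2) (1 + ν) (1 / z) :=
    (isGaussContinuation_hypF1 hν ρ).eqOn
      (isGaussContinuation_gaussQuad _ (one_add_ne_neg_nat hν)) (one_div_mem_cutPlane hz)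
  rw [hF]
  change solInfinity ρ ν z = _
  refine (analyticOnNhd_solInfinity ρ ν).eqOn_of_preconnected_of_eventuallyEq
    (g := fun z => connP ρ ν * hypE1 ρ ν z + connQ ρ ν * ((-z) ^ (1 / 2 : ℂ) * hypE2 ρ ν z))
    (fun z hz => ?_) isPreconnected_posCutPlane neg_half_mem_cutDisc.2 ?_ hz
  · have hzc := posCutPlane_subset_cutPlane hz
    exact (analyticAt_const.mul (h1.1 z hzc)).add (analyticAt_const.mul
      ((analyticAt_neg_cpow _ hz).mul (h2.1 z hzc)))
  · filter_upwards [isOpen_cutDisc.mem_nhds neg_half_mem_cutDisc] with y hy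
    rw [solInfinity_eq (one_add_ne_neg_nat hν) hy, h1.2 hy.1, h2.2 hy.1]
    rfl

/-! ### Powers with a given argument -/

/-- If z has argument θ in (0, 2π), then -z has the principal argument θ - π. -/
theorem powArg_eq {z : ℂ} {θ : ℝ} (hz : z ≠ 0) (hθ : θ ∈ Set.Ioo 0 (2 * Real.pi))
    (h : z = ‖z‖ * Complex.exp (θ * Complex.I)) (s : ℂ) :
    powArg z θ s = (-z) ^ s * Complex.exp (Real.pi * Complex.I * s) := by
  have hpos : 0 < ‖z‖ := norm_pos_iff.2 hz
  have e : -z = Complex.exp ((Real.log ‖z‖ : ℂ) + (θ - Real.pi : ℝ) * Complex.I) := by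
    rw [Complex.exp_add, ← Complex.ofReal_exp, Real.exp_log hpos, Complex.ofReal_sub, sub_mul,
      Complex.exp_sub, Complex.exp_pi_mul_I]
    conv_lhs => rw [h]
    ring
  have hlog : Complex.log (-z) = (Real.log ‖z‖ : ℂ) + (θ - Real.pi : ℝ) * Complex.I := by
    rw [e, Complex.log_exp] <;> simp <;> linarith [hθ.1, hθ.2]
  rw [powArg, Complex.cpow_def_of_ne_zero (neg_ne_zero.2 hz), hlog, ← Complex.exp_add]
  congr 1
  push_cast
  ring

theorem powArg_add_two_pi_mul_int (z : ℂ) (θ : ℝ) (k : ℤ) (s : ℂ) :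
    powArg z (θ + 2 * Real.pi * k) s =
      powArg z θ s * Complex.exp (2 * Real.pi * k * Complex.I * s) := by
  rw [powArg, powArg, ← Complex.exp_add]
  congr 1
  push_cast
  ring

theorem mem_posCutPlane_of_arg {z : ℂ} {θ : ℝ} (hz : z ≠ 0) (hθ : θ ∈ Set.Ioo 0 (2 * Real.pi))
    (h : z = ‖z‖ * Complex.exp (θ * Complex.I)) : z ∈ posCutPlane := by
  have hm : (θ - Real.pi) ∈ Set.Ioo (-Real.pi) Real.pi :=
    ⟨by linarith [hθ.1], by linarith [hθ.2]⟩
  have := real_mul_mem_posCutPlane (neg_exp_mem_posCutPlane hm) (norm_pos_iff.2 hz)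
  have e : (‖z‖ : ℂ) * -Complex.exp ((θ - Real.pi : ℝ) * Complex.I) = z := by
    conv_rhs => rw [h]
    rw [Complex.ofReal_sub, sub_mul, Complex.exp_sub, Complex.exp_pi_mul_I]
    ring
  rwa [e] at this

theorem conj_eq_of_arg {z : ℂ} {θ : ℝ} (h : z = ‖z‖ * Complex.exp (θ * Complex.I)) :
    starRingEnd ℂ z = ‖starRingEnd ℂ z‖ * Complex.exp ((-θ : ℝ) * Complex.I) := by
  rw [Complex.norm_conj]
  conv_lhs => rw [h]
  rw [map_mul, Complex.conj_ofReal, ← Complex.exp_conj, map_mul, Complex.conj_ofReal,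
    Complex.conj_I, Complex.ofReal_neg]
  congr 2
  ring

/-- Apply `powArg_eq` to the conjugate with the admissible argument 2π - θ, then undo the turn by
2π. The phase is inverse to that for z, so ρ drops out of the product of the two phases. -/
theorem powArg_conj_eq {z : ℂ} {θ : ℝ} (hz : z ≠ 0) (hθ : θ ∈ Set.Ioo 0 (2 * Real.pi))
    (h : z = ‖z‖ * Complex.exp (θ * Complex.I)) (s : ℂ) :
    powArg (starRingEnd ℂ z) (-θ) s =
      (-starRingEnd ℂ z) ^ s * Complex.exp (-(Real.pi * Complex.I * s)) := by
  have h' := conj_eq_of_arg h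
  have hk := powArg_add_two_pi_mul_int (starRingEnd ℂ z) (-θ) 1 s
  have h2 : starRingEnd ℂ z = ‖starRingEnd ℂ z‖ *
      Complex.exp ((-θ + 2 * Real.pi * (1 : ℤ) : ℝ) * Complex.I) := by
    have e : ((-θ + 2 * Real.pi * (1 : ℤ) : ℝ) : ℂ) * Complex.I =
        (-θ : ℝ) * Complex.I + 2 * Real.pi * Complex.I := by push_cast; ring
    rw [e, Complex.exp_add, Complex.exp_two_pi_mul_I, mul_one]
    exact h'
  rw [powArg_eq (by simpa using hz) ⟨by push_cast; linarith [hθ.2], by push_cast; linarith [hθ.1]⟩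
    h2] at hk
  rw [eq_comm, ← eq_div_iff (Complex.exp_ne_zero _)] at hk
  rw [hk, mul_div_assoc, ← Complex.exp_sub]
  congr 2
  push_cast
  ring

theorem hypG2_eq_hypG1 (ρ ν z : ℂ) (θ : ℝ) : hypG2 ρ ν z θ = hypG1 ρ (-ν) z θ := by
  rw [hypG2, hypG1, hypF2, hypF1, ← sub_eq_add_neg, ← sub_eq_add_neg, ← sub_eq_add_neg]

theorem hypE1_neg {ν : ℂ} (hν : ∀ n : ℤ, ν ≠ n) (ρ : ℂ) {z : ℂ} (hz : z ∈ cutPlane) :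
    hypE1 ρ (-ν) z = hypE1 ρ ν z := by
  have h := isGaussContinuation_hypE1 (neg_ne_int hν) ρ
  refine IsGaussContinuation.eqOn (a := (ρ + ν) / 2) (b := (ρ - ν) / 2) (c := 1 / 2) ⟨h.1, ?_⟩
    (isGaussContinuation_hypE1 hν ρ) hz
  exact fun y hy => (h.2 hy).trans (congrFun (seriesE1_neg ρ ν) y)

theorem hypE2_neg {ν : ℂ} (hν : ∀ n : ℤ, ν ≠ n) (ρ : ℂ) {z : ℂ} (hz : z ∈ cutPlane) :
    hypE2 ρ (-ν) z = hypE2 ρ ν z := by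
  have h := isGaussContinuation_hypE2 (neg_ne_int hν) ρ
  refine IsGaussContinuation.eqOn (a := (ρ + ν + 1) / 2) (b := (ρ - ν + 1) / 2) (c := 3 / 2)
    ⟨h.1, ?_⟩ (isGaussContinuation_hypE2 hν ρ) hz
  exact fun y hy => (h.2 hy).trans (congrFun (seriesE2_neg ρ ν) y)

theorem hypG1_eq {ν : ℂ} (hν : ∀ n : ℤ, ν ≠ n) (ρ : ℂ) {z : ℂ} {θ : ℝ} (hz : z ≠ 0)
    (hθ : θ ∈ Set.Ioo 0 (2 * Real.pi)) (h : z = ‖z‖ * Complex.exp (θ * Complex.I)) :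
    hypG1 ρ ν z θ = Complex.exp (-(Real.pi * Complex.I * ((ρ + ν) / 2))) *
      (connP ρ ν * hypE1 ρ ν z + connQ ρ ν * ((-z) ^ (1 / 2 : ℂ) * hypE2 ρ ν z)) := by
  rw [← neg_cpow_mul_hypF1_eq hν ρ (mem_posCutPlane_of_arg hz hθ h), hypG1, powArg_eq hz hθ h,
    neg_div, mul_neg]
  ring

theorem conj_mem_posCutPlane {z : ℂ} (hz : z ∈ posCutPlane) : starRingEnd ℂ z ∈ posCutPlane := by
  change -z ∈ Complex.slitPlane at hz
  change -starRingEnd ℂ z ∈ Complex.slitPlane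
  rw [Complex.mem_slitPlane_iff] at hz ⊢
  simpa using hz

theorem conj_mem_cutPlane {z : ℂ} (hz : z ∈ cutPlane) : starRingEnd ℂ z ∈ cutPlane := by
  rw [mem_cutPlane_iff, Complex.mem_slitPlane_iff] at hz ⊢
  simpa using hz

theorem hypG1_conj_eq {ν : ℂ} (hν : ∀ n : ℤ, ν ≠ n) (ρ : ℂ) {z : ℂ} {θ : ℝ} (hz : z ≠ 0)
    (hθ : θ ∈ Set.Ioo 0 (2 * Real.pi)) (h : z = ‖z‖ * Complex.exp (θ * Complex.I)) :
    hypG1 ρ ν (starRingEnd ℂ z) (-θ) = Complex.exp (Real.pi * Complex.I * ((ρ + ν) / 2)) *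
      (connP ρ ν * hypE1 ρ ν (starRingEnd ℂ z) +
        connQ ρ ν * ((-starRingEnd ℂ z) ^ (1 / 2 : ℂ) * hypE2 ρ ν (starRingEnd ℂ z))) := by
  rw [← neg_cpow_mul_hypF1_eq hν ρ (conj_mem_posCutPlane (mem_posCutPlane_of_arg hz hθ h)), hypG1,
    powArg_conj_eq hz hθ h, neg_div, mul_neg, neg_neg]
  ring

/-- Off the cut the principal square root commutes with conjugation, so the product is
|(-z)^(1/2)|². -/
theorem neg_cpow_half_mul_conj {z : ℂ} (hz : z ∈ posCutPlane) :
    (-z) ^ (1 / 2 : ℂ) * (-starRingEnd ℂ z) ^ (1 / 2 : ℂ) = ‖z‖ := by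
  have hz0 := ne_zero_of_mem_posCutPlane hz
  have harg := (Complex.mem_slitPlane_iff_arg.1 hz).1
  have hc : starRingEnd ℂ (1 / 2 : ℂ) = 1 / 2 := Complex.ext (by simp) (by simp)
  have hsq : ((-z) ^ (1 / 2 : ℂ)) ^ 2 = -z := by
    rw [one_div]; exact Complex.cpow_nat_inv_pow _ two_ne_zero
  rw [← map_neg, Complex.conj_cpow _ _ harg, hc, Complex.mul_conj, Complex.normSq_eq_norm_sq,
    ← norm_pow, hsq, norm_neg]

/-! ### Gamma factors -/

/-- Duplication splits Γ(ρ + ν), and one half cancels a denominator of `connP`; reflection moves the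
other denominator to the numerator. The Γ-factors of A⁽¹⁾ appear, and `Gamma_mul_connQ` produces
those of A⁽²⁾ likewise. -/
theorem Gamma_mul_connP {ρ ν : ℂ} (h1 : ∀ n : ℕ, ρ + ν ≠ -n) (h2 : ∀ n : ℕ, ρ - ν ≠ -n) :
    Complex.Gamma (ρ + ν) * connP ρ ν = Complex.Gamma (1 + ν) * ((2 : ℂ) ^ (ρ + ν - 1) *
      (Complex.Gamma ((ρ + ν) / 2) * Complex.Gamma ((ρ - ν) / 2)) *
        (Complex.sin (Real.pi * ((ρ - ν) / 2)) / Real.pi)) := by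
  have g1 : Complex.Gamma ((1 + ρ + ν) / 2) ≠ 0 := Complex.Gamma_ne_zero fun n hn =>
    h1 (2 * n + 1) (by push_cast; linear_combination 2 * hn)
  have g2 : Complex.Gamma ((ρ - ν) / 2) ≠ 0 := Complex.Gamma_ne_zero fun n hn =>
    h2 (2 * n) (by push_cast; linear_combination 2 * hn)
  have hdup := Complex.Gamma_mul_Gamma_add_half ((ρ + ν) / 2)
  have hr := inv_Gamma_mul_inv_Gamma_one_sub ((ρ - ν) / 2)
  rw [show 2 * ((ρ + ν) / 2) = ρ + ν by ring, show (ρ + ν) / 2 + 1 / 2 = (1 + ρ + ν) / 2 by ring]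
    at hdup
  have hpow : (2 : ℂ) ^ (ρ + ν - 1) * (2 : ℂ) ^ (1 - (ρ + ν)) = 1 := by
    rw [← Complex.cpow_add _ _ two_ne_zero]; simp
  rw [← hr, connP, show 1 + (ν - ρ) / 2 = 1 - (ρ - ν) / 2 by ring]
  generalize (Complex.Gamma (1 - (ρ - ν) / 2))⁻¹ = i
  generalize Complex.Gamma ((ρ + ν) / 2) = a at *
  generalize Complex.Gamma ((ρ - ν) / 2) = b at *
  generalize Complex.Gamma ((1 + ρ + ν) / 2) = c at *
  generalize (2 : ℂ) ^ (ρ + ν - 1) = x at *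
  generalize (2 : ℂ) ^ (1 - (ρ + ν)) = y at *
  generalize ((√Real.pi : ℝ) : ℂ) = w at *
  field_simp
  linear_combination -i * Complex.Gamma (1 + ν) * (x * hdup + Complex.Gamma (ρ + ν) * w * hpow)

theorem Gamma_mul_connQ {ρ ν : ℂ} (h1 : ∀ n : ℕ, ρ + ν ≠ -n) (h2 : ∀ n : ℕ, ρ - ν ≠ -n) :
    Complex.Gamma (ρ + ν) * connQ ρ ν = Complex.Gamma (1 + ν) * (-2 * (2 : ℂ) ^ (ρ + ν - 1) *
      (Complex.Gamma ((1 + ρ + ν) / 2) * Complex.Gamma ((1 + ρ - ν) / 2)) *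
        (Complex.cos (Real.pi * ((ρ - ν) / 2)) / Real.pi)) := by
  have g1 : Complex.Gamma ((ρ + ν) / 2) ≠ 0 := Complex.Gamma_ne_zero fun n hn =>
    h1 (2 * n) (by push_cast; linear_combination 2 * hn)
  have g2 : Complex.Gamma ((1 + ρ - ν) / 2) ≠ 0 := Complex.Gamma_ne_zero fun n hn =>
    h2 (2 * n + 1) (by push_cast; linear_combination 2 * hn)
  have hdup := Complex.Gamma_mul_Gamma_add_half ((ρ + ν) / 2)
  have hr := inv_Gamma_half_add_mul ((ρ - ν) / 2)
  rw [show 2 * ((ρ + ν) / 2) = ρ + ν by ring, show (ρ + ν) / 2 + 1 / 2 = (1 + ρ + ν) / 2 by ring]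
    at hdup
  have hpow : (2 : ℂ) ^ (ρ + ν - 1) * (2 : ℂ) ^ (1 - (ρ + ν)) = 1 := by
    rw [← Complex.cpow_add _ _ two_ne_zero]; simp
  rw [← hr, connQ, show (1 + ν - ρ) / 2 = 1 / 2 - (ρ - ν) / 2 by ring,
    show 1 / 2 + (ρ - ν) / 2 = (1 + ρ - ν) / 2 by ring]
  generalize (Complex.Gamma (1 / 2 - (ρ - ν) / 2))⁻¹ = i
  generalize Complex.Gamma ((ρ + ν) / 2) = a at *
  generalize Complex.Gamma ((1 + ρ - ν) / 2) = b at *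
  generalize Complex.Gamma ((1 + ρ + ν) / 2) = c at *
  generalize (2 : ℂ) ^ (ρ + ν - 1) = x at *
  generalize (2 : ℂ) ^ (1 - (ρ + ν)) = y at *
  generalize ((√Real.pi : ℝ) : ℂ) = w at *
  field_simp
  linear_combination i * Complex.Gamma (1 + ν) * (x * hdup + Complex.Gamma (ρ + ν) * w * hpow)

/-- The powers of 2 left by the two duplications combine with `4 ^ (-μ)` to turn (2π)^(2ρ) into 4
π^(2ρ); the shift δ cancels. -/
theorem four_cpow_mul_two_cpow (ρ μ δ : ℂ) :
    (4 : ℂ) ^ (-μ) * ((2 : ℂ) ^ (ρ + (μ + δ) - 1) * (2 : ℂ) ^ (ρ + (μ - δ) - 1)) *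
      (4 * (Real.pi : ℂ) ^ (2 * ρ)) = (2 * Real.pi : ℂ) ^ (2 * ρ) := by
  have h4 : (4 : ℂ) = ((2 : ℝ) : ℂ) * ((2 : ℝ) : ℂ) := by push_cast; norm_num
  have e1 : (4 : ℂ) ^ (-μ) = (2 : ℂ) ^ (-μ) * (2 : ℂ) ^ (-μ) := by
    rw [h4, Complex.mul_cpow_ofReal_nonneg (by norm_num) (by norm_num)]; norm_num
  have e2 : (2 * Real.pi : ℂ) ^ (2 * ρ) = (2 : ℂ) ^ (2 * ρ) * (Real.pi : ℂ) ^ (2 * ρ) := by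
    have := Complex.mul_cpow_ofReal_nonneg (a := 2) (b := Real.pi) (by norm_num) Real.pi_pos.le
      (2 * ρ)
    exact_mod_cast this
  have e3 : (2 : ℂ) ^ (-μ) * (2 : ℂ) ^ (-μ) * ((2 : ℂ) ^ (ρ + (μ + δ) - 1) *
      (2 : ℂ) ^ (ρ + (μ - δ) - 1)) * 4 = (2 : ℂ) ^ (2 * ρ) := by
    have h2 : (4 : ℂ) = (2 : ℂ) ^ (2 : ℂ) := by norm_num
    rw [h2, ← Complex.cpow_add _ _ two_ne_zero, ← Complex.cpow_add _ _ two_ne_zero,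
      ← Complex.cpow_add _ _ two_ne_zero, ← Complex.cpow_add _ _ two_ne_zero]
    congr 1
    ring
  rw [e1, e2, ← e3]
  ring

/-! ### The bilinear identity -/

theorem cos_pi_mul_int (d : ℤ) : Complex.cos (Real.pi * d) = (-1 : ℂ) ^ d := by
  have h : Complex.cos (Real.pi * d) = ((Real.cos (d * Real.pi) : ℝ) : ℂ) := by
    push_cast; rw [mul_comm]
  rw [h, Real.cos_int_mul_pi]; push_cast; rfl

theorem sin_pi_mul_int (d : ℤ) : Complex.sin (Real.pi * d) = 0 := by
  rw [mul_comm]; exact Complex.sin_int_mul_pi d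

theorem exp_pi_mul_I_mul_int (d : ℤ) : Complex.exp (Real.pi * Complex.I * d) = (-1 : ℂ) ^ d := by
  rw [show Real.pi * Complex.I * d = (Real.pi * d) * Complex.I by ring, Complex.exp_mul_I,
    cos_pi_mul_int, sin_pi_mul_int, zero_mul, add_zero]

theorem coeffC_eq (ρ μ : ℂ) (d : ℤ) :
    (4 : ℂ) ^ (-μ) * coeffC ρ μ d = -(4 : ℂ) ^ (-μ) * Complex.sin (Real.pi * (ρ + μ)) /
      ((2 * Real.pi : ℂ) ^ (2 * ρ) * Complex.sin (Real.pi * μ)) *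
      (Complex.Gamma (ρ + (μ + d)) / Complex.Gamma (1 + (μ + d))) *
      (Complex.Gamma (ρ + (μ - d)) / Complex.Gamma (1 + (μ - d))) := by
  rw [coeffC, ← add_assoc, ← add_sub_assoc, ← add_assoc, ← add_sub_assoc]
  ring

/-- A quadratic combination of the normalised connection coefficients. -/
theorem coeffC_mul {ρ μ : ℂ} (d : ℤ) (hμ : ∀ n : ℤ, μ ≠ n) {X Y x y : ℂ}
    (hX : Complex.Gamma (ρ + (μ + d)) * X =
      Complex.Gamma (1 + (μ + d)) * ((2 : ℂ) ^ (ρ + (μ + d) - 1) * x))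
    (hY : Complex.Gamma (ρ + (μ - d)) * Y =
      Complex.Gamma (1 + (μ - d)) * ((2 : ℂ) ^ (ρ + (μ - d) - 1) * y)) :
    (4 : ℂ) ^ (-μ) * coeffC ρ μ d * (X * Y) = -Complex.sin (Real.pi * (ρ + μ)) /
      (4 * (Real.pi : ℂ) ^ (2 * ρ) * Complex.sin (Real.pi * μ)) * (x * y) := by
  have g1 : Complex.Gamma (1 + (μ + d)) ≠ 0 := Complex.Gamma_ne_zero fun n hn =>
    hμ (-n - 1 - d) (by push_cast; linear_combination hn)
  have g2 : Complex.Gamma (1 + (μ - d)) ≠ 0 := Complex.Gamma_ne_zero fun n hn =>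
    hμ (-n - 1 + d) (by push_cast; linear_combination hn)
  have hpi : (Real.pi : ℂ) ≠ 0 := by exact_mod_cast Real.pi_ne_zero
  have hs := sin_pi_mul_ne_zero_of_ne_int hμ
  have hp : (Real.pi : ℂ) ^ (2 * ρ) ≠ 0 := by simp [Complex.cpow_eq_zero_iff, hpi]
  have h2p : (2 * Real.pi : ℂ) ^ (2 * ρ) ≠ 0 := by simp [Complex.cpow_eq_zero_iff, hpi]
  have hk := four_cpow_mul_two_cpow ρ μ d
  have hX' : Complex.Gamma (ρ + (μ + d)) / Complex.Gamma (1 + (μ + d)) * X =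
      (2 : ℂ) ^ (ρ + (μ + d) - 1) * x := by
    rw [div_mul_eq_mul_div, hX, mul_div_cancel_left₀ _ g1]
  have hY' : Complex.Gamma (ρ + (μ - d)) / Complex.Gamma (1 + (μ - d)) * Y =
      (2 : ℂ) ^ (ρ + (μ - d) - 1) * y := by
    rw [div_mul_eq_mul_div, hY, mul_div_cancel_left₀ _ g2]
  rw [coeffC_eq]
  calc _ = -(4 : ℂ) ^ (-μ) * Complex.sin (Real.pi * (ρ + μ)) /
        ((2 * Real.pi : ℂ) ^ (2 * ρ) * Complex.sin (Real.pi * μ)) *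
        (Complex.Gamma (ρ + (μ + d)) / Complex.Gamma (1 + (μ + d)) * X) *
        (Complex.Gamma (ρ + (μ - d)) / Complex.Gamma (1 + (μ - d)) * Y) := by ring
    _ = _ := by
      rw [hX', hY', ← hk]
      rw [← hk] at h2p
      have := left_ne_zero_of_mul h2p
      generalize Complex.sin (Real.pi * (ρ + μ)) = s1 at *
      generalize Complex.sin (Real.pi * μ) = s2 at *
      generalize (2 : ℂ) ^ (ρ + (μ + d) - 1) = t1 at *
      generalize (2 : ℂ) ^ (ρ + (μ - d) - 1) = t2 at *
      generalize (4 : ℂ) ^ (-μ) = t3 at *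
      generalize (Real.pi : ℂ) ^ (2 * ρ) = t4 at *
      have n3 := left_ne_zero_of_mul this
      have n12 := right_ne_zero_of_mul this
      have n1 := left_ne_zero_of_mul n12
      have n2 := right_ne_zero_of_mul n12
      field_simp

theorem two_mul_sin_mul_sin (ρ μ : ℂ) (d : ℤ) :
    2 * (Complex.sin (Real.pi * ((ρ - (μ + d)) / 2)) *
      Complex.sin (Real.pi * ((ρ - (μ - d)) / 2))) =
      (-1 : ℂ) ^ d - Complex.cos (Real.pi * (ρ - μ)) := by
  have h1 := Complex.cos_sub (Real.pi * ((ρ - (μ - d)) / 2)) (Real.pi * ((ρ - (μ + d)) / 2))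
  have h2 := Complex.cos_add (Real.pi * ((ρ - (μ - d)) / 2)) (Real.pi * ((ρ - (μ + d)) / 2))
  rw [show Real.pi * ((ρ - (μ - d)) / 2) - Real.pi * ((ρ - (μ + d)) / 2) = Real.pi * d by ring,
    cos_pi_mul_int] at h1
  rw [show Real.pi * ((ρ - (μ - d)) / 2) + Real.pi * ((ρ - (μ + d)) / 2) = Real.pi * (ρ - μ)
    by ring] at h2
  linear_combination h2 - h1

theorem two_mul_cos_mul_cos (ρ μ : ℂ) (d : ℤ) :
    2 * (Complex.cos (Real.pi * ((ρ - (μ + d)) / 2)) *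
      Complex.cos (Real.pi * ((ρ - (μ - d)) / 2))) =
      (-1 : ℂ) ^ d + Complex.cos (Real.pi * (ρ - μ)) := by
  have h1 := Complex.cos_sub (Real.pi * ((ρ - (μ - d)) / 2)) (Real.pi * ((ρ - (μ + d)) / 2))
  have h2 := Complex.cos_add (Real.pi * ((ρ - (μ - d)) / 2)) (Real.pi * ((ρ - (μ + d)) / 2))
  rw [show Real.pi * ((ρ - (μ - d)) / 2) - Real.pi * ((ρ - (μ + d)) / 2) = Real.pi * d by ring,
    cos_pi_mul_int] at h1
  rw [show Real.pi * ((ρ - (μ - d)) / 2) + Real.pi * ((ρ - (μ + d)) / 2) = Real.pi * (ρ - μ)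
    by ring] at h2
  linear_combination -h2 - h1

theorem two_mul_sin_mul_cos (ρ μ : ℂ) (d : ℤ) :
    2 * (Complex.sin (Real.pi * ((ρ - (μ + d)) / 2)) *
      Complex.cos (Real.pi * ((ρ - (μ - d)) / 2))) = Complex.sin (Real.pi * (ρ - μ)) := by
  have h1 := Complex.sin_sub (Real.pi * ((ρ - (μ + d)) / 2)) (Real.pi * ((ρ - (μ - d)) / 2))
  have h2 := Complex.sin_add (Real.pi * ((ρ - (μ + d)) / 2)) (Real.pi * ((ρ - (μ - d)) / 2))
  rw [show Real.pi * ((ρ - (μ + d)) / 2) - Real.pi * ((ρ - (μ - d)) / 2) = -(Real.pi * d) by ring,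
    Complex.sin_neg, sin_pi_mul_int] at h1
  rw [show Real.pi * ((ρ - (μ + d)) / 2) + Real.pi * ((ρ - (μ - d)) / 2) = Real.pi * (ρ - μ)
    by ring] at h2
  linear_combination -h2 - h1

theorem pi_cpow_add_two (ρ : ℂ) :
    (Real.pi : ℂ) ^ (2 * ρ + 2) = (Real.pi : ℂ) ^ (2 * ρ) * (Real.pi : ℂ) ^ 2 := by
  have hpi : (Real.pi : ℂ) ≠ 0 := by exact_mod_cast Real.pi_ne_zero
  rw [Complex.cpow_add _ _ hpi, ← Complex.cpow_natCast]
  norm_num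

theorem coeffC_neg_int (ρ μ : ℂ) (d : ℤ) : coeffC ρ μ (-d) = coeffC ρ μ d := by
  rw [coeffC, coeffC]
  push_cast
  rw [sub_neg_eq_add, sub_neg_eq_add, ← sub_eq_add_neg, ← sub_eq_add_neg,
    mul_comm (Complex.Gamma (ρ + μ - d)), mul_comm (Complex.Gamma (1 + μ - d))]

theorem coeffA1_neg (ρ μ : ℂ) (d : ℤ) : coeffA1 ρ (-μ) (-d) = coeffA1 ρ μ d := by
  rw [coeffA1, coeffA1]
  push_cast
  simp only [sub_neg_eq_add, ← sub_eq_add_neg]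
  ring

theorem coeffA2_neg (ρ μ : ℂ) (d : ℤ) : coeffA2 ρ (-μ) (-d) = coeffA2 ρ μ d := by
  rw [coeffA2, coeffA2]
  push_cast
  simp only [sub_neg_eq_add, ← sub_eq_add_neg]
  ring

section Bilinear

variable {ρ μ : ℂ} {d : ℤ}

theorem coeffC_mul_connP_mul_connP (hμ : ∀ n : ℤ, μ ≠ n)
    (hpp : ∀ n : ℕ, ρ + μ + d ≠ -n) (hpm : ∀ n : ℕ, ρ + μ - d ≠ -n)
    (hmp : ∀ n : ℕ, ρ - μ + d ≠ -n) (hmm : ∀ n : ℕ, ρ - μ - d ≠ -n) :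
    (4 : ℂ) ^ (-μ) * coeffC ρ μ d * (connP ρ (μ + d) * connP ρ (μ - d)) =
      -Complex.sin (Real.pi * (ρ + μ)) /
        (8 * (Real.pi : ℂ) ^ (2 * ρ + 2) * Complex.sin (Real.pi * μ)) *
        (coeffA1 ρ μ d * ((-1 : ℂ) ^ d - Complex.cos (Real.pi * (ρ - μ)))) := by
  have hX := Gamma_mul_connP (ρ := ρ) (ν := μ + d) (fun n => by rw [← add_assoc]; exact hpp n)
    (fun n => by rw [← sub_sub]; exact hmm n)
  have hY := Gamma_mul_connP (ρ := ρ) (ν := μ - d) (fun n => by rw [← add_sub_assoc]; exact hpm n)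
    (fun n => by rw [← sub_add]; exact hmp n)
  rw [mul_assoc ((2 : ℂ) ^ _)] at hX hY
  rw [coeffC_mul d hμ hX hY, ← two_mul_sin_mul_sin, coeffA1, pi_cpow_add_two]
  simp only [← sub_sub, ← sub_add, ← add_assoc, ← add_sub_assoc]
  field

theorem coeffC_mul_connQ_mul_connQ (hμ : ∀ n : ℤ, μ ≠ n)
    (hpp : ∀ n : ℕ, ρ + μ + d ≠ -n) (hpm : ∀ n : ℕ, ρ + μ - d ≠ -n)
    (hmp : ∀ n : ℕ, ρ - μ + d ≠ -n) (hmm : ∀ n : ℕ, ρ - μ - d ≠ -n) :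
    (4 : ℂ) ^ (-μ) * coeffC ρ μ d * (connQ ρ (μ + d) * connQ ρ (μ - d)) =
      -Complex.sin (Real.pi * (ρ + μ)) /
        (8 * (Real.pi : ℂ) ^ (2 * ρ + 2) * Complex.sin (Real.pi * μ)) *
        (4 * coeffA2 ρ μ d * ((-1 : ℂ) ^ d + Complex.cos (Real.pi * (ρ - μ)))) := by
  have hX := Gamma_mul_connQ (ρ := ρ) (ν := μ + d) (fun n => by rw [← add_assoc]; exact hpp n)
    (fun n => by rw [← sub_sub]; exact hmm n)
  have hY := Gamma_mul_connQ (ρ := ρ) (ν := μ - d) (fun n => by rw [← add_sub_assoc]; exact hpm n)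
    (fun n => by rw [← sub_add]; exact hmp n)
  rw [mul_comm (-2 : ℂ), mul_assoc ((2 : ℂ) ^ _), mul_assoc ((2 : ℂ) ^ _)] at hX hY
  rw [coeffC_mul d hμ hX hY, ← two_mul_cos_mul_cos, coeffA2, pi_cpow_add_two]
  simp only [← sub_sub, ← sub_add, ← add_assoc, ← add_sub_assoc]
  field

theorem coeffC_mul_connP_mul_connQ (hμ : ∀ n : ℤ, μ ≠ n)
    (hpp : ∀ n : ℕ, ρ + μ + d ≠ -n) (hpm : ∀ n : ℕ, ρ + μ - d ≠ -n)
    (hmp : ∀ n : ℕ, ρ - μ + d ≠ -n) (hmm : ∀ n : ℕ, ρ - μ - d ≠ -n) :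
    (4 : ℂ) ^ (-μ) * coeffC ρ μ d * (connP ρ (μ + d) * connQ ρ (μ - d)) =
      -Complex.sin (Real.pi * (ρ + μ)) /
        (8 * (Real.pi : ℂ) ^ (2 * ρ + 2) * Complex.sin (Real.pi * μ)) *
        (-2 * (Complex.Gamma ((ρ + μ + d) / 2) * Complex.Gamma ((ρ - μ - d) / 2) *
          (Complex.Gamma ((1 + ρ + μ - d) / 2) * Complex.Gamma ((1 + ρ - μ + d) / 2))) *
          Complex.sin (Real.pi * (ρ - μ))) := by
  have hX := Gamma_mul_connP (ρ := ρ) (ν := μ + d) (fun n => by rw [← add_assoc]; exact hpp n)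
    (fun n => by rw [← sub_sub]; exact hmm n)
  have hY := Gamma_mul_connQ (ρ := ρ) (ν := μ - d) (fun n => by rw [← add_sub_assoc]; exact hpm n)
    (fun n => by rw [← sub_add]; exact hmp n)
  rw [mul_assoc ((2 : ℂ) ^ _)] at hX
  rw [mul_comm (-2 : ℂ), mul_assoc ((2 : ℂ) ^ _), mul_assoc ((2 : ℂ) ^ _)] at hY
  rw [coeffC_mul d hμ hX hY, ← two_mul_sin_mul_cos ρ μ d, pi_cpow_add_two]
  simp only [← sub_sub, ← sub_add, ← add_assoc, ← add_sub_assoc]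
  field

theorem neg_one_zpow_mul_self (d : ℤ) : (-1 : ℂ) ^ d * (-1 : ℂ) ^ d = 1 := by
  rw [← mul_zpow]; simp

/-- With σ = (-1)^d, the sum over ±μ reduces, by addition formulas, to 2 sin(πμ) (cos(πμ) - σ
cos(πρ)). Cancelling sin(πμ) and multiplying by σ gives the numerator of B, since σ² = 1. -/
theorem bilinear_connP (hμ : ∀ n : ℤ, μ ≠ n)
    (hpp : ∀ n : ℕ, ρ + μ + d ≠ -n) (hpm : ∀ n : ℕ, ρ + μ - d ≠ -n)
    (hmp : ∀ n : ℕ, ρ - μ + d ≠ -n) (hmm : ∀ n : ℕ, ρ - μ - d ≠ -n) :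
    (-1 : ℂ) ^ d * ((4 : ℂ) ^ (-μ) * coeffC ρ μ d * (connP ρ (μ + d) * connP ρ (μ - d)) +
      (4 : ℂ) ^ μ * coeffC ρ (-μ) (-d) * (connP ρ (-(μ + d)) * connP ρ (-(μ - d)))) =
      coeffB ρ μ d * coeffA1 ρ μ d := by
  have h1 := coeffC_mul_connP_mul_connP hμ hpp hpm hmp hmm
  -- The second summand is the first under (μ, d) ↦ (-μ, -d), which permutes the four conditions on
  -- ρ ± μ ± d and fixes A⁽¹⁾.
  have h2 := coeffC_mul_connP_mul_connP (ρ := ρ) (μ := -μ) (d := -d) (neg_ne_int hμ)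
    (by simpa [← sub_eq_add_neg] using hmm) (by simpa [← sub_eq_add_neg] using hmp)
    (by simpa [← sub_eq_add_neg] using hpm) (by simpa [← sub_eq_add_neg] using hpp)
  rw [coeffA1_neg, neg_neg, show -μ + ((-d : ℤ) : ℂ) = -(μ + d) by push_cast; ring,
    show -μ - ((-d : ℤ) : ℂ) = -(μ - d) by push_cast; ring, mul_neg, Complex.sin_neg,
    sub_neg_eq_add, ← sub_eq_add_neg, zpow_neg, ← inv_zpow, inv_neg_one] at h2
  have hs := sin_pi_mul_ne_zero_of_ne_int hμ
  have hpi : (Real.pi : ℂ) ≠ 0 := by exact_mod_cast Real.pi_ne_zero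
  have hp : (Real.pi : ℂ) ^ (2 * ρ + 2) ≠ 0 := by simp [Complex.cpow_eq_zero_iff, hpi]
  have hsq := neg_one_zpow_mul_self d
  rw [h1, h2, coeffB, mul_add (Real.pi : ℂ), mul_sub (Real.pi : ℂ),
    Complex.sin_add, Complex.sin_sub, Complex.cos_add,
    Complex.cos_sub]
  have hc := Complex.sin_sq_add_cos_sq (Real.pi * ρ)
  generalize coeffA1 ρ μ d = A at *
  generalize Complex.sin (Real.pi * μ) = s1 at *
  generalize Complex.cos (Real.pi * μ) = c1 at *
  generalize Complex.sin (Real.pi * ρ) = s2 at *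
  generalize Complex.cos (Real.pi * ρ) = c2 at *
  generalize (Real.pi : ℂ) ^ (2 * ρ + 2) = P at *
  generalize (-1 : ℂ) ^ d = σ at *
  field_simp
  linear_combination 8 * A * s1 * (σ * c1 * hc - c2 * hsq)

theorem bilinear_connQ (hμ : ∀ n : ℤ, μ ≠ n)
    (hpp : ∀ n : ℕ, ρ + μ + d ≠ -n) (hpm : ∀ n : ℕ, ρ + μ - d ≠ -n)
    (hmp : ∀ n : ℕ, ρ - μ + d ≠ -n) (hmm : ∀ n : ℕ, ρ - μ - d ≠ -n) :
    (-1 : ℂ) ^ d * ((4 : ℂ) ^ (-μ) * coeffC ρ μ d * (connQ ρ (μ + d) * connQ ρ (μ - d)) +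
      (4 : ℂ) ^ μ * coeffC ρ (-μ) (-d) * (connQ ρ (-(μ + d)) * connQ ρ (-(μ - d)))) =
      coeffB ρ μ (d + 1) * coeffA2 ρ μ d * 4 := by
  have h1 := coeffC_mul_connQ_mul_connQ hμ hpp hpm hmp hmm
  have h2 := coeffC_mul_connQ_mul_connQ (ρ := ρ) (μ := -μ) (d := -d) (neg_ne_int hμ)
    (by simpa [← sub_eq_add_neg] using hmm) (by simpa [← sub_eq_add_neg] using hmp)
    (by simpa [← sub_eq_add_neg] using hpm) (by simpa [← sub_eq_add_neg] using hpp)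
  rw [coeffA2_neg, neg_neg, show -μ + ((-d : ℤ) : ℂ) = -(μ + d) by push_cast; ring,
    show -μ - ((-d : ℤ) : ℂ) = -(μ - d) by push_cast; ring, mul_neg, Complex.sin_neg,
    sub_neg_eq_add, ← sub_eq_add_neg, zpow_neg, ← inv_zpow, inv_neg_one] at h2
  have hs := sin_pi_mul_ne_zero_of_ne_int hμ
  have hpi : (Real.pi : ℂ) ≠ 0 := by exact_mod_cast Real.pi_ne_zero
  have hp : (Real.pi : ℂ) ^ (2 * ρ + 2) ≠ 0 := by simp [Complex.cpow_eq_zero_iff, hpi]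
  have hsq := neg_one_zpow_mul_self d
  rw [h1, h2, coeffB, mul_add (Real.pi : ℂ), mul_sub (Real.pi : ℂ),
    Complex.sin_add, Complex.sin_sub, Complex.cos_add,
    Complex.cos_sub, zpow_add₀ (by norm_num : (-1 : ℂ) ≠ 0), zpow_one]
  have hc := Complex.sin_sq_add_cos_sq (Real.pi * ρ)
  generalize coeffA2 ρ μ d = A at *
  generalize Complex.sin (Real.pi * μ) = s1 at *
  generalize Complex.cos (Real.pi * μ) = c1 at *
  generalize Complex.sin (Real.pi * ρ) = s2 at *
  generalize Complex.cos (Real.pi * ρ) = c2 at *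
  generalize (Real.pi : ℂ) ^ (2 * ρ + 2) = P at *
  generalize (-1 : ℂ) ^ d = σ at *
  field_simp
  linear_combination -8 * A * s1 * (σ * c1 * hc + c2 * hsq)

/-- The Γ-product is invariant under (μ, d) ↦ (-μ, -d), whereas sin π(ρ + μ) sin π(ρ - μ) / sin(πμ)
is odd in μ; the two summands cancel. -/
theorem bilinear_connP_connQ (hμ : ∀ n : ℤ, μ ≠ n)
    (hpp : ∀ n : ℕ, ρ + μ + d ≠ -n) (hpm : ∀ n : ℕ, ρ + μ - d ≠ -n)
    (hmp : ∀ n : ℕ, ρ - μ + d ≠ -n) (hmm : ∀ n : ℕ, ρ - μ - d ≠ -n) :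
    (4 : ℂ) ^ (-μ) * coeffC ρ μ d * (connP ρ (μ + d) * connQ ρ (μ - d)) +
      (4 : ℂ) ^ μ * coeffC ρ (-μ) (-d) * (connP ρ (-(μ + d)) * connQ ρ (-(μ - d))) = 0 := by
  have h1 := coeffC_mul_connP_mul_connQ hμ hpp hpm hmp hmm
  have h2 := coeffC_mul_connP_mul_connQ (ρ := ρ) (μ := -μ) (d := -d) (neg_ne_int hμ)
    (by simpa [← sub_eq_add_neg] using hmm) (by simpa [← sub_eq_add_neg] using hmp)
    (by simpa [← sub_eq_add_neg] using hpm) (by simpa [← sub_eq_add_neg] using hpp)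
  rw [neg_neg, show -μ + ((-d : ℤ) : ℂ) = -(μ + d) by push_cast; ring,
    show -μ - ((-d : ℤ) : ℂ) = -(μ - d) by push_cast; ring, mul_neg, Complex.sin_neg] at h2
  push_cast at h2
  simp only [sub_neg_eq_add, ← sub_eq_add_neg] at h2
  rw [h1, h2]
  ring

theorem combInfinity_eq_combZero (hμ : ∀ n : ℤ, μ ≠ n)
    (hpp : ∀ n : ℕ, ρ + μ + d ≠ -n) (hpm : ∀ n : ℕ, ρ + μ - d ≠ -n)
    (hmp : ∀ n : ℕ, ρ - μ + d ≠ -n) (hmm : ∀ n : ℕ, ρ - μ - d ≠ -n)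
    {z : ℂ} {θ : ℝ} (hz : z ≠ 0) (hθ : θ ∈ Set.Ioo 0 (2 * Real.pi))
    (h : z = ‖z‖ * Complex.exp (θ * Complex.I)) :
    combInfinity ρ μ d z θ = combZero ρ μ d z := by
  have hν1 : ∀ n : ℤ, μ + d ≠ n := fun n hn => hμ (n - d) (by push_cast; linear_combination hn)
  have hν2 : ∀ n : ℤ, μ - d ≠ n := fun n hn => hμ (n + d) (by push_cast; linear_combination hn)
  have hmem := mem_posCutPlane_of_arg hz hθ h
  have hzc := posCutPlane_subset_cutPlane hmem
  have hzc' := conj_mem_cutPlane hzc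
  have b1 := bilinear_connP hμ hpp hpm hmp hmm
  have b2 := bilinear_connQ hμ hpp hpm hmp hmm
  have b3 := bilinear_connP_connQ hμ hpp hpm hmp hmm
  -- Replacing d by -d exchanges μ + d and μ - d, which gives the other cross term.
  have b4 := bilinear_connP_connQ (d := -d) hμ (by simpa [← sub_eq_add_neg] using hpm)
    (by simpa using hpp) (by simpa [← sub_eq_add_neg] using hmm) (by simpa using hmp)
  rw [coeffC_neg_int, coeffC_neg_int, Int.cast_neg, sub_neg_eq_add, ← sub_eq_add_neg] at b4
  have hn := neg_cpow_half_mul_conj hmem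
  -- The phases of the two powers combine to exp(∓iπd) = (-1)^d for the two products; this is the
  -- sign carried by the bilinear identities.
  have p1 : Complex.exp (-(Real.pi * Complex.I * ((ρ + (μ + d)) / 2))) *
      Complex.exp (Real.pi * Complex.I * ((ρ + (μ - d)) / 2)) = (-1 : ℂ) ^ d := by
    rw [← Complex.exp_add, ← inv_neg_one, inv_zpow, ← zpow_neg, ← exp_pi_mul_I_mul_int]
    congr 1
    push_cast
    ring
  have p2 : Complex.exp (-(Real.pi * Complex.I * ((ρ + -(μ + d)) / 2))) *
      Complex.exp (Real.pi * Complex.I * ((ρ + -(μ - d)) / 2)) = (-1 : ℂ) ^ d := by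
    rw [← Complex.exp_add, ← exp_pi_mul_I_mul_int]
    congr 1
    ring
  rw [combInfinity, combZero, hypG2_eq_hypG1, hypG2_eq_hypG1, hypG1_eq hν1 ρ hz hθ h,
    hypG1_conj_eq hν2 ρ hz hθ h, hypG1_eq (neg_ne_int hν1) ρ hz hθ h,
    hypG1_conj_eq (neg_ne_int hν2) ρ hz hθ h, hypE1_neg hν1 ρ hzc, hypE2_neg hν1 ρ hzc,
    hypE1_neg hν2 ρ hzc', hypE2_neg hν2 ρ hzc', ← hn]
  generalize Complex.exp (-(Real.pi * Complex.I * ((ρ + (μ + d)) / 2))) = x1 at *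
  generalize Complex.exp (Real.pi * Complex.I * ((ρ + (μ - d)) / 2)) = x2 at *
  generalize Complex.exp (-(Real.pi * Complex.I * ((ρ + -(μ + d)) / 2))) = x3 at *
  generalize Complex.exp (Real.pi * Complex.I * ((ρ + -(μ - d)) / 2)) = x4 at *
  generalize hypE1 ρ (μ + d) z = e1
  generalize hypE2 ρ (μ + d) z = e2
  generalize hypE1 ρ (μ - d) (starRingEnd ℂ z) = f1
  generalize hypE2 ρ (μ - d) (starRingEnd ℂ z) = f2
  generalize (-z) ^ (1 / 2 : ℂ) = r1
  generalize (-starRingEnd ℂ z) ^ (1 / 2 : ℂ) = r2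
  generalize connP ρ (μ + d) = P1 at *
  generalize connQ ρ (μ + d) = Q1 at *
  generalize connP ρ (μ - d) = P2 at *
  generalize connQ ρ (μ - d) = Q2 at *
  generalize connP ρ (-(μ + d)) = P3 at *
  generalize connQ ρ (-(μ + d)) = Q3 at *
  generalize connP ρ (-(μ - d)) = P4 at *
  generalize connQ ρ (-(μ - d)) = Q4 at *
  generalize (4 : ℂ) ^ (-μ) * coeffC ρ μ d = K1 at *
  generalize (4 : ℂ) ^ μ * coeffC ρ (-μ) (-d) = K2 at *
  linear_combination e1 * f1 * b1 + r1 * r2 * e2 * f2 * b2 +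
    (-1 : ℂ) ^ d * r2 * e1 * f2 * b3 + (-1 : ℂ) ^ d * r1 * e2 * f1 * b4 +
    K1 * (P1 * e1 + Q1 * (r1 * e2)) * (P2 * f1 + Q2 * (r2 * f2)) * p1 +
    K2 * (P3 * e1 + Q3 * (r1 * e2)) * (P4 * f1 + Q4 * (r2 * f2)) * p2

end Bilinear

/-! ### Independence of the argument -/

/-- A shift of the argument by 2πk multiplies the product by exp(-iπk(ν - ν')), which is 1 because ν
- ν' is an even integer. -/
theorem hypG1_mul_hypG1_add_two_pi_mul_int (ρ ν ν' z z' : ℂ) (θ : ℝ) (k m : ℤ)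
    (h : ν - ν' = 2 * m) :
    hypG1 ρ ν z (θ + 2 * Real.pi * k) * hypG1 ρ ν' z' (-(θ + 2 * Real.pi * k)) =
      hypG1 ρ ν z θ * hypG1 ρ ν' z' (-θ) := by
  have e : -(θ + 2 * Real.pi * k) = -θ + 2 * Real.pi * (-k : ℤ) := by push_cast; ring
  have h1 : Complex.exp (2 * Real.pi * k * Complex.I * (-(ρ + ν) / 2)) *
      Complex.exp (2 * Real.pi * (-k : ℤ) * Complex.I * (-(ρ + ν') / 2)) = 1 := by
    rw [← Complex.exp_add, Complex.exp_eq_one_iff]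
    refine ⟨-(k * m), ?_⟩
    push_cast
    linear_combination -(Real.pi * k * Complex.I) * h
  rw [e, hypG1, hypG1, hypG1, hypG1, powArg_add_two_pi_mul_int, powArg_add_two_pi_mul_int]
  linear_combination powArg z θ (-(ρ + ν) / 2) * hypF1 ρ ν (1 / z) *
    (powArg z' (-θ) (-(ρ + ν') / 2) * hypF1 ρ ν' (1 / z')) * h1

theorem combInfinity_add_two_pi_mul_int (ρ μ : ℂ) (d : ℤ) (z : ℂ) (θ : ℝ) (k : ℤ) :
    combInfinity ρ μ d z (θ + 2 * Real.pi * k) = combInfinity ρ μ d z θ := by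
  have h1 := hypG1_mul_hypG1_add_two_pi_mul_int ρ (μ + d) (μ - d) z (starRingEnd ℂ z) θ k d
    (by ring)
  have h2 := hypG1_mul_hypG1_add_two_pi_mul_int ρ (-(μ + d)) (-(μ - d)) z (starRingEnd ℂ z) θ k
    (-d) (by push_cast; ring)
  simp only [combInfinity, hypG2_eq_hypG1]
  linear_combination (4 : ℂ) ^ (-μ) * coeffC ρ μ d * h1 + (4 : ℂ) ^ μ * coeffC ρ (-μ) (-d) * h2

theorem combInfinity_congr_arg (ρ μ : ℂ) (d : ℤ) {z : ℂ} (hz : z ≠ 0) {θ θ' : ℝ}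
    (h : z = ‖z‖ * Complex.exp (θ * Complex.I)) (h' : z = ‖z‖ * Complex.exp (θ' * Complex.I)) :
    combInfinity ρ μ d z θ = combInfinity ρ μ d z θ' := by
  have hn : (‖z‖ : ℂ) ≠ 0 := by simpa using hz
  have he := mul_left_cancel₀ hn (h.symm.trans h')
  obtain ⟨k, hk⟩ := Complex.exp_eq_exp_iff_exists_int.1 he
  have : θ = θ' + 2 * Real.pi * k := by
    have h2 : (θ : ℂ) = θ' + 2 * Real.pi * k :=
      mul_right_cancel₀ Complex.I_ne_zero (by linear_combination hk)
    exact_mod_cast h2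
  rw [this, combInfinity_add_two_pi_mul_int]

theorem exists_arg_mem_Ioo {z : ℂ} (hz : z ∈ posCutPlane) :
    ∃ θ ∈ Set.Ioo 0 (2 * Real.pi), z = ‖z‖ * Complex.exp (θ * Complex.I) := by
  have harg := (Complex.mem_slitPlane_iff_arg.1 hz).1
  have h1 := Complex.neg_pi_lt_arg (-z)
  have h2 := lt_of_le_of_ne (Complex.arg_le_pi (-z)) harg
  refine ⟨(-z).arg + Real.pi, ⟨by linarith, by linarith⟩, ?_⟩
  have := Complex.norm_mul_exp_arg_mul_I (-z)
  rw [norm_neg] at this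
  rw [Complex.ofReal_add, add_mul, Complex.exp_add, Complex.exp_pi_mul_I]
  linear_combination this

theorem eq_norm_mul_exp_arg (z : ℂ) : z = ‖z‖ * Complex.exp (z.arg * Complex.I) :=
  (Complex.norm_mul_exp_arg_mul_I z).symm

/-! ### Regularity of the two combinations -/

theorem continuousOn_hypE1 {ρ ν : ℂ} (hν : ∀ n : ℤ, ν ≠ n) (hρ : ρ.re < 1 / 2) :
    ContinuousOn (hypE1 ρ ν) (Metric.closedBall 0 1) :=
  continuousOn_hyp2F1 (isGaussContinuation_hypE1 hν ρ) half_ne_neg_nat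
    (re_add_sub_neg hρ (by ring))

theorem continuousOn_hypE2 {ρ ν : ℂ} (hν : ∀ n : ℤ, ν ≠ n) (hρ : ρ.re < 1 / 2) :
    ContinuousOn (hypE2 ρ ν) (Metric.closedBall 0 1) :=
  continuousOn_hyp2F1 (isGaussContinuation_hypE2 hν ρ) three_halves_ne_neg_nat
    (re_add_sub_neg hρ (by ring))

theorem continuousOn_hypF1 {ρ ν : ℂ} (hν : ∀ n : ℤ, ν ≠ n) (hρ : ρ.re < 1 / 2) :
    ContinuousOn (hypF1 ρ ν) (Metric.closedBall 0 1) := by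
  have h := isGaussContinuation_hypF1 hν ρ
  rw [hypF1_eq] at h ⊢
  exact continuousOn_hyp2F1 h (one_add_ne_neg_nat hν) (re_add_sub_neg hρ (by ring))

section Regularity

variable {ρ μ : ℂ} {d : ℤ}

theorem add_int_ne_int (hμ : ∀ n : ℤ, μ ≠ n) (d n : ℤ) : μ + d ≠ n := fun hn =>
  hμ (n - d) (by push_cast; linear_combination hn)

theorem sub_int_ne_int (hμ : ∀ n : ℤ, μ ≠ n) (d n : ℤ) : μ - d ≠ n := fun hn =>
  hμ (n + d) (by push_cast; linear_combination hn)

theorem continuousOn_combZero (hμ : ∀ n : ℤ, μ ≠ n) (hρ : ρ.re < 1 / 2) :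
    ContinuousOn (combZero ρ μ d) (Metric.closedBall 0 1) := by
  have hconj : Set.MapsTo (starRingEnd ℂ) (Metric.closedBall (0 : ℂ) 1)
      (Metric.closedBall 0 1) := fun z hz => by simpa using hz
  have cc : ContinuousOn (starRingEnd ℂ) (Metric.closedBall (0 : ℂ) 1) :=
    Complex.continuous_conj.continuousOn
  have hν1 := add_int_ne_int hμ d
  have hν2 := sub_int_ne_int hμ d
  exact ((continuousOn_const.mul (continuousOn_hypE1 hν1 hρ)).mul
    ((continuousOn_hypE1 hν2 hρ).comp cc hconj)).add
    (((continuousOn_const.mul (by fun_prop)).mul (continuousOn_hypE2 hν1 hρ)).mul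
      ((continuousOn_hypE2 hν2 hρ).comp cc hconj))

theorem analyticAt_conj_comp {g : ℂ → ℂ} {w : ℂ} (hg : AnalyticAt ℝ g w) :
    AnalyticAt ℝ (fun u => starRingEnd ℂ (g u)) w :=
  (Complex.conjCLE.toContinuousLinearMap.analyticAt (g w)).fun_comp hg

theorem analyticAt_real_comp {F g : ℂ → ℂ} {w : ℂ} (hF : AnalyticAt ℂ F (g w))
    (hg : AnalyticAt ℝ g w) : AnalyticAt ℝ (fun u => F (g u)) w :=
  (hF.restrictScalars (𝕜 := ℝ)).fun_comp hg

/-- The modulus is the sole obstruction to real-analyticity, so its regularity is a hypothesis. This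
serves both the identity map away from 0 and the squaring map at 0. -/
theorem analyticAt_combZero_comp (hμ : ∀ n : ℤ, μ ≠ n) {g : ℂ → ℂ} {w : ℂ}
    (hg : AnalyticAt ℝ g w) (hn : AnalyticAt ℝ (fun u => (‖g u‖ : ℂ)) w)
    (hw : g w ∈ cutPlane) : AnalyticAt ℝ (fun u => combZero ρ μ d (g u)) w := by
  have hν1 := add_int_ne_int hμ d
  have hν2 := sub_int_ne_int hμ d
  have hw' := conj_mem_cutPlane hw
  have hgc := analyticAt_conj_comp hg
  exact ((analyticAt_const.mul
    (analyticAt_real_comp ((isGaussContinuation_hypE1 hν1 ρ).1 _ hw) hg)).mul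
    (analyticAt_real_comp ((isGaussContinuation_hypE1 hν2 ρ).1 _ hw') hgc)).add
    (((analyticAt_const.mul (analyticAt_const.mul hn)).mul
      (analyticAt_real_comp ((isGaussContinuation_hypE2 hν1 ρ).1 _ hw) hg)).mul
      (analyticAt_real_comp ((isGaussContinuation_hypE2 hν2 ρ).1 _ hw') hgc))

theorem analyticAt_ofReal_norm {z : ℂ} (hz : z ≠ 0) : AnalyticAt ℝ (fun u : ℂ => (‖u‖ : ℂ)) z :=
  (Complex.ofRealCLM.analyticAt ‖z‖).fun_comp
    (analyticWithinAt_univ.1 (contDiffWithinAt_omega_iff_analyticWithinAt.1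
      (contDiffAt_norm ℝ hz : ContDiffAt ℝ ω _ z)))

theorem powArg_arg (z s : ℂ) : powArg z z.arg s = Complex.exp (s * Complex.log z) := by
  rw [powArg, Complex.log]

theorem powArg_conj_neg_arg (z s : ℂ) :
    powArg (starRingEnd ℂ z) (-z.arg) s = Complex.exp (s * starRingEnd ℂ (Complex.log z)) := by
  rw [powArg, Complex.log, Complex.norm_conj]
  simp

theorem hypG1_arg (ρ ν z : ℂ) :
    hypG1 ρ ν z z.arg = Complex.exp (-(ρ + ν) / 2 * Complex.log z) * hypF1 ρ ν (1 / z) := by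
  rw [hypG1, powArg_arg]

theorem hypG1_conj_neg_arg (ρ ν z : ℂ) :
    hypG1 ρ ν (starRingEnd ℂ z) (-z.arg) =
      Complex.exp (-(ρ + ν) / 2 * starRingEnd ℂ (Complex.log z)) *
        hypF1 ρ ν (1 / starRingEnd ℂ z) := by
  rw [hypG1, powArg_conj_neg_arg]

theorem analyticAt_hypG1_arg {ν : ℂ} (hν : ∀ n : ℤ, ν ≠ n) {z : ℂ}
    (hz : z ∈ Complex.slitPlane) (hz' : 1 / z ∈ cutPlane) :
    AnalyticAt ℝ (fun u : ℂ => hypG1 ρ ν u u.arg) z := by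
  simp only [hypG1_arg]
  refine AnalyticAt.restrictScalars (𝕜 := ℝ) (𝕜' := ℂ) ?_
  have h0 := Complex.slitPlane_ne_zero hz
  have h1 : AnalyticAt ℂ (fun z : ℂ => 1 / z) z := analyticAt_const.div analyticAt_id h0
  exact (analyticAt_const.mul (analyticAt_clog hz)).cexp.mul
    (((isGaussContinuation_hypF1 hν ρ).1 _ hz').fun_comp h1)

theorem analyticAt_hypG1_conj_neg_arg {ν : ℂ} (hν : ∀ n : ℤ, ν ≠ n) {z : ℂ}
    (hz : z ∈ Complex.slitPlane) (hz' : 1 / z ∈ cutPlane) :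
    AnalyticAt ℝ (fun u : ℂ => hypG1 ρ ν (starRingEnd ℂ u) (-u.arg)) z := by
  simp only [hypG1_conj_neg_arg]
  have h0 := Complex.slitPlane_ne_zero hz
  have h1 : AnalyticAt ℂ (fun z : ℂ => 1 / z) z := analyticAt_const.div analyticAt_id h0
  have hlog := analyticAt_conj_comp ((analyticAt_clog hz).restrictScalars (𝕜 := ℝ))
  have hinv := analyticAt_conj_comp (h1.restrictScalars (𝕜 := ℝ))
  have hF := analyticAt_real_comp (F := hypF1 ρ ν) (g := fun u => starRingEnd ℂ (1 / u))
    ((isGaussContinuation_hypF1 hν ρ).1 _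
    (conj_mem_cutPlane hz')) hinv
  simp only [map_div₀, map_one] at hF
  have he := analyticAt_real_comp (F := fun t => Complex.exp (-(ρ + ν) / 2 * t))
    (analyticAt_const.mul analyticAt_id).cexp hlog
  exact he.mul hF

/-- With the principal argument, the powers are exponentials of the principal logarithm and its
conjugate, real-analytic off (-∞, 0]. This covers (1, ∞), where the combination at zero is cut. -/
theorem analyticAt_combInfinity_arg (hμ : ∀ n : ℤ, μ ≠ n) {z : ℂ}
    (hz : z ∈ Complex.slitPlane) (hz' : 1 / z ∈ cutPlane) :
    AnalyticAt ℝ (fun u : ℂ => combInfinity ρ μ d u u.arg) z := by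
  have hν1 := add_int_ne_int hμ d
  have hν2 := sub_int_ne_int hμ d
  simp only [combInfinity, hypG2_eq_hypG1]
  exact ((analyticAt_const.mul (analyticAt_hypG1_arg hν1 hz hz')).mul
    (analyticAt_hypG1_conj_neg_arg hν2 hz hz')).add
    ((analyticAt_const.mul (analyticAt_hypG1_arg (neg_ne_int hν1) hz hz')).mul
    (analyticAt_hypG1_conj_neg_arg (neg_ne_int hν2) hz hz'))

theorem one_div_mem_closedBall {z : ℂ} (hz : 1 ≤ ‖z‖) : 1 / z ∈ Metric.closedBall (0 : ℂ) 1 := by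
  rw [mem_closedBall_zero_iff, norm_div, norm_one]
  exact div_le_one_of_le₀ hz (norm_nonneg _)

theorem continuousOn_one_div : ContinuousOn (fun z : ℂ => 1 / z) {z | 1 ≤ ‖z‖} := by
  refine continuousOn_const.div continuousOn_id fun z hz h => ?_
  have hz' : 1 ≤ ‖z‖ := hz
  have h' : z = 0 := h
  rw [h', norm_zero] at hz'
  linarith

theorem continuousWithinAt_hypG1_arg {ν : ℂ} (hν : ∀ n : ℤ, ν ≠ n) (hρ : ρ.re < 1 / 2) :
    ContinuousWithinAt (fun u : ℂ => hypG1 ρ ν u u.arg) {z | 1 ≤ ‖z‖} 1 := by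
  simp only [hypG1_arg]
  have hF := (continuousOn_hypF1 hν hρ).comp continuousOn_one_div
    (fun z hz => one_div_mem_closedBall hz) 1 (by simp)
  refine ContinuousWithinAt.mul ?_ hF
  have := (continuousAt_clog Complex.one_mem_slitPlane)
  exact (by fun_prop : ContinuousAt (fun u => Complex.exp (-(ρ + ν) / 2 * Complex.log u))
    1).continuousWithinAt

theorem continuousWithinAt_hypG1_conj_neg_arg {ν : ℂ} (hν : ∀ n : ℤ, ν ≠ n) (hρ : ρ.re < 1 / 2) :
    ContinuousWithinAt (fun u : ℂ => hypG1 ρ ν (starRingEnd ℂ u) (-u.arg)) {z | 1 ≤ ‖z‖} 1 := by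
  simp only [hypG1_conj_neg_arg]
  have hF := (continuousOn_hypF1 hν hρ).comp (continuousOn_one_div.comp
    Complex.continuous_conj.continuousOn (s := {z | 1 ≤ ‖z‖}) (fun z hz => by
      change 1 ≤ ‖starRingEnd ℂ z‖
      rw [Complex.norm_conj]; exact hz))
    (fun z hz => one_div_mem_closedBall (by rw [Complex.norm_conj]; exact hz)) 1 (by simp)
  refine ContinuousWithinAt.mul ?_ hF
  have h1 := (continuousAt_clog Complex.one_mem_slitPlane)
  have h2 : ContinuousAt (fun u => starRingEnd ℂ (Complex.log u)) 1 :=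
    Complex.continuous_conj.continuousAt.comp h1
  exact (by fun_prop : ContinuousAt (fun u => Complex.exp (-(ρ + ν) / 2 *
    starRingEnd ℂ (Complex.log u))) 1).continuousWithinAt

theorem continuousWithinAt_combInfinity_arg (hμ : ∀ n : ℤ, μ ≠ n) (hρ : ρ.re < 1 / 2) :
    ContinuousWithinAt (fun u : ℂ => combInfinity ρ μ d u u.arg) {z | 1 ≤ ‖z‖} 1 := by
  have hν1 := add_int_ne_int hμ d
  have hν2 := sub_int_ne_int hμ d
  simp only [combInfinity, hypG2_eq_hypG1]
  exact ((continuousWithinAt_const.mul (continuousWithinAt_hypG1_arg hν1 hρ)).mul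
    (continuousWithinAt_hypG1_conj_neg_arg hν2 hρ)).add
    ((continuousWithinAt_const.mul (continuousWithinAt_hypG1_arg (neg_ne_int hν1) hρ)).mul
    (continuousWithinAt_hypG1_conj_neg_arg (neg_ne_int hν2) hρ))

/-- The point 1 lies on the cut of both sides, so the identity does not apply there directly; it is
the limit of the identity at exp(it) as t decreases to 0. -/
theorem combInfinity_one (hμ : ∀ n : ℤ, μ ≠ n) (hρ : ρ.re < 1 / 2)
    (hpp : ∀ n : ℕ, ρ + μ + d ≠ -n) (hpm : ∀ n : ℕ, ρ + μ - d ≠ -n)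
    (hmp : ∀ n : ℕ, ρ - μ + d ≠ -n) (hmm : ∀ n : ℕ, ρ - μ - d ≠ -n) :
    combInfinity ρ μ d 1 (1 : ℂ).arg = combZero ρ μ d 1 := by
  have hc : ContinuousAt (fun t : ℝ => Complex.exp (t * Complex.I)) 0 := by fun_prop
  have h0 : Complex.exp ((0 : ℝ) * Complex.I) = 1 := by simp
  have hnorm : ∀ t : ℝ, ‖Complex.exp (t * Complex.I)‖ = 1 := Complex.norm_exp_ofReal_mul_I
  have t1 : Tendsto (fun t : ℝ => Complex.exp (t * Complex.I)) (𝓝[>] 0)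
      (𝓝[{z | 1 ≤ ‖z‖}] 1) := by
    refine tendsto_nhdsWithin_iff.2 ⟨?_, Eventually.of_forall fun t => (hnorm t).ge⟩
    rw [← h0]; exact hc.tendsto.mono_left nhdsWithin_le_nhds
  have t2 : Tendsto (fun t : ℝ => Complex.exp (t * Complex.I)) (𝓝[>] 0)
      (𝓝[Metric.closedBall 0 1] 1) := by
    refine tendsto_nhdsWithin_iff.2 ⟨?_, Eventually.of_forall fun t => by
      rw [mem_closedBall_zero_iff, hnorm]⟩
    rw [← h0]; exact hc.tendsto.mono_left nhdsWithin_le_nhds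
  have l1 := (continuousWithinAt_combInfinity_arg (d := d) hμ hρ).tendsto.comp t1
  have l2 := (continuousOn_combZero (d := d) hμ hρ 1 (by simp)).tendsto.comp t2
  refine tendsto_nhds_unique_of_eventuallyEq l1 l2 ?_
  filter_upwards [Ioo_mem_nhdsGT (Real.pi_pos)] with t ht
  have hz : Complex.exp (t * Complex.I) =
      ‖Complex.exp (t * Complex.I)‖ * Complex.exp (t * Complex.I) := by
    rw [hnorm]; simp
  simp only [Function.comp_apply]
  rw [← combInfinity_congr_arg ρ μ d (Complex.exp_ne_zero _) hz (eq_norm_mul_exp_arg _)]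
  exact combInfinity_eq_combZero hμ hpp hpm hmp hmm (Complex.exp_ne_zero _)
    ⟨ht.1, by linarith [ht.2, Real.pi_pos]⟩ hz

end Regularity

/-! ### The glued function -/

open Classical in
/-- The function equal to the combination at zero on the closed unit disc, and to the combination
at infinity outside. -/
noncomputable def combGlued (ρ μ : ℂ) (d : ℤ) (z : ℂ) : ℂ :=
  if ‖z‖ ≤ 1 then combZero ρ μ d z else combInfinity ρ μ d z z.arg

section Glued

variable {ρ μ : ℂ} {d : ℤ}

theorem combInfinity_arg_eq_combZero (hμ : ∀ n : ℤ, μ ≠ n)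
    (hpp : ∀ n : ℕ, ρ + μ + d ≠ -n) (hpm : ∀ n : ℕ, ρ + μ - d ≠ -n)
    (hmp : ∀ n : ℕ, ρ - μ + d ≠ -n) (hmm : ∀ n : ℕ, ρ - μ - d ≠ -n)
    {z : ℂ} (hz : z ∈ posCutPlane) : combInfinity ρ μ d z z.arg = combZero ρ μ d z := by
  obtain ⟨θ, hθ, h⟩ := exists_arg_mem_Ioo hz
  have hz0 := ne_zero_of_mem_posCutPlane hz
  rw [← combInfinity_congr_arg ρ μ d hz0 h (eq_norm_mul_exp_arg z)]
  exact combInfinity_eq_combZero hμ hpp hpm hmp hmm hz0 hθ h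

theorem combGlued_eq_combZero (hμ : ∀ n : ℤ, μ ≠ n)
    (hpp : ∀ n : ℕ, ρ + μ + d ≠ -n) (hpm : ∀ n : ℕ, ρ + μ - d ≠ -n)
    (hmp : ∀ n : ℕ, ρ - μ + d ≠ -n) (hmm : ∀ n : ℕ, ρ - μ - d ≠ -n)
    {z : ℂ} (hz : z ∉ Complex.ofReal '' Set.Ioi (1 : ℝ)) :
    combGlued ρ μ d z = combZero ρ μ d z := by
  rw [combGlued]
  split_ifs with h
  · rfl
  · refine combInfinity_arg_eq_combZero hμ hpp hpm hmp hmm ?_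
    rw [mem_posCutPlane_iff]
    rintro ⟨x, hx, rfl⟩
    have hx0 : (0 : ℝ) ≤ x := hx
    refine hz ⟨x, ?_, rfl⟩
    simpa [abs_of_nonneg hx0] using h

theorem combGlued_eq_combInfinity_arg (hμ : ∀ n : ℤ, μ ≠ n) (hρ : ρ.re < 1 / 2)
    (hpp : ∀ n : ℕ, ρ + μ + d ≠ -n) (hpm : ∀ n : ℕ, ρ + μ - d ≠ -n)
    (hmp : ∀ n : ℕ, ρ - μ + d ≠ -n) (hmm : ∀ n : ℕ, ρ - μ - d ≠ -n)
    {z : ℂ} (hz : z ∉ Complex.ofReal '' Set.Ico (0 : ℝ) 1) :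
    combGlued ρ μ d z = combInfinity ρ μ d z z.arg := by
  rw [combGlued]
  split_ifs with h
  · by_cases hp : z ∈ posCutPlane
    · exact (combInfinity_arg_eq_combZero hμ hpp hpm hmp hmm hp).symm
    · rw [mem_posCutPlane_iff, not_not] at hp
      obtain ⟨x, hx, rfl⟩ := hp
      have hx0 : (0 : ℝ) ≤ x := hx
      have hx1 : x ≤ 1 := by simpa [abs_of_nonneg hx0] using h
      have : x = 1 := by
        by_contra hne
        exact hz ⟨x, ⟨hx0, lt_of_le_of_ne hx1 hne⟩, rfl⟩
      rw [this, Complex.ofReal_one]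
      exact (combInfinity_one hμ hρ hpp hpm hmp hmm).symm
  · rfl

theorem cutPlane_notMem_Ioi {z : ℂ} (hz : z ∈ cutPlane) : z ∉ Complex.ofReal '' Set.Ioi (1 : ℝ) := by
  rintro ⟨x, hx, rfl⟩
  exact hz ⟨x, Set.mem_Ici.2 (Set.mem_Ioi.1 hx).le, rfl⟩

/-- Off [1, ∞) the glued function is locally the combination at zero; near a point of (1, ∞) it is
the combination at infinity by definition. Only 0, because of |z|, and the branch point 1 are
excluded. -/
theorem analyticAt_combGlued (hμ : ∀ n : ℤ, μ ≠ n)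
    (hpp : ∀ n : ℕ, ρ + μ + d ≠ -n) (hpm : ∀ n : ℕ, ρ + μ - d ≠ -n)
    (hmp : ∀ n : ℕ, ρ - μ + d ≠ -n) (hmm : ∀ n : ℕ, ρ - μ - d ≠ -n)
    {z : ℂ} (h0 : z ≠ 0) (h1 : z ≠ 1) : AnalyticAt ℝ (combGlued ρ μ d) z := by
  by_cases hz : z ∈ cutPlane
  · refine (analyticAt_combZero_comp (ρ := ρ) (d := d) hμ analyticAt_id
      (analyticAt_ofReal_norm h0) hz).congr ?_
    filter_upwards [isOpen_cutPlane.mem_nhds hz] with y hy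
    exact (combGlued_eq_combZero hμ hpp hpm hmp hmm (cutPlane_notMem_Ioi hy)).symm
  · rw [cutPlane, Set.notMem_compl_iff] at hz
    obtain ⟨x, hx, rfl⟩ := hz
    have hx1 : 1 < x := lt_of_le_of_ne hx fun h => h1 (by rw [← h, Complex.ofReal_one])
    have hs : (x : ℂ) ∈ Complex.slitPlane := by left; simp; linarith
    have hinv : 1 / (x : ℂ) ∈ cutPlane := by
      refine ball_subset_cutPlane ?_
      rw [mem_ball_zero_iff, norm_div, norm_one, Complex.norm_real,
        Real.norm_of_nonneg (by linarith)]
      exact (div_lt_one (by linarith)).2 hx1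
    refine (analyticAt_combInfinity_arg (ρ := ρ) (d := d) hμ hs hinv).congr ?_
    have hopen : IsOpen {y : ℂ | 1 < ‖y‖} := isOpen_lt continuous_const continuous_norm
    have hmem : (x : ℂ) ∈ {y : ℂ | 1 < ‖y‖} := by
      change 1 < ‖(x : ℂ)‖
      rw [Complex.norm_real, Real.norm_of_nonneg (by linarith)]; exact hx1
    filter_upwards [hopen.mem_nhds hmem] with y hy
    rw [combGlued, if_neg (not_le.2 hy)]

theorem analyticAt_combGlued_sq (hμ : ∀ n : ℤ, μ ≠ n)
    (hpp : ∀ n : ℕ, ρ + μ + d ≠ -n) (hpm : ∀ n : ℕ, ρ + μ - d ≠ -n)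
    (hmp : ∀ n : ℕ, ρ - μ + d ≠ -n) (hmm : ∀ n : ℕ, ρ - μ - d ≠ -n)
    {w : ℂ} (hw : w ^ 2 ≠ 1) : AnalyticAt ℝ (fun u : ℂ => combGlued ρ μ d (u ^ 2)) w := by
  have hsq : AnalyticAt ℝ (fun u : ℂ => u ^ 2) w := analyticAt_id.pow 2
  by_cases h0 : w = 0
  · have hmem : w ^ 2 ∈ cutPlane := ball_subset_cutPlane (by simp [h0])
    have hn : AnalyticAt ℝ (fun u : ℂ => (‖u ^ 2‖ : ℂ)) w := by
      -- |u²| = u ū is a real polynomial in u, so the singularity of the modulus at 0 disappears.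
      have := analyticAt_id.mul (analyticAt_conj_comp (analyticAt_id (𝕜 := ℝ) (z := w)))
      refine this.congr (Eventually.of_forall fun u => ?_)
      simp only [Pi.mul_apply, id, Complex.mul_conj, Complex.normSq_eq_norm_sq, norm_pow]
    refine (analyticAt_combZero_comp (ρ := ρ) (d := d) hμ hsq hn hmem).congr ?_
    filter_upwards [hsq.continuousAt.preimage_mem_nhds (isOpen_cutPlane.mem_nhds hmem)] with y hy
    exact (combGlued_eq_combZero hμ hpp hpm hmp hmm (cutPlane_notMem_Ioi hy)).symm
  · exact AnalyticAt.fun_comp (g := combGlued ρ μ d) (f := fun u : ℂ => u ^ 2)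
      (analyticAt_combGlued hμ hpp hpm hmp hmm (pow_ne_zero 2 h0) hw) hsq

/-- Only 0 and 1 are not covered by analyticity. The point 0 is interior to the closed disc; at 1
the closed disc and its closed exterior cover the plane, and continuity within each of them
suffices. -/
theorem continuous_combGlued (hμ : ∀ n : ℤ, μ ≠ n) (hρ : ρ.re < 1 / 2)
    (hpp : ∀ n : ℕ, ρ + μ + d ≠ -n) (hpm : ∀ n : ℕ, ρ + μ - d ≠ -n)
    (hmp : ∀ n : ℕ, ρ - μ + d ≠ -n) (hmm : ∀ n : ℕ, ρ - μ - d ≠ -n) :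
    Continuous (combGlued ρ μ d) := by
  have hball : Set.EqOn (combGlued ρ μ d) (combZero ρ μ d) (Metric.closedBall 0 1) :=
    fun z hz => if_pos (by simpa using hz)
  have hcb := (continuousOn_combZero (d := d) hμ hρ).congr hball
  rw [continuous_iff_continuousAt]
  intro z
  by_cases h0 : z = 0
  · subst h0
    exact hcb.continuousAt (Metric.closedBall_mem_nhds _ one_pos)
  by_cases h1 : z = 1
  · subst h1
    have hout : ContinuousWithinAt (combGlued ρ μ d) {z | 1 ≤ ‖z‖} 1 := by
      have heq : ∀ z ∈ {z : ℂ | 1 ≤ ‖z‖},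
          combGlued ρ μ d z = combInfinity ρ μ d z z.arg := fun z hz => by
        refine combGlued_eq_combInfinity_arg hμ hρ hpp hpm hmp hmm ?_
        rintro ⟨x, hx, rfl⟩
        have hz' : 1 ≤ ‖(x : ℂ)‖ := hz
        rw [Complex.norm_real, Real.norm_of_nonneg hx.1] at hz'
        linarith [hx.2]
      exact (continuousWithinAt_combInfinity_arg hμ hρ).congr heq (heq 1 (by simp))
    have hun := (hcb 1 (by simp)).union hout
    have huniv : Metric.closedBall (0 : ℂ) 1 ∪ {z | 1 ≤ ‖z‖} = Set.univ := by
      refine Set.eq_univ_of_forall fun z => ?_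
      rcases le_total ‖z‖ 1 with h | h
      · exact Or.inl (by simpa using h)
      · exact Or.inr h
    rwa [huniv, continuousWithinAt_univ] at hun
  · exact (analyticAt_combGlued hμ hpp hpm hmp hmm h0 h1).continuousAt

end Glued

end HypergeometricConnection

theorem proposition3p2 (ρ μ : ℂ) (d : ℤ)
    (hμ : ∀ n : ℤ, μ ≠ n)
    (hpp : ∀ n : ℕ, ρ + μ + d ≠ -n) (hpm : ∀ n : ℕ, ρ + μ - d ≠ -n)
    (hmp : ∀ n : ℕ, ρ - μ + d ≠ -n) (hmm : ∀ n : ℕ, ρ - μ - d ≠ -n) :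
    (∀ (z : ℂ) (θ : ℝ), z ≠ 0 → θ ∈ Set.Ioo 0 (2 * Real.pi) →
      z = ‖z‖ * Complex.exp (θ * Complex.I) →
      combInfinity ρ μ d z θ = combZero ρ μ d z) ∧
    (ρ.re < 1 / 2 →
      ∃ f : ℂ → ℂ,
        (∀ (z : ℂ) (θ : ℝ), z ∉ Complex.ofReal '' Set.Ico (0 : ℝ) 1 →
          z = ‖z‖ * Complex.exp (θ * Complex.I) → f z = combInfinity ρ μ d z θ) ∧
        (∀ z : ℂ, z ∉ Complex.ofReal '' Set.Ioi (1 : ℝ) → f z = combZero ρ μ d z) ∧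
        Continuous f ∧
        (∀ z : ℂ, z ≠ 0 → z ≠ 1 → AnalyticAt ℝ f z) ∧
        (∀ w : ℂ, w ^ 2 ≠ 1 → AnalyticAt ℝ (fun u : ℂ => f (u ^ 2)) w)) := by
  refine ⟨fun z θ hz hθ h => combInfinity_eq_combZero hμ hpp hpm hmp hmm hz hθ h, fun hρ =>
    ⟨combGlued ρ μ d, fun z θ hz h => ?_,
      fun z hz => combGlued_eq_combZero hμ hpp hpm hmp hmm hz,
      continuous_combGlued hμ hρ hpp hpm hmp hmm,
      fun z h0 h1 => analyticAt_combGlued hμ hpp hpm hmp hmm h0 h1,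
      fun w hw => analyticAt_combGlued_sq hμ hpp hpm hmp hmm hw⟩⟩
  have hz0 : z ≠ 0 := by
    rintro rfl
    exact hz ⟨0, by simp, Complex.ofReal_zero⟩
  rw [combGlued_eq_combInfinity_arg hμ hρ hpp hpm hmp hmm hz]
  exact combInfinity_congr_arg ρ μ d hz0 (eq_norm_mul_exp_arg z) h
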